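/- Let $d\in\{2,3\}$ and let $\Omega\subset\mathbb R^d$ be a cube of side length $\ell>0$, identified with the torus; all functions on $\Omega$ are periodic, $\langle\cdot,\cdot\rangle$ is the $L^2(\Omega)$ scalar product, $\|v\|_{H^1}^2=\|v\|_{L^2}^2+\|\nabla v\|_{L^2}^2$, and $\|r\|_{H^{-1}}=\sup_{v\in H^1(\Omega)}\langle r,v\rangle/\|v\|_{H^1}$. Assume: (i) $\gamma_\rho,\gamma_\eta>0$. (ii) For every $\omega=(\rho,\eta,p,q)\in\mathbb R\times\mathbb R\times\mathbb R^d\times\mathbb R^d$ the matrix $\mathbf L(\omega)=\begin{pmatrix}\mathbf L_{11}&\mathbf L_{12}\\ \mathbf L_{12}^\top&\mathbf L_{22}\end{pmatrix}\in\mathbb R^{(d+1)\times(d+1)}$ (with $\mathbf L_{11}\in\mathbb R^{d\times d}$, $\mathbf L_{12}\in\mathbb R^{d}$, $\mathbf L_{22}\in\mathbb R$) is symmetric with $\lambda_1|\xi|^2\le\xi^\top\mathbf L(\omega)\xi\le\lambda_2|\xi|^2$ for all $\xi$, where $\lambda_1>0$, and its entries are $C^2$ functions of $\omega$ with first and second derivatives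 bounded by $\lambda_3$. (iii) $f:\mathbb R^2\to[0,\infty)$ is smooth, $|\partial_\rho^k\partial_\eta^l f(\rho,\eta)|\le c_1(|\rho|^{4-k-l}+|\eta|^{4-k-l})+c_2$ for all $k+l\le4$, and $f(\rho,\eta)+\frac\alpha2(\rho^2+\eta^2)$ is strongly convex with modulus $\kappa$, where $\alpha,\kappa>0$. Write $f_\rho,f_\eta$ for the partial derivatives of $f$. (iv) $\mathcal T_h$ is a geometrically conforming partition of $\Omega$ into simplices whose periodic extension is also conforming, quasi-uniform with constant $\sigma>0$ (that is, $\sigma h\le\rho_K\le h_K\le h$ for all $K\in\mathcal T_h$, with inradius $\rho_K$, diameter $h_K$ and $h=\max_K h_K$), and $\mathcal V_h=\{v\in H^1(\Omega): v|_K\in P_2(K)\ \forall K\in\mathcal T_h\}$. (v) $\tau=T/N$ with $T>0$ and an integer $N\ge1$, $t^n=n\tau$, $I_n=(t^{n-1},t^n)$. $P_1^c(\mathcal V_h)$ and $P_0(\mathcal V_h)$ are the continuous piecewise affine and the piecewise constant functions of time on this grid with values in $\mathcal V_h$, $\bar u$ is the piecewise constant $L^2$-projection of $u$ in time, and $\langle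 a,b\rangle^n=\int_{I_n}\langle a(s),b(s)\rangle\,ds$. Let $\rho,\eta\in P_1^c(\mathcal V_h)$ and $\bar\mu_\rho,\bar\mu_\eta\in P_0(\mathcal V_h)$ be a discrete solution with initial values $\rho(0)=\rho_0\in\mathcal V_h$, $\eta(0)=\eta_0\in\mathcal V_h$, that is, with $\bar{\mathbf L}=\mathbf L(\bar\rho,\bar\eta,\nabla\bar\rho,\nabla\bar\eta)$, \begin{align*} \langle\partial_t\rho,v_1\rangle^n+\langle\bar{\mathbf L}_{11}\nabla\bar\mu_\rho+\bar\mu_\eta\bar{\mathbf L}_{12},\nabla v_1\rangle^n&=0,\\ \langle\partial_t\eta,v_2\rangle^n+\langle\bar{\mathbf L}_{12}\cdot\nabla\bar\mu_\rho+\bar{\mathbf L}_{22}\bar\mu_\eta,v_2\rangle^n&=0,\\ \langle\bar\mu_\rho,w_1\rangle^n-\gamma_\rho\langle\nabla\bar\rho,\nabla w_1\rangle^n-\langle f_\rho(\rho,\eta),w_1\rangle^n&=0,\\ \langle\bar\mu_\eta,w_2\rangle^n-\gamma_\eta\langle\nabla\bar\eta,\nabla w_2\rangle^n-\langle f_\eta(\rho,\eta),w_2\rangle^n&=0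 \end{align*} for all $v_1,v_2,w_1,w_2\in\mathcal V_h$ and $1\le n\le N$. Let $\hat\rho,\hat\eta\in P_1^c(\mathcal V_h)$ and $\hat{\bar\mu}_\rho,\hat{\bar\mu}_\eta\in P_0(\mathcal V_h)$ satisfy the same four equations, with the same matrix $\bar{\mathbf L}$ (evaluated at $(\rho,\eta)$), but with the right-hand sides $0$ replaced by $\langle\bar r_1,v_1\rangle^n$, $\langle\bar r_2,v_2\rangle^n$, $\langle\bar r_3,w_1\rangle^n$, $\langle\bar r_4,w_2\rangle^n$, where $\bar r_i\in P_0(\mathcal V_h)$. Let $M$ be a bound for $\|\rho_0\|_{H^1}$, $\|\eta_0\|_{H^1}$, for $\|\hat\rho(t)\|_{H^1}$, $\|\hat\eta(t)\|_{H^1}$ on $[0,T]$, and for $\|\partial_t\hat\rho\|_{L^2}$, $\|\partial_t\hat\eta\|_{L^2}$ on all $I_n$. Define \begin{align*} \mathcal E_\alpha(\rho,\eta|\hat\rho,\hat\eta)=\int_\Omega&\tfrac{\gamma_\rho}2|\nabla(\rho-\hat\rho)|^2+\tfrac{\gamma_\eta}2|\nabla(\eta-\hat\eta)|^2+\tfrac\alpha2|\rho-\hat\rho|^2+\tfrac\alpha2|\eta-\hat\eta|^2\\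 &+f(\rho,\eta)-f(\hat\rho,\hat\eta)-f_\rho(\hat\rho,\hat\eta)(\rho-\hat\rho)-f_\eta(\hat\rho,\hat\eta)(\eta-\hat\eta), \end{align*} $$\bar{\mathcal D}(m,q)=\int_\Omega\begin{pmatrix}\nabla m\\ q\end{pmatrix}^{\!\top}\bar{\mathbf L}\begin{pmatrix}\nabla m\\ q\end{pmatrix}.$$ Then for every $1\le n\le N$ \begin{align*} \mathcal E_\alpha(\rho,\eta|\hat\rho,\hat\eta)\Big|_{t^{n-1}}^{t^n}&+C_1\int_{I_n}\bar{\mathcal D}(\bar\mu_\rho-\hat{\bar\mu}_\rho,\bar\mu_\eta-\hat{\bar\mu}_\eta)\,ds\le C_2\int_{I_n}\mathcal E_\alpha(\rho,\eta|\hat\rho,\hat\eta)\,ds\\ &+C_3\int_{I_n}\|\bar r_1\|_{H^{-1}}^2+\|\bar r_2\|_{L^2}^2+\|\bar r_3\|_{H^1}^2+\|\bar r_4\|_{L^2}^2\,ds \end{align*} with positive constants $C_1,C_2,C_3$ that depend only on $d,\ell,T,\gamma_\rho,\gamma_\eta,\lambda_1,\lambda_2,\lambda_3,c_1,c_2,\alpha,\kappa,\sigma$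 and $M$ (in particular not on $h$, $\tau$, $n$). -/

import Mathlib

open scoped ContDiff

noncomputable section

namespace CHAC

/-! ### Periodic Sobolev space of order one on the cube -/

/-- The ambient Euclidean space. -/
abbrev E (d : ℕ) := EuclideanSpace ℝ (Fin d)

/-- The periodicity cell: a half-open cube of side length `ℓ`. -/
def cube (d : ℕ) (ℓ : ℝ) : Set (E d) := {x | ∀ i, x i ∈ Set.Ico 0 ℓ}

/-- `ℓ`-periodicity in every coordinate direction. -/
def IsPeriodic {d : ℕ} {F : Type*} (ℓ : ℝ) (u : E d → F) : Prop :=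
  ∀ i : Fin d, Function.Periodic u (EuclideanSpace.single i ℓ)

/-- `g` is the weak gradient of the periodic function `u`; it is periodic and square integrable
over the periodicity cell. -/
structure IsWeakGrad {d : ℕ} (ℓ : ℝ) (u : E d → ℝ) (g : E d → E d) : Prop where
  periodic : IsPeriodic ℓ g
  memLp : MeasureTheory.MemLp g 2 (MeasureTheory.volume.restrict (cube d ℓ))
  integral_eq : ∀ φ : E d → ℝ, ContDiff ℝ ∞ φ → HasCompactSupport φ → ∀ i : Fin d,
    ∫ x, u x * fderiv ℝ φ x (EuclideanSpace.single i 1) = - ∫ x, g x i * φ x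

/-- The space `H¹(Ω)` of periodic functions. -/
structure MemH1 {d : ℕ} (ℓ : ℝ) (u : E d → ℝ) : Prop where
  periodic : IsPeriodic ℓ u
  memLp : MeasureTheory.MemLp u 2 (MeasureTheory.volume.restrict (cube d ℓ))
  exists_grad : ∃ g, IsWeakGrad ℓ u g

open Classical in
/-- The weak gradient (unique up to a null set; zero if there is none). -/
def wgrad {d : ℕ} (ℓ : ℝ) (u : E d → ℝ) : E d → E d :=
  if h : ∃ g, IsWeakGrad ℓ u g then h.choose else 0

/-- The `L²(Ω)` scalar product. -/
def ip {d : ℕ} (ℓ : ℝ) (u v : E d → ℝ) : ℝ := ∫ x in cube d ℓ, u x * v x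

/-- The `L²(Ω)` scalar product of vector fields. -/
def ipv {d : ℕ} (ℓ : ℝ) (u v : E d → E d) : ℝ := ∫ x in cube d ℓ, inner ℝ (u x) (v x)

/-- The norm of `L²(Ω)`. -/
def normL2 {d : ℕ} (ℓ : ℝ) (u : E d → ℝ) : ℝ := Real.sqrt (ip ℓ u u)

/-- The norm of `H¹(Ω)`. -/
def normH1 {d : ℕ} (ℓ : ℝ) (u : E d → ℝ) : ℝ :=
  Real.sqrt (ip ℓ u u + ipv ℓ (wgrad ℓ u) (wgrad ℓ u))

/-- The dual norm of `H⁻¹(Ω)` of a square integrable function. -/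
def normHneg1 {d : ℕ} (ℓ : ℝ) (r : E d → ℝ) : ℝ :=
  sSup {q : ℝ | ∃ v : E d → ℝ, MemH1 ℓ v ∧ q = ip ℓ r v / normH1 ℓ v}

/-! ### Meshes and finite elements -/

/-- The lattice vector `ℓ k`. -/
def latticeVec {d : ℕ} (ℓ : ℝ) (k : Fin d → ℤ) : E d := WithLp.toLp 2 (fun i => ℓ * (k i : ℝ))

/-- A partition of the closed cube into `d`-simplices (given by their vertex sets) whose periodic
extension is geometrically conforming: any two cells of the extension meet in the convex hull of
their common vertices. -/
structure PeriodicMesh (d : ℕ) (ℓ : ℝ) where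
  cells : Finset (Finset (E d))
  card_cell : ∀ K ∈ cells, K.card = d + 1
  affineIndependent : ∀ K ∈ cells, AffineIndependent ℝ (fun x : K => (x : E d))
  cover : (⋃ K ∈ cells, convexHull ℝ (K : Set (E d))) = {x | ∀ i, x i ∈ Set.Icc 0 ℓ}
  conforming : ∀ K ∈ cells, ∀ K' ∈ cells, ∀ k : Fin d → ℤ,
    convexHull ℝ (K : Set (E d)) ∩
        (fun x => latticeVec ℓ k + x) '' convexHull ℝ (K' : Set (E d)) =
      convexHull ℝ ((K : Set (E d)) ∩ (fun x => latticeVec ℓ k + x) '' (K' : Set (E d)))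

/-- The radius of the largest ball contained in `s`. -/
def inradius {d : ℕ} (s : Set (E d)) : ℝ := sSup {r : ℝ | ∃ x, Metric.closedBall x r ⊆ s}

/-- The global mesh size, the largest diameter of a cell. -/
def PeriodicMesh.meshSize {d : ℕ} {ℓ : ℝ} (T : PeriodicMesh d ℓ) : ℝ :=
  sSup ((fun K : Finset (E d) => Metric.diam (convexHull ℝ (K : Set (E d)))) '' T.cells)

/-- Quasi-uniformity with constant `σ`. -/
def PeriodicMesh.QuasiUniform {d : ℕ} {ℓ : ℝ} (T : PeriodicMesh d ℓ) (σ : ℝ) : Prop :=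
  0 < σ ∧ ∀ K ∈ T.cells,
    σ * T.meshSize ≤ inradius (convexHull ℝ (K : Set (E d))) ∧
    inradius (convexHull ℝ (K : Set (E d))) ≤ Metric.diam (convexHull ℝ (K : Set (E d))) ∧
    Metric.diam (convexHull ℝ (K : Set (E d))) ≤ T.meshSize

/-- Periodic `H¹` functions that are quadratic polynomials on every (closed) cell. -/
def PeriodicMesh.Vh {d : ℕ} {ℓ : ℝ} (T : PeriodicMesh d ℓ) : Set (E d → ℝ) :=
  {v | MemH1 ℓ v ∧ ∀ K ∈ T.cells, ∃ p : MvPolynomial (Fin d) ℝ, p.totalDegree ≤ 2 ∧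
    ∀ x ∈ convexHull ℝ (K : Set (E d)), v x = MvPolynomial.eval (fun i => x i) p}

/-! ### Functions of time. The step with index `n` is the interval from `n τ` to `(n + 1) τ`. -/

/-- The grid point `n τ`. -/
def node (τ : ℝ) (n : ℕ) : ℝ := n * τ

/-- Continuous functions of time that are affine on each of the `N` steps, with values in `V`. -/
def IsP1c {d : ℕ} (τ : ℝ) (N : ℕ) (V : Set (E d → ℝ)) (u : ℝ → E d → ℝ) : Prop :=
  ∀ n < N, ∃ a ∈ V, ∃ b ∈ V, ∀ t ∈ Set.Icc (node τ n) (node τ (n + 1)), ∀ x,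
    u t x = a x + (t - node τ n) * b x

/-- Functions of time that are constant on each of the `N` open steps, with values in `V`. -/
def IsP0 {d : ℕ} (τ : ℝ) (N : ℕ) (V : Set (E d → ℝ)) (u : ℝ → E d → ℝ) : Prop :=
  ∀ n < N, ∃ a ∈ V, ∀ t ∈ Set.Ioo (node τ n) (node τ (n + 1)), u t = a

/-- The time derivative. -/
def dt {d : ℕ} (u : ℝ → E d → ℝ) (t : ℝ) : E d → ℝ := fun x => deriv (fun s => u s x) t

/-- The value on the step `n` of the projection to piecewise constant functions of time. -/
def avg {d : ℕ} (τ : ℝ) (n : ℕ) (u : ℝ → E d → ℝ) : E d → ℝ :=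
  fun x => τ⁻¹ * ∫ s in (node τ n)..(node τ (n + 1)), u s x

/-! ### Model parameters -/

/-- Arguments `(ρ, η, ∇ρ, ∇η)` of the mobility. -/
abbrev State (d : ℕ) := ℝ × ℝ × E d × E d

/-- Mobility matrices, with a block of size `d` and a block of size `1`. -/
abbrev Mobility (d : ℕ) := State d → Matrix (Fin d ⊕ Unit) (Fin d ⊕ Unit) ℝ

/-- Assumptions on the mobility matrix. -/
structure MobilityAssumption {d : ℕ} (lam₁ lam₂ lam₃ : ℝ) (L : Mobility d) : Prop where
  symm : ∀ z, (L z).IsSymm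
  lower : ∀ z, ∀ ξ : Fin d ⊕ Unit → ℝ, lam₁ * (ξ ⬝ᵥ ξ) ≤ ξ ⬝ᵥ (L z).mulVec ξ
  upper : ∀ z, ∀ ξ : Fin d ⊕ Unit → ℝ, ξ ⬝ᵥ (L z).mulVec ξ ≤ lam₂ * (ξ ⬝ᵥ ξ)
  contDiff : ∀ i j, ContDiff ℝ 2 (fun z => L z i j)
  bound₁ : ∀ i j z, ‖fderiv ℝ (fun z => L z i j) z‖ ≤ lam₃
  bound₂ : ∀ i j z, ‖iteratedFDeriv ℝ 2 (fun z => L z i j) z‖ ≤ lam₃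

/-- Assumptions on the potential: smoothness, nonnegativity, quartic growth, and uniform convexity
with modulus `κ` of the potential shifted by `α / 2` times the squared Euclidean norm. -/
structure PotentialAssumption (c₁ c₂ α κ : ℝ) (f : ℝ → ℝ → ℝ) : Prop where
  smooth : ContDiff ℝ ∞ (fun p : ℝ × ℝ => f p.1 p.2)
  nonneg : ∀ a b, 0 ≤ f a b
  growth : ∀ k l : ℕ, k + l ≤ 4 → ∀ a b : ℝ,
    |iteratedDeriv k (fun r => iteratedDeriv l (fun s => f r s) b) a| ≤
      c₁ * (|a| ^ (4 - (k + l)) + |b| ^ (4 - (k + l))) + c₂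
  convex : ConvexOn ℝ Set.univ
    (fun p : ℝ × ℝ => f p.1 p.2 + α / 2 * (p.1 ^ 2 + p.2 ^ 2) - κ / 2 * (p.1 ^ 2 + p.2 ^ 2))

/-- Partial derivative with respect to the first argument. -/
def fρ (f : ℝ → ℝ → ℝ) (a b : ℝ) : ℝ := deriv (fun r => f r b) a

/-- Partial derivative with respect to the second argument. -/
def fη (f : ℝ → ℝ → ℝ) (a b : ℝ) : ℝ := deriv (fun s => f a s) b

/-! ### The numerical scheme -/

/-- The argument of the mobility on step `n`: the piecewise constant projection of
`(ρ, η, ∇ρ, ∇η)`. -/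
def stateBar {d : ℕ} (ℓ τ : ℝ) (n : ℕ) (ρ η : ℝ → E d → ℝ) (x : E d) : State d :=
  (avg τ n ρ x, avg τ n η x, wgrad ℓ (avg τ n ρ) x, wgrad ℓ (avg τ n η) x)

/-- `L₁₁ p + q L₁₂`. -/
def flux {d : ℕ} (A : Matrix (Fin d ⊕ Unit) (Fin d ⊕ Unit) ℝ) (p : E d) (q : ℝ) : E d :=
  WithLp.toLp 2 (fun i => (∑ j, A (Sum.inl i) (Sum.inl j) * p j) + q * A (Sum.inl i) (Sum.inr ()))

/-- `L₁₂ · p + L₂₂ q`. -/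
def source {d : ℕ} (A : Matrix (Fin d ⊕ Unit) (Fin d ⊕ Unit) ℝ) (p : E d) (q : ℝ) : ℝ :=
  (∑ j, A (Sum.inl j) (Sum.inr ()) * p j) + A (Sum.inr ()) (Sum.inr ()) * q

/-- The first form: `⟨∂ₜρ, v⟩ⁿ + ⟨L₁₁ ∇μρ + μη L₁₂, ∇v⟩ⁿ`, with `L` evaluated along the
field `z`. -/
def form₁ {d : ℕ} (ℓ τ : ℝ) (n : ℕ) (L : Mobility d) (z : E d → State d)
    (ρ μρ μη : ℝ → E d → ℝ) (v : E d → ℝ) : ℝ :=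
  (∫ t in (node τ n)..(node τ (n + 1)), ip ℓ (dt ρ t) v) +
    ∫ t in (node τ n)..(node τ (n + 1)),
      ipv ℓ (fun x => flux (L (z x)) (wgrad ℓ (μρ t) x) (μη t x)) (wgrad ℓ v)

/-- The second form: `⟨∂ₜη, v⟩ⁿ + ⟨L₁₂ · ∇μρ + L₂₂ μη, v⟩ⁿ`. -/
def form₂ {d : ℕ} (ℓ τ : ℝ) (n : ℕ) (L : Mobility d) (z : E d → State d)
    (η μρ μη : ℝ → E d → ℝ) (v : E d → ℝ) : ℝ :=
  (∫ t in (node τ n)..(node τ (n + 1)), ip ℓ (dt η t) v) +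
    ∫ t in (node τ n)..(node τ (n + 1)),
      ip ℓ (fun x => source (L (z x)) (wgrad ℓ (μρ t) x) (μη t x)) v

/-- The third and fourth form: `⟨μ, w⟩ⁿ - γ ⟨∇ū, ∇w⟩ⁿ - ⟨g(ρ, η), w⟩ⁿ`. -/
def form₃ {d : ℕ} (ℓ τ : ℝ) (n : ℕ) (γ : ℝ) (g : ℝ → ℝ → ℝ)
    (u ρ η μ : ℝ → E d → ℝ) (w : E d → ℝ) : ℝ :=
  (∫ t in (node τ n)..(node τ (n + 1)), ip ℓ (μ t) w)
    - γ * (∫ _t in (node τ n)..(node τ (n + 1)), ipv ℓ (wgrad ℓ (avg τ n u)) (wgrad ℓ w))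
    - ∫ t in (node τ n)..(node τ (n + 1)), ip ℓ (fun x => g (ρ t x) (η t x)) w

/-- `(ρ, η, μρ, μη)` is a discrete solution with initial values `ρ₀, η₀`. -/
structure IsDiscreteSolution {d : ℕ} (ℓ τ : ℝ) (N : ℕ) (V : Set (E d → ℝ)) (γρ γη : ℝ)
    (L : Mobility d) (f : ℝ → ℝ → ℝ) (ρ₀ η₀ : E d → ℝ) (ρ η μρ μη : ℝ → E d → ℝ) : Prop where
  ρ_mem : IsP1c τ N V ρ
  η_mem : IsP1c τ N V η
  μρ_mem : IsP0 τ N V μρ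
  μη_mem : IsP0 τ N V μη
  ρ_init : ρ 0 = ρ₀
  η_init : η 0 = η₀
  eq₁ : ∀ n < N, ∀ v ∈ V, form₁ ℓ τ n L (stateBar ℓ τ n ρ η) ρ μρ μη v = 0
  eq₂ : ∀ n < N, ∀ v ∈ V, form₂ ℓ τ n L (stateBar ℓ τ n ρ η) η μρ μη v = 0
  eq₃ : ∀ n < N, ∀ w ∈ V, form₃ ℓ τ n γρ (fρ f) ρ ρ η μρ w = 0
  eq₄ : ∀ n < N, ∀ w ∈ V, form₃ ℓ τ n γη (fη f) η ρ η μη w = 0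

/-- `(ρ', η', μρ', μη')` satisfies the scheme up to the residuals `r₁, …, r₄`, with the mobility
evaluated at `(ρ, η)`. -/
structure IsPerturbedSolution {d : ℕ} (ℓ τ : ℝ) (N : ℕ) (V : Set (E d → ℝ)) (γρ γη : ℝ)
    (L : Mobility d) (f : ℝ → ℝ → ℝ) (ρ η : ℝ → E d → ℝ) (ρ' η' μρ' μη' : ℝ → E d → ℝ)
    (r₁ r₂ r₃ r₄ : ℝ → E d → ℝ) : Prop where
  ρ_mem : IsP1c τ N V ρ'
  η_mem : IsP1c τ N V η'
  μρ_mem : IsP0 τ N V μρ'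
  μη_mem : IsP0 τ N V μη'
  r₁_mem : IsP0 τ N V r₁
  r₂_mem : IsP0 τ N V r₂
  r₃_mem : IsP0 τ N V r₃
  r₄_mem : IsP0 τ N V r₄
  eq₁ : ∀ n < N, ∀ v ∈ V, form₁ ℓ τ n L (stateBar ℓ τ n ρ η) ρ' μρ' μη' v =
    ∫ t in (node τ n)..(node τ (n + 1)), ip ℓ (r₁ t) v
  eq₂ : ∀ n < N, ∀ v ∈ V, form₂ ℓ τ n L (stateBar ℓ τ n ρ η) η' μρ' μη' v =
    ∫ t in (node τ n)..(node τ (n + 1)), ip ℓ (r₂ t) v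
  eq₃ : ∀ n < N, ∀ w ∈ V, form₃ ℓ τ n γρ (fρ f) ρ' ρ' η' μρ' w =
    ∫ t in (node τ n)..(node τ (n + 1)), ip ℓ (r₃ t) w
  eq₄ : ∀ n < N, ∀ w ∈ V, form₃ ℓ τ n γη (fη f) η' ρ' η' μη' w =
    ∫ t in (node τ n)..(node τ (n + 1)), ip ℓ (r₄ t) w

/-- `ρ` and `η` are bounded in `H¹` at all times, and their time derivatives in `L²`, by `M`. -/
structure IsBoundedBy {d : ℕ} (ℓ τ : ℝ) (N : ℕ) (M : ℝ) (ρ η : ℝ → E d → ℝ) : Prop where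
  ρ_H1 : ∀ t ∈ Set.Icc 0 (node τ N), normH1 ℓ (ρ t) ≤ M
  η_H1 : ∀ t ∈ Set.Icc 0 (node τ N), normH1 ℓ (η t) ≤ M
  ρ_dt : ∀ n < N, ∀ t ∈ Set.Ioo (node τ n) (node τ (n + 1)), normL2 ℓ (dt ρ t) ≤ M
  η_dt : ∀ n < N, ∀ t ∈ Set.Ioo (node τ n) (node τ (n + 1)), normL2 ℓ (dt η t) ≤ M

/-! ### Relative energy and dissipation -/

/-- The regularized relative energy of `(ρ, η)` with respect to `(ρ', η')`. -/
def relEnergy {d : ℕ} (ℓ γρ γη α : ℝ) (f : ℝ → ℝ → ℝ) (ρ η ρ' η' : E d → ℝ) : ℝ :=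
  ∫ x in cube d ℓ,
    (γρ / 2 * ‖wgrad ℓ (ρ - ρ') x‖ ^ 2 + γη / 2 * ‖wgrad ℓ (η - η') x‖ ^ 2
      + α / 2 * |ρ x - ρ' x| ^ 2 + α / 2 * |η x - η' x| ^ 2
      + f (ρ x) (η x) - f (ρ' x) (η' x)
      - fρ f (ρ' x) (η' x) * (ρ x - ρ' x) - fη f (ρ' x) (η' x) * (η x - η' x))

/-- The dissipation functional `⟨(∇m, q), L(z) (∇m, q)⟩`. -/
def dissipation {d : ℕ} (ℓ : ℝ) (L : Mobility d) (z : E d → State d) (m q : E d → ℝ) : ℝ :=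
  ∫ x in cube d ℓ,
    (Sum.elim (fun i => wgrad ℓ m x i) (fun _ => q x) : Fin d ⊕ Unit → ℝ) ⬝ᵥ
      (L (z x)).mulVec (Sum.elim (fun i => wgrad ℓ m x i) (fun _ => q x))

end CHAC

end

/-! The relative energy is, by convexity of `f` plus the `α`-term, bounded below by a multiple of
the squared `H¹` distance of the two solutions (`le_relEnergy`). The claim is therefore a one-step
stability estimate in `H¹`: the energy increment plus a fraction of the dissipation is to be
controlled by the time integral of the squared distance and by the residuals.

On one step the solutions are `a + s b`, `a' + s b'` (and `a₂ + s b₂`, `a₂' + s b₂'`), while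
potentials and residuals are constant in time. Differentiating the relative energy in `s` gives the
difference of the driving forces paired with `b - b'`, plus the second order Taylor remainder of
`∇f` paired with the velocity of the perturbed solution (`hasDerivAt_relPot`, `relEnergy_sub`). The
quadratic parts integrate exactly to midpoint values, and the midpoint is the time average used by
the scheme, so no time discretization error appears. The third and fourth equations, tested with `b
- b'` and `b₂ - b₂'`, turn the forces into `⟨b - b', (m - m') + r₃ + α e⟩`, where `e` is the
midpoint error, and analogously for the second component. This bracket lies in the discrete space,
hence is an admissible test function for the first equation. The result is minus the dissipation
plus perturbations (`IsStep.relEnergy_sub_eq`). Passing the term `r₃ + α e` through the evolution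
equation avoids any bound on `b - b'`, and it is why `r₃` enters in `H¹`.

Three perturbations remain. Those from `r₃ + α e` and its counterpart are absorbed by Young's
inequality for the mobility form. The pairing of `r₁` with `m - m'` needs the full `H¹` norm of `m -
m'`, but the dissipation controls only its gradient; Poincaré's inequality adds the mean, and the
third equation tested with the constant `1` bounds the mean (`IsStep.sq_mean_sub_le`). The Taylor
remainder is at most linear growth times a squared error times a velocity; with exponents `6`, `3`,
`2` and the embedding of `H¹` into `L⁶` it is bounded by the squared `H¹` distance
(`exists_taylor_integral_le`).

The last two steps need `H¹` bounds on the unperturbed solution, which come from its own energy law: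
the energy decreases, the mean of `ρ` is conserved, and the `L²` norm of `η` grows at a rate
governed by the dissipation already spent (`IsDiscreteSolution.invariants`, `exists_H1sq_bound`).

The analytic tools are proved only for periodic Lipschitz functions. This is enough because a
conforming piecewise polynomial is globally Lipschitz (`PeriodicMesh.lipPer_of_mem_Vh`). On this
class the weak gradient is the a.e. classical gradient and integrability is automatic, while the
Poincaré and Sobolev constants depend only on `d` and `ℓ`. -/

noncomputable section

namespace CHAC

open MeasureTheory Filter Topology
open scoped ENNReal NNReal

/-! ### Integration of periodic functions -/

section Periodic

variable {d : ℕ}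

/-- The basis of the lattice of periods. -/
def latBasis (d : ℕ) {ℓ : ℝ} (hℓ : 0 < ℓ) : Module.Basis (Fin d) ℝ (E d) :=
  (EuclideanSpace.basisFun (Fin d) ℝ).toBasis.unitsSMul (fun _ => Units.mk0 ℓ hℓ.ne')

lemma latBasis_apply {ℓ : ℝ} (hℓ : 0 < ℓ) (i : Fin d) :
    latBasis d hℓ i = EuclideanSpace.single i ℓ := by
  ext j
  simp [latBasis, Module.Basis.unitsSMul_apply, Units.smul_def]

lemma latBasis_repr {ℓ : ℝ} (hℓ : 0 < ℓ) (x : E d) (i : Fin d) :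
    (latBasis d hℓ).repr x i = ℓ⁻¹ * x i := by
  simp [latBasis, Module.Basis.repr_unitsSMul, Units.smul_def]

lemma cube_eq_fundamentalDomain {ℓ : ℝ} (hℓ : 0 < ℓ) :
    cube d ℓ = ZSpan.fundamentalDomain (latBasis d hℓ) := by
  ext x
  simp only [cube, Set.mem_ofPred_eq, ZSpan.mem_fundamentalDomain, latBasis_repr, Set.mem_Ico]
  refine forall_congr' fun i => and_congr ?_ ?_
  · constructor
    · intro h; positivity
    · intro h; by_contra! hx
      have := mul_neg_of_pos_of_neg (inv_pos.mpr hℓ) hx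
      linarith
  · rw [inv_mul_lt_iff₀ hℓ, mul_one]

lemma measurableSet_cube (d : ℕ) (ℓ : ℝ) : MeasurableSet (cube d ℓ) := by
  have : cube d ℓ = ⋂ i : Fin d, (fun x : E d => x i) ⁻¹' Set.Ico 0 ℓ := by
    ext x; simp [cube]
  rw [this]
  exact MeasurableSet.iInter fun i => (by fun_prop : Measurable fun x : E d => x i) measurableSet_Ico

/-- The closed cube. -/
def closedCube (d : ℕ) (ℓ : ℝ) : Set (E d) := {x | ∀ i, x i ∈ Set.Icc 0 ℓ}

lemma cube_subset_closedCube (d : ℕ) (ℓ : ℝ) : cube d ℓ ⊆ closedCube d ℓ :=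
  fun _ hx i => Set.Ico_subset_Icc_self (hx i)

lemma isCompact_closedCube (d : ℕ) (ℓ : ℝ) : IsCompact (closedCube d ℓ) := by
  have h : closedCube d ℓ = (EuclideanSpace.equiv (Fin d) ℝ).toHomeomorph ⁻¹'
      (Set.pi Set.univ fun _ => Set.Icc 0 ℓ) := by
    ext x; simp only [closedCube, Set.mem_ofPred_eq, Set.mem_preimage, Set.mem_univ_pi]; rfl
  rw [h, Homeomorph.isCompact_preimage]
  exact isCompact_univ_pi fun _ => isCompact_Icc

instance (d : ℕ) (ℓ : ℝ) : IsFiniteMeasure (volume.restrict (cube d ℓ)) :=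
  ⟨by
    rw [Measure.restrict_apply_univ]
    exact (measure_mono (cube_subset_closedCube d ℓ)).trans_lt
      (isCompact_closedCube d ℓ).measure_lt_top⟩

lemma IsPeriodic.vadd_eq {F : Type*} {ℓ : ℝ} (hℓ : 0 < ℓ) {u : E d → F} (hu : IsPeriodic ℓ u)
    (g : (Submodule.span ℤ (Set.range (latBasis d hℓ)))) (x : E d) :
    u (g +ᵥ x) = u x := by
  obtain ⟨g, hg⟩ := g
  have key : ∀ g ∈ Submodule.span ℤ (Set.range (latBasis d hℓ)), ∀ x, u (g + x) = u x := by
    intro g hg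
    induction hg using Submodule.span_induction with
    | mem y hy =>
      obtain ⟨i, rfl⟩ := hy
      intro x
      rw [latBasis_apply, add_comm]
      exact hu i x
    | zero => simp
    | add a b _ _ ha hb => intro x; rw [add_assoc, ha, hb]
    | smul c a _ ha =>
      intro x
      have h2 : Function.Periodic u a := fun x => by rw [add_comm]; exact ha x
      have := h2.zsmul c x
      rwa [add_comm]
  exact key g hg x

instance vaddInvariantMeasure_span {ℓ : ℝ} (hℓ : 0 < ℓ) :
    VAddInvariantMeasure (Submodule.span ℤ (Set.range (latBasis d hℓ))) (E d) volume :=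
  ⟨fun c s _ => measure_preimage_add volume (c : E d) s⟩

lemma isAddFundamentalDomain_cube {ℓ : ℝ} (hℓ : 0 < ℓ) :
    IsAddFundamentalDomain (Submodule.span ℤ (Set.range (latBasis d hℓ)))
      (cube d ℓ) volume := by
  rw [cube_eq_fundamentalDomain hℓ]
  exact ZSpan.isAddFundamentalDomain _ _

/-- The unique lattice representative of `x + z` in the cell is that of `x` in the shifted cell.
Comparing fundamental domains then makes integrals of periodic functions independent of the cell. -/
lemma isAddFundamentalDomain_translate {ℓ : ℝ} (hℓ : 0 < ℓ) (z : E d) :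
    IsAddFundamentalDomain (Submodule.span ℤ (Set.range (latBasis d hℓ)))
      ((fun x => x + z) ⁻¹' cube d ℓ) volume := by
  refine IsAddFundamentalDomain.mk' (((measurableSet_cube d ℓ).preimage
    (measurable_add_const z)).nullMeasurableSet) fun x => ?_
  have h := ZSpan.exist_unique_vadd_mem_fundamentalDomain (latBasis d hℓ) (x + z)
  rw [← cube_eq_fundamentalDomain hℓ] at h
  obtain ⟨v, hv, hv'⟩ := h
  refine ⟨v, ?_, fun y hy => hv' y ?_⟩
  · change ((v : E d) + x) + z ∈ cube d ℓ
    rw [add_assoc]; exact hv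
  · change ((y : E d) + x) + z ∈ cube d ℓ at hy
    change (y : E d) + (x + z) ∈ cube d ℓ
    rwa [← add_assoc]

lemma integral_cube_add {F : Type*} [NormedAddCommGroup F] [NormedSpace ℝ F] {ℓ : ℝ} (hℓ : 0 < ℓ)
    {u : E d → F} (hu : IsPeriodic ℓ u) (z : E d) :
    ∫ x in cube d ℓ, u (x + z) = ∫ x in cube d ℓ, u x := by
  have h1 : ∫ x in (fun x => x + -z) ⁻¹' cube d ℓ, u x = ∫ x in cube d ℓ, u x :=
    (isAddFundamentalDomain_translate hℓ (-z)).setIntegral_eq (isAddFundamentalDomain_cube hℓ)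
      (fun g x => hu.vadd_eq hℓ g x)
  rw [← h1, ← (measurePreserving_add_right volume z).setIntegral_preimage_emb
    (measurableEmbedding_addRight z) u ((fun x => x + -z) ⁻¹' cube d ℓ)]
  congr 2
  ext x; simp

lemma exists_finset_closedBall_subset {ℓ : ℝ} (hℓ : 0 < ℓ) (R : ℝ) :
    ∃ s : Finset (Fin d → ℤ), Metric.closedBall (0 : E d) R ⊆
      ⋃ k ∈ s, (fun x => x + latticeVec ℓ (-k)) ⁻¹' cube d ℓ := by
  obtain ⟨m, hm⟩ := exists_nat_ge (R / ℓ + 1)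
  let s : Finset (Fin d → ℤ) := Fintype.piFinset fun _ => Finset.Icc (-(m : ℤ)) m
  refine ⟨s, ?_⟩
  intro x hx
  simp only [Set.mem_iUnion, Set.mem_preimage]
  have hxi : ∀ i, |x i| ≤ R := fun i => by
    have := PiLp.norm_apply_le x i
    rw [Real.norm_eq_abs] at this
    exact this.trans (by simpa using hx)
  refine ⟨fun i => ⌊x i / ℓ⌋, ?_, fun i => ?_⟩
  · simp only [s, Fintype.mem_piFinset, Finset.mem_Icc]
    intro i
    have h1 : |x i / ℓ| ≤ R / ℓ := by
      rw [abs_div, abs_of_pos hℓ]; gcongr; exact hxi i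
    rw [abs_le] at h1
    constructor
    · rw [Int.le_floor]; push_cast; linarith
    · have := Int.floor_le (x i / ℓ)
      have h3 : ((⌊x i / ℓ⌋ : ℤ) : ℝ) ≤ (m : ℤ) := by push_cast; linarith
      exact_mod_cast h3
  · have h1 := Int.floor_le (x i / ℓ)
    have h2 := Int.lt_floor_add_one (x i / ℓ)
    rw [le_div_iff₀ hℓ] at h1
    rw [div_lt_iff₀ hℓ] at h2
    simp only [latticeVec, PiLp.add_apply, Pi.neg_apply, Int.cast_neg, Set.mem_Ico]
    constructor <;> nlinarith

/-- A ball is covered by finitely many lattice translates of the cell, each carrying the same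
integral. The number of cells does not depend on `u`; this carries whole-space inequalities over to
the torus. -/
lemma exists_lintegral_le_mul_cube {ℓ : ℝ} (hℓ : 0 < ℓ) (R : ℝ) :
    ∃ n : ℕ, ∀ u : E d → ℝ≥0∞, IsPeriodic ℓ u →
      ∫⁻ x in Metric.closedBall (0 : E d) R, u x ≤ n * ∫⁻ x in cube d ℓ, u x := by
  obtain ⟨s, hcov⟩ := exists_finset_closedBall_subset (d := d) hℓ R
  refine ⟨s.card, fun u hu => ?_⟩
  calc ∫⁻ x in Metric.closedBall (0 : E d) R, u x
      ≤ ∫⁻ x in ⋃ k ∈ s, (fun x => x + latticeVec ℓ (-k)) ⁻¹' cube d ℓ, u x :=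
        lintegral_mono_set hcov
    _ ≤ ∑ k ∈ s, ∫⁻ x in (fun x => x + latticeVec ℓ (-k)) ⁻¹' cube d ℓ, u x := by
        have : ⋃ k ∈ s, (fun x => x + latticeVec ℓ (-k)) ⁻¹' cube d ℓ =
          ⋃ k : s, (fun x => x + latticeVec ℓ (-(k : Fin d → ℤ))) ⁻¹' cube d ℓ :=
          Set.biUnion_eq_iUnion (s : Set (Fin d → ℤ)) _
        rw [this]
        refine (lintegral_iUnion_le _ _).trans_eq ?_
        rw [tsum_fintype]
        exact Finset.sum_coe_sort s
          fun k => ∫⁻ x in (fun x => x + latticeVec ℓ (-k)) ⁻¹' cube d ℓ, u x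
    _ = ∑ k ∈ s, ∫⁻ x in cube d ℓ, u x := Finset.sum_congr rfl fun k _ =>
        (isAddFundamentalDomain_translate hℓ _).setLIntegral_eq (isAddFundamentalDomain_cube hℓ) _
          (fun g x => hu.vadd_eq hℓ g x)
    _ = _ := by simp

lemma integrableOn_closedBall {F : Type*} [NormedAddCommGroup F] {ℓ : ℝ} (hℓ : 0 < ℓ)
    {u : E d → F} (hu : IsPeriodic ℓ u) (hi : IntegrableOn u (cube d ℓ)) (R : ℝ) :
    IntegrableOn u (Metric.closedBall (0 : E d) R) := by
  obtain ⟨s, hcov⟩ := exists_finset_closedBall_subset (d := d) hℓ R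
  refine IntegrableOn.mono_set ?_ hcov
  rw [integrableOn_finset_iUnion]
  intro k _
  rwa [(isAddFundamentalDomain_translate hℓ _).integrableOn_iff (isAddFundamentalDomain_cube hℓ)
    (fun g x => hu.vadd_eq hℓ g x)]

lemma IsPeriodic.add_latticeVec {F : Type*} {ℓ : ℝ} (hℓ : 0 < ℓ) {u : E d → F}
    (hu : IsPeriodic ℓ u) (k : Fin d → ℤ) (x : E d) : u (x + latticeVec ℓ k) = u x := by
  have hk : latticeVec ℓ k ∈ Submodule.span ℤ (Set.range (latBasis d hℓ)) := by
    have : latticeVec ℓ k = ∑ i, k i • latBasis d hℓ i := by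
      ext j
      simp [latticeVec, latBasis_apply, mul_comm, Finset.sum_apply, WithLp.ofLp_sum, Pi.single_apply]
    rw [this]
    exact Submodule.sum_mem _ fun i _ => Submodule.smul_mem _ _
      (Submodule.subset_span (Set.mem_range_self i))
  rw [add_comm]
  exact hu.vadd_eq hℓ ⟨_, hk⟩ x

end Periodic

end CHAC
end

noncomputable section

namespace CHAC

open MeasureTheory Filter Topology
open scoped ENNReal NNReal

/-! ### Lipschitz continuity of piecewise polynomial functions -/

/-- Follow `f` along the segment. The closed pieces pull back to finitely many closed sets of times,
so from every time some piece recurs immediately to the right; along it the slope is at most `K *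
dist x y`. A mean value inequality that needs only the lower right slope then gives the bound
without ordering the pieces along the segment. -/
lemma dist_le_of_segment_cover {ι V : Type*} [NormedAddCommGroup V] [NormedSpace ℝ V]
    {f : V → ℝ} {K : ℝ≥0} {s : Finset ι} {S : ι → Set V} (hS : ∀ i ∈ s, IsClosed (S i))
    (hf : ∀ i ∈ s, LipschitzOnWith K f (S i)) {x y : V} (h : segment ℝ x y ⊆ ⋃ i ∈ s, S i) :
    f y - f x ≤ K * dist x y := by
  set φ : ℝ → V := fun t => AffineMap.lineMap x y t with hφ
  have hφc : Continuous φ := AffineMap.lineMap_continuous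
  let T : s → Set ℝ := fun i => φ ⁻¹' S i ∩ Set.Icc 0 1
  have hcov : Set.Icc (0 : ℝ) 1 = ⋃ i, T i := by
    ext t
    simp only [T, Set.mem_iUnion, Set.mem_inter_iff, Set.mem_preimage]
    constructor
    · intro ht
      have : φ t ∈ segment ℝ x y := by
        rw [segment_eq_image_lineMap]; exact ⟨t, ht, rfl⟩
      have := h this
      simp only [Set.mem_iUnion] at this
      obtain ⟨i, hi, hti⟩ := this
      exact ⟨⟨i, hi⟩, hti, ht⟩
    · rintro ⟨i, _, ht⟩; exact ht
  have hTc : ∀ i, IsClosed (T i) := fun i => ((hS i i.2).preimage hφc).inter isClosed_Icc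
  have hslope : ∀ i : s, ∀ a ∈ T i, ∀ b ∈ T i, f (φ b) - f (φ a) ≤ K * dist x y * |b - a| := by
    intro i a ha b hb
    have := (hf i i.2).dist_le_mul _ hb.1 _ ha.1
    rw [Real.dist_eq] at this
    have h2 : dist (φ b) (φ a) = |b - a| * dist x y := by
      simp [hφ, dist_lineMap_lineMap, Real.dist_eq]
    rw [h2] at this
    calc _ ≤ |f (φ b) - f (φ a)| := le_abs_self _
      _ ≤ _ := this
      _ = _ := by ring
  have hcont : ContinuousOn (fun t => f (φ t)) (Set.Icc 0 1) := by
    rw [hcov]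
    refine (locallyFinite_of_finite T).continuousOn_iUnion hTc fun i => ?_
    exact (hf i i.2).continuousOn.comp hφc.continuousOn fun t ht => ht.1
  have hB : ∀ t : ℝ, HasDerivAt (fun t => f x + K * dist x y * t) (K * dist x y) t := by
    intro t
    simpa using ((hasDerivAt_id t).const_mul (K * dist x y)).const_add (f x)
  have := image_le_of_liminf_slope_right_le_deriv_boundary (f := fun t => f (φ t)) hcont
    (B := fun t => f x + K * dist x y * t) (B' := fun _ => K * dist x y) (by simp [hφ])
    (fun t _ => (hB t).continuousAt.continuousWithinAt) (fun t _ => (hB t).hasDerivWithinAt)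
    ?_ (Set.right_mem_Icc.mpr zero_le_one)
  · simp only [hφ, AffineMap.lineMap_apply_one, mul_one] at this
    linarith
  · intro t ht r hr
    have hev : ∀ᶠ z in 𝓝[>] t, z ∈ Set.Ioc t 1 := Ioc_mem_nhdsGT ht.2
    -- Pigeonhole: finitely many sets cover a right neighbourhood of `t`, so one of them accumulates
    -- at `t`; being closed, it contains `t`.
    have hfr : ∃ i, ∃ᶠ z in 𝓝[>] t, z ∈ T i := by
      by_contra! hcon
      have : ∀ᶠ z in 𝓝[>] t, ∀ i, z ∉ T i := by
        rw [eventually_all]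
        intro i; exact hcon i
      obtain ⟨z, hz, hz'⟩ := (this.and hev).exists
      have hz1 : z ∈ Set.Icc (0 : ℝ) 1 := ⟨ht.1.trans hz'.1.le, hz'.2⟩
      rw [hcov, Set.mem_iUnion] at hz1
      obtain ⟨i, hi⟩ := hz1
      exact hz i hi
    obtain ⟨i, hi⟩ := hfr
    have hti : t ∈ T i := by
      have h1 : ∃ᶠ z in 𝓝 t, z ∈ T i := hi.filter_mono nhdsWithin_le_nhds
      exact (hTc i).mem_of_frequently_of_tendsto h1 tendsto_id
    refine (hi.and_eventually hev).mono fun z hz => lt_of_le_of_lt ?_ hr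
    have hzt : 0 < z - t := by have := hz.2.1; linarith
    rw [slope_def_field, div_le_iff₀ hzt]
    simpa [abs_of_pos hzt] using hslope i t hti z hz.1

/-- Periodic Lipschitz functions. -/
structure LipPer {d : ℕ} (ℓ : ℝ) (u : E d → ℝ) : Prop where
  periodic : IsPeriodic ℓ u
  lip : ∃ K, LipschitzWith K u

lemma contDiff_eval_mvPolynomial {d : ℕ} (p : MvPolynomial (Fin d) ℝ) :
    ContDiff ℝ 1 (fun x : E d => MvPolynomial.eval (fun i => x i) p) := by
  induction p using MvPolynomial.induction_on with
  | C a => simpa using contDiff_const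
  | add p q hp hq => simpa using hp.add hq
  | mul_X p i hp =>
    simp only [map_mul, MvPolynomial.eval_X]
    exact hp.mul (by fun_prop)

lemma convex_closedCube (d : ℕ) (ℓ : ℝ) : Convex ℝ (closedCube d ℓ) := by
  intro x hx y hy a b ha hb hab i
  have := convex_Icc 0 ℓ (hx i) (hy i) ha hb hab
  simpa using this

lemma exists_lipschitzOnWith_closedCube {d : ℕ} (ℓ : ℝ) {g : E d → ℝ} (hg : ContDiff ℝ 1 g) :
    ∃ K, LipschitzOnWith K g (closedCube d ℓ) := by
  have hc : Continuous fun x => ‖fderiv ℝ g x‖₊ := (hg.continuous_fderiv (by simp)).nnnorm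
  obtain ⟨K, hK⟩ := ((isCompact_closedCube d ℓ).image hc).bddAbove
  refine ⟨K, (convex_closedCube d ℓ).lipschitzOnWith_of_nnnorm_fderiv_le (𝕜 := ℝ)
    (fun x _ => (hg.differentiable (by simp)) x) fun x hx => hK ⟨x, hx, rfl⟩⟩

lemma PeriodicMesh.convexHull_subset {d : ℕ} {ℓ : ℝ} (T : PeriodicMesh d ℓ) {K : Finset (E d)}
    (hK : K ∈ T.cells) : convexHull ℝ (K : Set (E d)) ⊆ closedCube d ℓ := by
  have := T.cover
  intro x hx
  change x ∈ {x : E d | ∀ i, x i ∈ Set.Icc 0 ℓ}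
  rw [← this]
  exact Set.mem_biUnion hK hx

/-- On each closed cell `v` is a polynomial on a bounded set, hence Lipschitz, and there are
finitely many cells up to periodicity. Since the polynomial agrees with `v` on closed cells,
neighbouring pieces match and the constants propagate along segments. The Lipschitz constant depends
on `v` and the mesh and never enters a final estimate. -/
lemma PeriodicMesh.lipPer_of_mem_Vh {d : ℕ} {ℓ : ℝ} (hℓ : 0 < ℓ) (T : PeriodicMesh d ℓ)
    {v : E d → ℝ} (hv : v ∈ T.Vh) : LipPer ℓ v := by
  obtain ⟨hH, hp⟩ := hv
  refine ⟨hH.periodic, ?_⟩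
  have h1 : ∀ K ∈ T.cells, ∃ C, LipschitzOnWith C v (convexHull ℝ (K : Set (E d))) := by
    intro K hK
    obtain ⟨p, _, hpe⟩ := hp K hK
    obtain ⟨C, hC⟩ := exists_lipschitzOnWith_closedCube ℓ (contDiff_eval_mvPolynomial p)
    exact ⟨C, fun x hx y hy => by
      rw [hpe x hx, hpe y hy]; exact hC (T.convexHull_subset hK hx) (T.convexHull_subset hK hy)⟩
  choose! C hC using h1
  let C' := T.cells.sup C
  have hC' : ∀ K ∈ T.cells, LipschitzOnWith C' v (convexHull ℝ (K : Set (E d))) := fun K hK =>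
    (hC K hK).weaken (Finset.le_sup hK)
  refine ⟨C', LipschitzWith.of_le_add_mul _ fun y x => ?_⟩
  obtain ⟨s, hs⟩ := exists_finset_closedBall_subset (d := d) hℓ (max ‖x‖ ‖y‖)
  -- The pieces are indexed by a lattice shift and a cell: a point belongs to the piece if, moved
  -- back by the shift, it lies in the cell.
  have := dist_le_of_segment_cover (f := v) (K := C') (s := s ×ˢ T.cells)
    (S := fun q => (fun x => x + latticeVec ℓ (-q.1)) ⁻¹' convexHull ℝ (q.2 : Set (E d)))
    (x := x) (y := y) ?_ ?_ ?_
  · rw [dist_comm]; linarith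
  · intro q hq
    exact (q.2.finite_toSet.isCompact_convexHull ℝ).isClosed.preimage (by fun_prop)
  · intro q hq a ha b hb
    have := hC' q.2 (Finset.mem_product.mp hq).2 ha hb
    simpa [hH.periodic.add_latticeVec hℓ] using this
  · refine (((convex_closedBall (0 : E d) (max ‖x‖ ‖y‖)).segment_subset (by simp)
      (by simp)).trans hs).trans ?_
    intro z hz
    simp only [Set.mem_iUnion] at hz
    obtain ⟨k, hk, hz⟩ := hz
    have hz2 : z + latticeVec ℓ (-k) ∈ ⋃ K ∈ T.cells, convexHull ℝ (K : Set (E d)) := by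
      rw [T.cover]; exact cube_subset_closedCube d ℓ hz
    simp only [Set.mem_iUnion] at hz2
    obtain ⟨K, hK, hzK⟩ := hz2
    exact Set.mem_biUnion (x := (k, K)) (by simp [hk, hK]) hzK

end CHAC
end

noncomputable section

namespace CHAC

open MeasureTheory Filter Topology
open scoped ENNReal NNReal Gradient

/-! ### Weak gradients of periodic Lipschitz functions -/

section Grad

variable {d : ℕ} {ℓ : ℝ} {u v : E d → ℝ}

lemma IsPeriodic.comp₂ {F G H : Type*} {u : E d → F} {v : E d → G} (hu : IsPeriodic ℓ u)
    (hv : IsPeriodic ℓ v) (φ : F → G → H) : IsPeriodic ℓ (fun x => φ (u x) (v x)) :=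
  fun i x => by simp only [hu i x, hv i x]

lemma IsPeriodic.comp {F G : Type*} {u : E d → F} (hu : IsPeriodic ℓ u) (φ : F → G) :
    IsPeriodic ℓ (fun x => φ (u x)) :=
  fun i x => by simp only [hu i x]

namespace LipPer

lemma continuous (hu : LipPer ℓ u) : Continuous u := hu.lip.choose_spec.continuous

lemma add (hu : LipPer ℓ u) (hv : LipPer ℓ v) : LipPer ℓ (u + v) := by
  obtain ⟨K, hK⟩ := hu.lip
  obtain ⟨K', hK'⟩ := hv.lip
  exact ⟨hu.periodic.comp₂ hv.periodic (· + ·), _, hK.add hK'⟩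

lemma const_smul (hu : LipPer ℓ u) (c : ℝ) : LipPer ℓ (c • u) := by
  obtain ⟨K, hK⟩ := hu.lip
  refine ⟨hu.periodic.comp (c • ·), ‖c‖₊ * K, (lipschitzWith_smul c).comp hK⟩

lemma const (c : ℝ) : LipPer (d := d) ℓ (fun _ => c) :=
  ⟨fun _ _ => rfl, 0, LipschitzWith.const c⟩

lemma sub (hu : LipPer ℓ u) (hv : LipPer ℓ v) : LipPer ℓ (u - v) := by
  have := hu.add (hv.const_smul (-1))
  rwa [neg_one_smul, ← sub_eq_add_neg] at this

lemma ae_differentiableAt (hu : LipPer ℓ u) : ∀ᵐ x, DifferentiableAt ℝ u x :=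
  hu.lip.choose_spec.ae_differentiableAt

end LipPer

lemma gradient_apply (u : E d → ℝ) (x : E d) (i : Fin d) :
    ∇ u x i = fderiv ℝ u x (EuclideanSpace.single i 1) := by
  have h := InnerProductSpace.toDual_symm_apply (𝕜 := ℝ) (x := EuclideanSpace.single i (1 : ℝ))
    (y := fderiv ℝ u x)
  rw [← h, gradient, EuclideanSpace.inner_single_right]
  simp

lemma norm_gradient (u : E d → ℝ) (x : E d) : ‖∇ u x‖ = ‖fderiv ℝ u x‖ := by
  simp [gradient]

lemma measurable_gradient (u : E d → ℝ) : Measurable (∇ u) :=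
  ((InnerProductSpace.toDual ℝ (E d)).symm.continuous.measurable).comp (measurable_fderiv ℝ u)

lemma isPeriodic_gradient (hu : IsPeriodic ℓ u) : IsPeriodic ℓ (∇ u) := by
  intro i x
  have : (fun y => u (y + EuclideanSpace.single i ℓ)) = u := funext fun y => hu i y
  simp only [gradient]
  rw [← fderiv_comp_add_right, this]

lemma LipschitzWith.norm_gradient_le {K : ℝ≥0} (hK : LipschitzWith K u) (x : E d) :
    ‖∇ u x‖ ≤ K := by
  rw [norm_gradient]; exact norm_fderiv_le_of_lipschitz ℝ hK

lemma LipPer.memLp_gradient (hu : LipPer ℓ u) :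
    MemLp (∇ u) 2 (volume.restrict (cube d ℓ)) := by
  obtain ⟨K, hK⟩ := hu.lip
  exact MemLp.of_bound (measurable_gradient u).aestronglyMeasurable K
    (Eventually.of_forall fun x => LipschitzWith.norm_gradient_le hK x)

lemma integrableOn_cube_of_continuous {F : Type*} [NormedAddCommGroup F] {u : E d → F}
    (hu : Continuous u) : IntegrableOn u (cube d ℓ) :=
  (hu.continuousOn.integrableOn_compact (isCompact_closedCube d ℓ)).mono_set
    (cube_subset_closedCube d ℓ)

lemma memLp_cube_of_continuous {F : Type*} [NormedAddCommGroup F] {u : E d → F}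
    (hu : Continuous u) (p : ℝ≥0∞) : MemLp u p (volume.restrict (cube d ℓ)) := by
  obtain ⟨C, hC⟩ := (isCompact_closedCube d ℓ).exists_bound_of_continuousOn hu.continuousOn
  refine MemLp.of_bound (hu.continuousOn.aestronglyMeasurable_of_isCompact
    (isCompact_closedCube d ℓ) (isCompact_closedCube d ℓ).measurableSet |>.mono_measure
    (Measure.restrict_mono (cube_subset_closedCube d ℓ) le_rfl)) C ?_
  rw [ae_restrict_iff' (measurableSet_cube d ℓ)]
  exact Eventually.of_forall fun x hx => hC x (cube_subset_closedCube d ℓ hx)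

/-- Rademacher's theorem gives the a.e. derivative, and integration by parts holds for a Lipschitz
function against a compactly supported one. -/
lemma LipPer.isWeakGrad_gradient (hu : LipPer ℓ u) : IsWeakGrad ℓ u (∇ u) := by
  refine ⟨isPeriodic_gradient hu.periodic, hu.memLp_gradient, fun φ hφ hφc i => ?_⟩
  obtain ⟨K, hK⟩ := hu.lip
  have hφd : Differentiable ℝ φ := hφ.differentiable (by simp)
  have h := hK.integral_lineDeriv_mul_eq (μ := volume)
    (ContDiff.lipschitzWith_of_hasCompactSupport hφc hφ (by simp)).choose_spec hφc
    (EuclideanSpace.single i (1 : ℝ))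
  have h1 : ∫ x, lineDeriv ℝ u x (EuclideanSpace.single i 1) * φ x = ∫ x, ∇ u x i * φ x := by
    refine integral_congr_ae ?_
    filter_upwards [hK.ae_differentiableAt (μ := volume)] with x hx
    rw [hx.lineDeriv_eq_fderiv, gradient_apply]
  have h2 : ∫ x, lineDeriv ℝ φ x (-EuclideanSpace.single i 1) * u x =
      -∫ x, u x * fderiv ℝ φ x (EuclideanSpace.single i 1) := by
    rw [← integral_neg]
    congr 1; ext x
    rw [(hφd x).lineDeriv_eq_fderiv, map_neg]; ring
  rw [h1, h2] at h
  linarith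

lemma IsWeakGrad.locallyIntegrable (hℓ : 0 < ℓ) {g : E d → E d} (hg : IsWeakGrad ℓ u g)
    (i : Fin d) : LocallyIntegrable (fun x => g x i) := by
  rw [locallyIntegrable_iff]
  intro k hk
  obtain ⟨R, hR⟩ := hk.isBounded.subset_closedBall 0
  refine (integrableOn_closedBall hℓ (hg.periodic.comp fun y => y i) ?_ R).mono_set hR
  have h1 : IntegrableOn g (cube d ℓ) := hg.memLp.integrable (by norm_num)
  exact (EuclideanSpace.proj i : E d →L[ℝ] ℝ).integrable_comp h1

/-- The fundamental lemma of the calculus of variations in each component. As `wgrad` is an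
arbitrary choice, this is what permits computing with it, always up to null sets. -/
lemma IsWeakGrad.ae_eq (hℓ : 0 < ℓ) {g g' : E d → E d} (hg : IsWeakGrad ℓ u g)
    (hg' : IsWeakGrad ℓ u g') : g =ᵐ[volume] g' := by
  have h : ∀ i, ∀ᵐ x, g x i = g' x i := by
    intro i
    refine ae_eq_of_integral_contDiff_smul_eq (hg.locallyIntegrable hℓ i)
      (hg'.locallyIntegrable hℓ i) fun φ hφ hφc => ?_
    have h1 := hg.integral_eq φ hφ hφc i
    rw [hg'.integral_eq φ hφ hφc i, neg_inj] at h1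
    simpa only [smul_eq_mul, mul_comm] using h1.symm
  filter_upwards [ae_all_iff.mpr h] with x hx
  ext i; exact hx i

lemma LipPer.memH1 (hu : LipPer ℓ u) : MemH1 ℓ u :=
  ⟨hu.periodic, memLp_cube_of_continuous hu.continuous 2, _, hu.isWeakGrad_gradient⟩

lemma isWeakGrad_wgrad (hu : ∃ g, IsWeakGrad ℓ u g) : IsWeakGrad ℓ u (wgrad ℓ u) := by
  unfold wgrad
  rw [dif_pos hu]
  exact hu.choose_spec

lemma LipPer.wgrad_ae_eq (hℓ : 0 < ℓ) (hu : LipPer ℓ u) : wgrad ℓ u =ᵐ[volume] ∇ u :=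
  (isWeakGrad_wgrad ⟨_, hu.isWeakGrad_gradient⟩).ae_eq hℓ hu.isWeakGrad_gradient

lemma memLp_wgrad (ℓ : ℝ) (u : E d → ℝ) :
    MemLp (wgrad ℓ u) 2 (volume.restrict (cube d ℓ)) := by
  by_cases h : ∃ g, IsWeakGrad ℓ u g
  · exact (isWeakGrad_wgrad h).memLp
  · unfold wgrad
    rw [dif_neg h]
    exact MemLp.zero

lemma wgrad_add (hℓ : 0 < ℓ) (hu : LipPer ℓ u) (hv : LipPer ℓ v) :
    ∀ᵐ x, wgrad ℓ (u + v) x = wgrad ℓ u x + wgrad ℓ v x := by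
  filter_upwards [(hu.add hv).wgrad_ae_eq hℓ, hu.wgrad_ae_eq hℓ, hv.wgrad_ae_eq hℓ,
    hu.ae_differentiableAt, hv.ae_differentiableAt] with x h1 h2 h3 h4 h5
  rw [h1, h2, h3, gradient, fderiv_add h4 h5, map_add]; rfl

lemma wgrad_smul (hℓ : 0 < ℓ) (hu : LipPer ℓ u) (c : ℝ) :
    ∀ᵐ x, wgrad ℓ (c • u) x = c • wgrad ℓ u x := by
  filter_upwards [(hu.const_smul c).wgrad_ae_eq hℓ, hu.wgrad_ae_eq hℓ,
    hu.ae_differentiableAt] with x h1 h2 h4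
  rw [h1, h2, gradient, fderiv_const_smul h4, map_smul]; rfl

lemma wgrad_sub (hℓ : 0 < ℓ) (hu : LipPer ℓ u) (hv : LipPer ℓ v) :
    ∀ᵐ x, wgrad ℓ (u - v) x = wgrad ℓ u x - wgrad ℓ v x := by
  filter_upwards [(hu.sub hv).wgrad_ae_eq hℓ, hu.wgrad_ae_eq hℓ, hv.wgrad_ae_eq hℓ,
    hu.ae_differentiableAt, hv.ae_differentiableAt] with x h1 h2 h3 h4 h5
  rw [h1, h2, h3, gradient, fderiv_sub h4 h5, map_sub]; rfl

lemma wgrad_const (hℓ : 0 < ℓ) (c : ℝ) : ∀ᵐ x : E d, wgrad ℓ (fun _ => c) x = 0 := by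
  filter_upwards [(LipPer.const c).wgrad_ae_eq hℓ] with x h1
  rw [h1, gradient]; simp

end Grad

/-! ### The finite element space as a vector space -/

namespace PeriodicMesh

variable {d : ℕ} {ℓ : ℝ} (T : PeriodicMesh d ℓ) {u v : E d → ℝ}

lemma add_mem_Vh (hℓ : 0 < ℓ) (hu : u ∈ T.Vh) (hv : v ∈ T.Vh) : u + v ∈ T.Vh := by
  refine ⟨((T.lipPer_of_mem_Vh hℓ hu).add (T.lipPer_of_mem_Vh hℓ hv)).memH1, fun K hK => ?_⟩
  obtain ⟨p, hp, hp'⟩ := hu.2 K hK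
  obtain ⟨q, hq, hq'⟩ := hv.2 K hK
  exact ⟨p + q, (MvPolynomial.totalDegree_add p q).trans (max_le hp hq), fun x hx => by
    simp [hp' x hx, hq' x hx]⟩

lemma smul_mem_Vh (hℓ : 0 < ℓ) (c : ℝ) (hu : u ∈ T.Vh) : c • u ∈ T.Vh := by
  refine ⟨((T.lipPer_of_mem_Vh hℓ hu).const_smul c).memH1, fun K hK => ?_⟩
  obtain ⟨p, hp, hp'⟩ := hu.2 K hK
  exact ⟨c • p, (MvPolynomial.totalDegree_smul_le c p).trans hp, fun x hx => by
    simp [hp' x hx, MvPolynomial.smul_eval]⟩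

lemma sub_mem_Vh (hℓ : 0 < ℓ) (hu : u ∈ T.Vh) (hv : v ∈ T.Vh) : u - v ∈ T.Vh := by
  have := T.add_mem_Vh hℓ hu (T.smul_mem_Vh hℓ (-1) hv)
  rwa [neg_one_smul, ← sub_eq_add_neg] at this

lemma const_mem_Vh (c : ℝ) : (fun _ => c) ∈ T.Vh :=
  ⟨(LipPer.const c).memH1, fun _ _ => ⟨MvPolynomial.C c, by simp, fun _ _ => by simp⟩⟩

end PeriodicMesh

end CHAC
end

noncomputable section

namespace CHAC

open MeasureTheory Filter Topology
open scoped ENNReal NNReal Gradient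

/-! ### Poincaré inequality -/

section Poincare

variable {d : ℕ} {ℓ : ℝ} {u v : E d → ℝ}

lemma integrable_prod_cube_of_continuous {f : E d × E d → ℝ} (hf : Continuous f) :
    Integrable f ((volume.restrict (cube d ℓ)).prod (volume.restrict (cube d ℓ))) := by
  rw [Measure.prod_restrict]
  exact (hf.continuousOn.integrableOn_compact
    ((isCompact_closedCube d ℓ).prod (isCompact_closedCube d ℓ))).mono_set
    (Set.prod_mono (cube_subset_closedCube d ℓ) (cube_subset_closedCube d ℓ))

/-- Split the translation by `z` into `n + 1` equal ones. Cauchy–Schwarz and translation invariance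
replace the increment by the difference quotient of step `z / (n + 1)`, which tends a.e. to the
directional derivative. This needs only differentiability a.e. -/
lemma LipPer.integral_sq_translate_sub_le (hℓ : 0 < ℓ) (hu : LipPer ℓ u) (z : E d) :
    ∫ x in cube d ℓ, (u (x + z) - u x) ^ 2 ≤ ∫ x in cube d ℓ, (fderiv ℝ u x z) ^ 2 := by
  obtain ⟨K, hK⟩ := hu.lip
  have hc := hu.continuous
  have key : ∀ n : ℕ, ∫ x in cube d ℓ, (u (x + z) - u x) ^ 2 ≤
      ∫ x in cube d ℓ, (((n : ℝ) + 1) • (u (x + ((n : ℝ) + 1)⁻¹ • z) - u x)) ^ 2 := by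
    intro n
    set w : E d := ((n : ℝ) + 1)⁻¹ • z with hw
    have hzw : z = ((n + 1 : ℕ) : ℝ) • w := by
      rw [hw, smul_smul]; push_cast
      rw [mul_inv_cancel₀ (by positivity), one_smul]
    have h1 : ∀ x, (u (x + z) - u x) ^ 2 ≤ ((n : ℝ) + 1) *
        ∑ j ∈ Finset.range (n + 1), (u (x + (j : ℝ) • w + w) - u (x + (j : ℝ) • w)) ^ 2 := by
      intro x
      have h2 : u (x + z) - u x =
          ∑ j ∈ Finset.range (n + 1), (u (x + (j : ℝ) • w + w) - u (x + (j : ℝ) • w)) := by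
        have := Finset.sum_range_sub (fun j : ℕ => u (x + (j : ℝ) • w)) (n + 1)
        simp only [Nat.cast_zero, zero_smul, add_zero, ← hzw] at this
        rw [← this]
        refine Finset.sum_congr rfl fun j _ => ?_
        push_cast
        rw [add_smul, one_smul, add_assoc]
      rw [h2]
      have := sq_sum_le_card_mul_sum_sq (s := Finset.range (n + 1))
        (f := fun j : ℕ => u (x + (j : ℝ) • w + w) - u (x + (j : ℝ) • w))
      simpa using this
    have h3 : ∀ j : ℕ, ∫ x in cube d ℓ, (u (x + (j : ℝ) • w + w) - u (x + (j : ℝ) • w)) ^ 2 =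
        ∫ x in cube d ℓ, (u (x + w) - u x) ^ 2 := by
      intro j
      refine integral_cube_add hℓ (u := fun x => (u (x + w) - u x) ^ 2) ?_ ((j : ℝ) • w)
      intro i x
      simp only
      rw [add_right_comm, hu.periodic i, hu.periodic i]
    calc ∫ x in cube d ℓ, (u (x + z) - u x) ^ 2
        ≤ ∫ x in cube d ℓ, ((n : ℝ) + 1) *
          ∑ j ∈ Finset.range (n + 1), (u (x + (j : ℝ) • w + w) - u (x + (j : ℝ) • w)) ^ 2 := by
          refine integral_mono (integrableOn_cube_of_continuous (by fun_prop))
            (integrableOn_cube_of_continuous (by fun_prop)) h1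
      _ = ((n : ℝ) + 1) * ∑ j ∈ Finset.range (n + 1),
          ∫ x in cube d ℓ, (u (x + (j : ℝ) • w + w) - u (x + (j : ℝ) • w)) ^ 2 := by
          rw [integral_const_mul, integral_finsetSum]
          intro j _
          exact integrableOn_cube_of_continuous (by fun_prop)
      _ = ((n : ℝ) + 1) ^ 2 * ∫ x in cube d ℓ, (u (x + w) - u x) ^ 2 := by
          simp only [h3, Finset.sum_const, Finset.card_range, nsmul_eq_mul]
          push_cast; ring
      _ = _ := by
          rw [← integral_const_mul]
          congr 1; ext x; rw [smul_eq_mul]; ring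
  refine ge_of_tendsto' (tendsto_integral_of_dominated_convergence
    (fun _ => (K * ‖z‖) ^ 2) (fun n => ?_) ?_ (fun n => ?_) ?_) key
  · exact (integrableOn_cube_of_continuous (by fun_prop)).aestronglyMeasurable
  · exact integrable_const _
  · refine Eventually.of_forall fun x => ?_
    rw [norm_pow]
    refine pow_le_pow_left₀ (norm_nonneg _) ?_ 2
    rw [norm_smul]
    have h := hK.dist_le_mul (x + ((n : ℝ) + 1)⁻¹ • z) x
    rw [dist_eq_norm, dist_eq_norm, add_sub_cancel_left, norm_smul, norm_inv] at h
    have hp : 0 < ‖(n : ℝ) + 1‖ := norm_pos_iff.mpr (by positivity)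
    calc _ ≤ ‖(n : ℝ) + 1‖ * (K * (‖(n : ℝ) + 1‖⁻¹ * ‖z‖)) := by gcongr
      _ = _ := by field_simp
  · refine ae_restrict_of_ae ?_
    filter_upwards [hu.ae_differentiableAt] with x hx
    refine (hx.hasFDerivAt.lim z ?_).pow 2
    simp only [Real.norm_eq_abs]
    refine tendsto_abs_atTop_atTop.comp ?_
    exact tendsto_atTop_add_const_right _ _ tendsto_natCast_atTop_atTop

lemma volume_cube_pos (hℓ : 0 < ℓ) : 0 < volume.real (cube d ℓ) := by
  rw [cube_eq_fundamentalDomain hℓ]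
  refine ENNReal.toReal_pos (ZSpan.measure_fundamentalDomain_ne_zero _) ?_
  rw [← cube_eq_fundamentalDomain hℓ]
  exact ((measure_mono (cube_subset_closedCube d ℓ)).trans_lt
      (isCompact_closedCube d ℓ).measure_lt_top).ne

lemma LipPer.ipv_wgrad (hℓ : 0 < ℓ) (hu : LipPer ℓ u) :
    ipv ℓ (wgrad ℓ u) (wgrad ℓ u) = ∫ x in cube d ℓ, ‖fderiv ℝ u x‖ ^ 2 := by
  refine integral_congr_ae (ae_restrict_of_ae ?_)
  filter_upwards [hu.wgrad_ae_eq hℓ] with x hx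
  rw [hx, real_inner_self_eq_norm_sq, norm_gradient]

lemma LipPer.integrableOn_norm_fderiv_sq (hu : LipPer ℓ u) :
    IntegrableOn (fun x => ‖fderiv ℝ u x‖ ^ 2) (cube d ℓ) := by
  have := hu.memLp_gradient.integrable_norm_pow (by norm_num)
  simpa [norm_gradient, IntegrableOn] using this

lemma norm_sq_le_of_mem_cube {x : E d} (hx : x ∈ cube d ℓ) : ‖x‖ ^ 2 ≤ d * ℓ ^ 2 := by
  rw [EuclideanSpace.norm_sq_eq]
  calc ∑ i, ‖x i‖ ^ 2 ≤ ∑ _i : Fin d, ℓ ^ 2 := by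
        refine Finset.sum_le_sum fun i _ => ?_
        rw [Real.norm_eq_abs, abs_of_nonneg (hx i).1]
        exact pow_le_pow_left₀ (hx i).1 (hx i).2.le 2
    _ = _ := by simp

/-- Integrate `(u (x + z) - u x) ^ 2` over both `x` and `z` in the cell. Expanding the square yields
`2 V ‖u‖² - 2 (∫ u)²` by periodicity, with `V` the volume; the translation estimate bounds the same
integral by `V d ℓ² ‖∇u‖²`, because `|z|² ≤ d ℓ²` on the cell. -/
lemma exists_poincare (d : ℕ) {ℓ : ℝ} (hℓ : 0 < ℓ) :
    ∃ C : ℝ, 0 < C ∧ ∀ u : E d → ℝ, LipPer ℓ u →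
      ip ℓ u u ≤ C * (ipv ℓ (wgrad ℓ u) (wgrad ℓ u) + (∫ x in cube d ℓ, u x) ^ 2) := by
  set V := volume.real (cube d ℓ) with hV
  have hVp : 0 < V := volume_cube_pos hℓ
  refine ⟨V⁻¹ + d * ℓ ^ 2, by positivity, fun u hu => ?_⟩
  have hc := hu.continuous
  rw [hu.ipv_wgrad hℓ]
  set G := ∫ x in cube d ℓ, ‖fderiv ℝ u x‖ ^ 2 with hG
  have hG0 : 0 ≤ G := integral_nonneg fun x => by positivity
  have h1 : ∀ x, ∫ z in cube d ℓ, (u (x + z) - u x) ^ 2 =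
      ip ℓ u u - 2 * u x * (∫ y in cube d ℓ, u y) + V * u x ^ 2 := by
    intro x
    have h := integral_cube_add hℓ (u := fun y => (u y - u x) ^ 2)
      (hu.periodic.comp fun y => (y - u x) ^ 2) x
    simp only [add_comm x]
    rw [h]
    have : ∀ y, (u y - u x) ^ 2 = u y * u y - 2 * u x * u y + u x ^ 2 := fun y => by ring
    simp only [this]
    rw [integral_add, integral_sub, integral_const_mul, setIntegral_const]
    · rfl
    all_goals exact integrableOn_cube_of_continuous (by fun_prop)
  have h2 : ∫ x in cube d ℓ, ∫ z in cube d ℓ, (u (x + z) - u x) ^ 2 =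
      2 * V * ip ℓ u u - 2 * (∫ y in cube d ℓ, u y) ^ 2 := by
    simp only [h1]
    have : ∀ y, ip ℓ u u - 2 * u y * (∫ y in cube d ℓ, u y) + V * u y ^ 2 =
      ip ℓ u u - (2 * (∫ y in cube d ℓ, u y)) * u y + V * (u y * u y) := fun y => by ring
    simp only [this]
    rw [integral_add, integral_sub, integral_const_mul, integral_const_mul, setIntegral_const]
    · change V * ip ℓ u u - _ + V * ip ℓ u u = _
      ring
    all_goals exact integrableOn_cube_of_continuous (by fun_prop)
  have h3 : ∫ x in cube d ℓ, ∫ z in cube d ℓ, (u (x + z) - u x) ^ 2 ≤ V * (d * ℓ ^ 2 * G) := by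
    rw [integral_integral_swap (f := fun x z => (u (x + z) - u x) ^ 2)
      (integrable_prod_cube_of_continuous (by fun_prop))]
    have h4 : ∀ z ∈ cube d ℓ, ∫ x in cube d ℓ, (u (x + z) - u x) ^ 2 ≤ d * ℓ ^ 2 * G := by
      intro z hz
      refine (hu.integral_sq_translate_sub_le hℓ z).trans ?_
      calc ∫ x in cube d ℓ, (fderiv ℝ u x z) ^ 2
          ≤ ∫ x in cube d ℓ, ‖z‖ ^ 2 * ‖fderiv ℝ u x‖ ^ 2 := by
            refine integral_mono_of_nonneg (Eventually.of_forall fun x => sq_nonneg _)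
              (hu.integrableOn_norm_fderiv_sq.const_mul _) (Eventually.of_forall fun x => ?_)
            have := (fderiv ℝ u x).le_opNorm z
            simp only
            rw [← mul_pow, ← sq_abs, ← Real.norm_eq_abs]
            refine pow_le_pow_left₀ (norm_nonneg _) ?_ 2
            rwa [mul_comm]
        _ = ‖z‖ ^ 2 * G := integral_const_mul _ _
        _ ≤ _ := by gcongr; exact norm_sq_le_of_mem_cube hz
    calc _ ≤ ∫ _z in cube d ℓ, (d * ℓ ^ 2 * G : ℝ) := by
          refine setIntegral_mono_on ?_ (integrable_const _) (measurableSet_cube d ℓ) h4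
          exact (integrable_prod_cube_of_continuous
            (f := fun q : E d × E d => (u (q.1 + q.2) - u q.1) ^ 2) (by fun_prop)).integral_prod_right
      _ = _ := by rw [setIntegral_const]; rfl
  rw [h2] at h3
  have h5 : V * ip ℓ u u ≤ (∫ y in cube d ℓ, u y) ^ 2 + V * (d * ℓ ^ 2 * G) := by
    have : 0 ≤ V * (d * ℓ ^ 2 * G) := by positivity
    linarith
  have h6 : ip ℓ u u ≤ V⁻¹ * ((∫ y in cube d ℓ, u y) ^ 2 + V * (d * ℓ ^ 2 * G)) := by
    rw [inv_mul_eq_div, le_div_iff₀ hVp]; linarith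
  refine h6.trans ?_
  rw [mul_add, ← mul_assoc V⁻¹ V, inv_mul_cancel₀ hVp.ne', one_mul]
  have h7 : 0 ≤ V⁻¹ * G := by positivity
  have h8 : 0 ≤ d * ℓ ^ 2 * (∫ y in cube d ℓ, u y) ^ 2 := by positivity
  linarith [add_mul (V⁻¹) (d * ℓ ^ 2 : ℝ) (G + (∫ y in cube d ℓ, u y) ^ 2),
    mul_add V⁻¹ G ((∫ y in cube d ℓ, u y) ^ 2),
    mul_add (d * ℓ ^ 2 : ℝ) G ((∫ y in cube d ℓ, u y) ^ 2)]

end Poincare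

end CHAC
end

noncomputable section

namespace CHAC

open MeasureTheory Filter Topology
open scoped ENNReal NNReal Gradient

/-! ### Sobolev inequality -/

section Sobolev

open scoped Convolution

variable {d : ℕ} {ℓ : ℝ} {u v : E d → ℝ}

/-- Differentiation under the integral sign, dominated by the Lipschitz constant. The derivative
falls on `v` rather than on the kernel, so the mollified gradients converge a.e. and stay bounded by
`K`. -/
lemma hasFDerivAt_convolution_of_lipschitz {v : E d → ℝ} {K : ℝ≥0} (hv : LipschitzWith K v)
    (φ : ContDiffBump (0 : E d)) (x : E d) :
    HasFDerivAt (φ.normed volume ⋆[ContinuousLinearMap.lsmul ℝ ℝ, volume] v)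
      ((φ.normed volume ⋆[ContinuousLinearMap.lsmul ℝ ℝ, volume] (fderiv ℝ v)) x) x := by
  have hφi : Integrable (φ.normed volume) volume := φ.integrable_normed
  have hcont : ∀ y, Integrable (fun t => φ.normed volume t • v (y - t)) := fun y =>
    Continuous.integrable_of_hasCompactSupport
      (φ.continuous_normed.smul (hv.continuous.comp (continuous_const.sub continuous_id)))
      (φ.hasCompactSupport_normed.smul_right)
  refine (hasFDerivAt_integral_of_dominated_loc_of_lip (s := Set.univ)
    (bound := fun t => K * φ.normed volume t)
    (F := fun y t => φ.normed volume t • v (y - t))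
    (F' := fun t => φ.normed volume t • fderiv ℝ v (x - t)) univ_mem
    (Eventually.of_forall fun y => (hcont y).aestronglyMeasurable) (hcont x) ?_ ?_
    (hφi.const_mul _) ?_).2
  · refine φ.continuous_normed.aestronglyMeasurable.smul ?_
    exact ((measurable_fderiv ℝ v).comp (measurable_const.sub measurable_id)).aestronglyMeasurable
  · refine Eventually.of_forall fun t => ?_
    refine LipschitzWith.lipschitzOnWith (LipschitzWith.of_dist_le_mul fun y z => ?_)
    have h := hv.dist_le_mul (y - t) (z - t)
    rw [dist_sub_right] at h
    rw [dist_smul₀, Real.norm_eq_abs, abs_of_nonneg (φ.nonneg_normed t)]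
    have : ((Real.nnabs (K * φ.normed volume t) : ℝ≥0) : ℝ) = K * φ.normed volume t := by
      rw [Real.coe_nnabs]; exact abs_of_nonneg (mul_nonneg K.2 (φ.nonneg_normed t))
    rw [this]
    calc _ ≤ φ.normed volume t * (K * dist y z) :=
          mul_le_mul_of_nonneg_left h (φ.nonneg_normed t)
      _ = _ := by ring
  · have h1 : ∀ᵐ t, DifferentiableAt ℝ v (x - t) :=
      (Measure.measurePreserving_sub_left volume x).quasiMeasurePreserving.ae hv.ae_differentiableAt
    filter_upwards [h1] with t ht
    have h2 : HasFDerivAt (fun y : E d => y - t) (ContinuousLinearMap.id ℝ (E d)) x :=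
      (hasFDerivAt_id x).sub_const t
    simpa [Function.comp_def, Pi.smul_def] using (ht.hasFDerivAt.comp x h2).const_smul (φ.normed volume t)

lemma norm_convolution_fderiv_le {v : E d → ℝ} {K : ℝ≥0} (hv : LipschitzWith K v)
    (φ : ContDiffBump (0 : E d)) (x : E d) :
    ‖(φ.normed volume ⋆[ContinuousLinearMap.lsmul ℝ ℝ, volume] (fderiv ℝ v)) x‖ ≤ K := by
  rw [convolution_def]
  calc _ ≤ ∫ t, K * φ.normed volume t := by
        refine norm_integral_le_of_norm_le (φ.integrable_normed.const_mul _)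
          (Eventually.of_forall fun t => ?_)
        rw [ContinuousLinearMap.lsmul_apply, norm_smul, Real.norm_eq_abs,
          abs_of_nonneg (φ.nonneg_normed t), mul_comm]
        exact mul_le_mul_of_nonneg_right (norm_fderiv_le_of_lipschitz ℝ hv) (φ.nonneg_normed t)
    _ = K := by rw [integral_const_mul, φ.integral_normed, mul_one]

/-- The exponent with Sobolev conjugate `6`: `3/2` in the plane and `2` in space. In the plane `p =
2` is not subcritical, hence the detour through `3/2`. -/
lemma exists_exponent (hd : d = 2 ∨ d = 3) : ∃ p : ℝ≥0, 1 ≤ p ∧ p ≤ 2 ∧ (p : ℝ) < d ∧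
    (p : ℝ)⁻¹ - (d : ℝ)⁻¹ ≤ ((6 : ℝ≥0) : ℝ)⁻¹ := by
  rcases hd with rfl | rfl
  · exact ⟨3 / 2, by norm_num [← NNReal.coe_le_coe], by norm_num [← NNReal.coe_le_coe],
      by norm_num, by norm_num⟩
  · exact ⟨2, by norm_num, le_rfl, by norm_num, by norm_num⟩

/-- Gagliardo–Nirenberg–Sobolev from `Lᵖ` of the gradient to `L⁶`, followed by Hölder on the ball to
pass from `Lᵖ` to `L²`. -/
lemma exists_sobolev_contDiff (hd : d = 2 ∨ d = 3) (R : ℝ) :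
    ∃ C : ℝ≥0, ∀ w : E d → ℝ, ContDiff ℝ 1 w → Function.support w ⊆ Metric.closedBall 0 R →
      ∫⁻ x, ‖w x‖ₑ ^ 6 ≤ C * (∫⁻ x in Metric.closedBall 0 R, ‖fderiv ℝ w x‖ₑ ^ 2) ^ 3 := by
  obtain ⟨p, hp1, hp2, hpd, hp6⟩ := exists_exponent hd
  set B : Set (E d) := Metric.closedBall 0 R with hB
  have hfin : volume B ^ (1 / (p : ℝ) - 1 / 2) ≠ ⊤ :=
    ENNReal.rpow_ne_top_of_nonneg (by
      rw [sub_nonneg]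
      exact one_div_le_one_div_of_le (by have : (1 : ℝ) ≤ p := hp1; linarith) hp2)
      (measure_closedBall_lt_top).ne
  refine ⟨(eLpNormLESNormFDerivOfLeConst ℝ (volume : Measure (E d)) B p 6 *
    (volume B ^ (1 / (p : ℝ) - 1 / 2)).toNNReal) ^ 6, fun w hw hsupp => ?_⟩
  have h1 := eLpNorm_le_eLpNorm_fderiv_of_le (volume : Measure (E d)) hw hsupp (p := p) (q := 6)
    hp1 (by rw [finrank_euclideanSpace_fin]; exact_mod_cast hpd) (by simpa using hp6)
    Metric.isBounded_closedBall
  have hsupp' : Function.support (fderiv ℝ w) ⊆ B :=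
    (support_fderiv_subset ℝ).trans (closure_minimal hsupp Metric.isClosed_closedBall)
  rw [← eLpNorm_restrict_eq_of_support_subset (f := fderiv ℝ w) (p := p) hsupp'] at h1
  have h2 := eLpNorm_le_eLpNorm_mul_rpow_measure_univ (μ := volume.restrict B)
    (p := p) (q := 2) (f := fderiv ℝ w) (by exact_mod_cast hp2)
    (measurable_fderiv ℝ w).aestronglyMeasurable
  have h6 : ∫⁻ x, ‖w x‖ₑ ^ 6 = eLpNorm w 6 volume ^ 6 := by
    rw [eLpNorm_eq_lintegral_rpow_enorm_toReal (by norm_num) (by norm_num)]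
    rw [← ENNReal.rpow_natCast, ← ENNReal.rpow_mul]
    norm_num
  have h7 : ∫⁻ x in B, ‖fderiv ℝ w x‖ₑ ^ 2 = eLpNorm (fderiv ℝ w) 2 (volume.restrict B) ^ 2 := by
    rw [eLpNorm_eq_lintegral_rpow_enorm_toReal (by norm_num) (by norm_num)]
    rw [← ENNReal.rpow_natCast, ← ENNReal.rpow_mul]
    norm_num
  rw [h6, h7, ← pow_mul]
  rw [Measure.restrict_apply_univ] at h2
  simp only [ENNReal.coe_toReal, ENNReal.toReal_ofNat] at h2
  push_cast
  rw [ENNReal.coe_toNNReal hfin, ← mul_pow]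
  refine pow_le_pow_left' ?_ 6
  have h8 : ((6 : ℝ≥0) : ℝ≥0∞) = 6 := by norm_num
  rw [h8] at h1
  refine h1.trans ?_
  rw [mul_assoc]
  refine mul_le_mul_right ?_ _
  rw [mul_comm]
  exact h2

/-- Mollify and pass to the limit: Fatou on the left, dominated convergence on the right. The radius
grows by one to hold the supports of the mollifications. -/
lemma exists_sobolev_lipschitz (hd : d = 2 ∨ d = 3) (R : ℝ) :
    ∃ C : ℝ≥0, ∀ (v : E d → ℝ) (K : ℝ≥0), LipschitzWith K v →
      Function.support v ⊆ Metric.closedBall 0 R →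
      ∫⁻ x, ‖v x‖ₑ ^ 6 ≤
        C * (∫⁻ x in Metric.closedBall 0 (R + 1), ‖fderiv ℝ v x‖ₑ ^ 2) ^ 3 := by
  obtain ⟨C, hC⟩ := exists_sobolev_contDiff hd (R + 1)
  refine ⟨C, fun v K hK hsupp => ?_⟩
  -- The ratio of outer to inner radius stays `2`, as Lebesgue differentiation requires for a.e.
  -- convergence of the convolutions.
  let φ : ℕ → ContDiffBump (0 : E d) := fun n =>
    ⟨1 / (2 * (n + 1)), 1 / (n + 1), by positivity, by
      rw [div_lt_div_iff₀ (by positivity) (by positivity)]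
      have : (0 : ℝ) ≤ n := by positivity
      linarith⟩
  have hrout : ∀ n, (φ n).rOut = 1 / ((n : ℝ) + 1) := fun n => rfl
  have hrin : ∀ n, (φ n).rIn = 1 / (2 * ((n : ℝ) + 1)) := fun n => rfl
  have hlim : Tendsto (fun n => (φ n).rOut) atTop (𝓝 0) := by
    simp only [hrout]; exact tendsto_one_div_add_atTop_nhds_zero_nat
  have hrat : ∀ᶠ n in atTop, (φ n).rOut ≤ 2 * (φ n).rIn := Eventually.of_forall fun n => by
    rw [hrout, hrin]; apply le_of_eq; field_simp
  let w : ℕ → E d → ℝ := fun n =>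
    (φ n).normed volume ⋆[ContinuousLinearMap.lsmul ℝ ℝ, volume] v
  let D : ℕ → E d → (E d →L[ℝ] ℝ) := fun n =>
    (φ n).normed volume ⋆[ContinuousLinearMap.lsmul ℝ ℝ, volume] (fderiv ℝ v)
  have hfd : ∀ n, fderiv ℝ (w n) = D n := fun n => funext fun x =>
    (hasFDerivAt_convolution_of_lipschitz hK (φ n) x).fderiv
  have hsm : ∀ n, ContDiff ℝ 1 (w n) := fun n =>
    (φ n).hasCompactSupport_normed.contDiff_convolution_left _ (φ n).contDiff_normed
      hK.continuous.locallyIntegrable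
  have hsp : ∀ n, Function.support (w n) ⊆ Metric.closedBall 0 (R + 1) := by
    intro n
    refine (support_convolution_subset _).trans ?_
    rintro _ ⟨a, ha, b, hb, rfl⟩
    rw [(φ n).support_normed_eq, Metric.mem_ball, dist_zero_right] at ha
    have hb' := hsupp hb
    rw [mem_closedBall_zero_iff] at hb' ⊢
    have : (φ n).rOut ≤ 1 := by
      rw [hrout, div_le_one (by positivity)]
      have : (0 : ℝ) ≤ n := by positivity
      linarith
    change ‖a + b‖ ≤ _
    linarith [norm_add_le a b]
  have hw : ∀ᵐ x, Tendsto (fun n => w n x) atTop (𝓝 (v x)) :=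
    ContDiffBump.ae_convolution_tendsto_right_of_locallyIntegrable hlim hrat
      hK.continuous.locallyIntegrable
  have hDli : LocallyIntegrable (fderiv ℝ v) volume := by
    refine (MemLp.locallyIntegrable (p := ⊤) ?_ le_top)
    exact memLp_top_of_bound (measurable_fderiv ℝ v).aestronglyMeasurable K
      (Eventually.of_forall fun x => norm_fderiv_le_of_lipschitz ℝ hK)
  have hD : ∀ᵐ x, Tendsto (fun n => D n x) atTop (𝓝 (fderiv ℝ v x)) :=
    ContDiffBump.ae_convolution_tendsto_right_of_locallyIntegrable hlim hrat hDli
  set B : Set (E d) := Metric.closedBall 0 (R + 1) with hB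
  have hI : Tendsto (fun n => ∫⁻ x in B, ‖D n x‖ₑ ^ 2) atTop
      (𝓝 (∫⁻ x in B, ‖fderiv ℝ v x‖ₑ ^ 2)) := by
    refine tendsto_lintegral_of_dominated_convergence' (fun _ => (K : ℝ≥0∞) ^ 2)
      (fun n => ?_) (fun n => Eventually.of_forall fun x => ?_) ?_ ?_
    · rw [← hfd]
      exact ((measurable_fderiv ℝ (w n)).enorm.pow_const 2).aemeasurable
    · refine pow_le_pow_left' ?_ 2
      have := norm_convolution_fderiv_le hK (φ n) x
      rw [← ofReal_norm, ← ENNReal.ofReal_coe_nnreal]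
      exact ENNReal.ofReal_le_ofReal this
    · rw [lintegral_const, Measure.restrict_apply_univ]
      exact ENNReal.mul_ne_top (by simp) measure_closedBall_lt_top.ne
    · filter_upwards [ae_restrict_of_ae hD] with x hx
      exact ((ENNReal.continuous_pow 2).tendsto _).comp hx.enorm
  have hbound : ∀ n, ∫⁻ x, ‖w n x‖ₑ ^ 6 ≤ C * (∫⁻ x in B, ‖D n x‖ₑ ^ 2) ^ 3 := by
    intro n
    rw [← hfd]
    exact hC (w n) (hsm n) (hsp n)
  have hlimR : Tendsto (fun n => (C : ℝ≥0∞) * (∫⁻ x in B, ‖D n x‖ₑ ^ 2) ^ 3) atTop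
      (𝓝 (C * (∫⁻ x in B, ‖fderiv ℝ v x‖ₑ ^ 2) ^ 3)) :=
    ENNReal.Tendsto.const_mul (((ENNReal.continuous_pow 3).tendsto _).comp hI)
      (Or.inr ENNReal.coe_ne_top)
  calc ∫⁻ x, ‖v x‖ₑ ^ 6 = ∫⁻ x, liminf (fun n => ‖w n x‖ₑ ^ 6) atTop := by
        refine lintegral_congr_ae ?_
        filter_upwards [hw] with x hx
        exact (((ENNReal.continuous_pow 6).tendsto _).comp hx.enorm).liminf_eq.symm
    _ ≤ liminf (fun n => ∫⁻ x, ‖w n x‖ₑ ^ 6) atTop :=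
        lintegral_liminf_le fun n => ((hsm n).continuous.measurable.enorm.pow_const 6)
    _ ≤ liminf (fun n => (C : ℝ≥0∞) * (∫⁻ x in B, ‖D n x‖ₑ ^ 2) ^ 3) atTop :=
        liminf_le_liminf (Eventually.of_forall hbound)
    _ = _ := hlimR.liminf_eq

lemma LipPer.exists_bound (hℓ : 0 < ℓ) (hu : LipPer ℓ u) : ∃ B : ℝ, ∀ x, |u x| ≤ B := by
  obtain ⟨B, hB⟩ := (isCompact_closedCube d ℓ).exists_bound_of_continuousOn hu.continuous.continuousOn
  refine ⟨B, fun x => ?_⟩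
  obtain ⟨s, hs⟩ := exists_finset_closedBall_subset (d := d) hℓ ‖x‖
  have := hs (mem_closedBall_zero_iff.mpr le_rfl)
  simp only [Set.mem_iUnion] at this
  obtain ⟨k, _, hk⟩ := this
  rw [← hu.periodic.add_latticeVec hℓ (-k) x, ← Real.norm_eq_abs]
  exact hB _ (cube_subset_closedCube d ℓ hk)

/-- Apply the inequality for compact support to `χ u`, with a cutoff `χ` equal to `1` on the cell.
The product rule brings in `u` itself besides its gradient, and the integrals over the large ball
return to the cell by periodicity. -/
lemma exists_sobolev (hd : d = 2 ∨ d = 3) {ℓ : ℝ} (hℓ : 0 < ℓ) :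
    ∃ C : ℝ, 0 < C ∧ ∀ u : E d → ℝ, LipPer ℓ u →
      ∫ x in cube d ℓ, u x ^ 6 ≤
        C * (ip ℓ u u + ipv ℓ (wgrad ℓ u) (wgrad ℓ u)) ^ 3 := by
  obtain ⟨R, hR⟩ := (isCompact_closedCube d ℓ).isBounded.subset_closedBall (0 : E d)
  set R' := max R 1 with hR'
  have hR'0 : 0 < R' := lt_max_of_lt_right one_pos
  let χ : ContDiffBump (0 : E d) := ⟨R', R' + 1, hR'0, by linarith⟩
  obtain ⟨Kχ, hKχ⟩ := ContDiff.lipschitzWith_of_hasCompactSupport χ.hasCompactSupport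
    (χ.contDiff (n := 1)) (by simp)
  obtain ⟨C, hC⟩ := exists_sobolev_lipschitz hd (R' + 1)
  obtain ⟨n, hn⟩ := exists_lintegral_le_mul_cube (d := d) hℓ (R' + 1 + 1)
  set A : ℝ := n * (2 * (1 + (Kχ : ℝ) ^ 2)) with hA
  -- The added `1` only makes the constant positive.
  refine ⟨C * A ^ 3 + 1, by positivity, fun u hu => ?_⟩
  obtain ⟨K, hK⟩ := hu.lip
  obtain ⟨b, hb⟩ := hu.exists_bound hℓ
  have hc := hu.continuous
  let v : E d → ℝ := fun x => χ x * u x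
  have hv : LipschitzWith (K + Kχ * b.toNNReal) v := by
    refine LipschitzWith.of_dist_le_mul fun x y => ?_
    have h1 := hK.dist_le_mul x y
    have h2 := hKχ.dist_le_mul x y
    rw [Real.dist_eq] at *
    have h3 : |χ x| ≤ 1 := by rw [abs_of_nonneg χ.nonneg]; exact χ.le_one
    have h4 : v x - v y = χ x * (u x - u y) + (χ x - χ y) * u y := by simp only [v]; ring
    have h5 : |u y| ≤ b.toNNReal := (hb y).trans (Real.le_coe_toNNReal b)
    rw [h4]
    refine (abs_add_le _ _).trans ?_
    rw [abs_mul, abs_mul]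
    push_cast
    calc _ ≤ 1 * (K * dist x y) + (Kχ * dist x y) * (b.toNNReal : ℝ) := by gcongr
      _ = _ := by ring
  have hsupp : Function.support v ⊆ Metric.closedBall 0 (R' + 1) := by
    intro x hx
    have : x ∈ Function.support χ := by
      intro h; exact hx (by simp [v, h])
    rw [χ.support_eq] at this
    exact Metric.ball_subset_closedBall this
  have h1 := hC v _ hv hsupp
  let q : E d → ℝ := fun x => 2 * (1 + (Kχ : ℝ) ^ 2) * (u x ^ 2 + ‖fderiv ℝ u x‖ ^ 2)
  have hq0 : ∀ x, 0 ≤ q x := fun x => by positivity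
  have hqp : IsPeriodic ℓ (fun x => ENNReal.ofReal (q x)) := by
    refine IsPeriodic.comp (F := ℝ) (u := q) (fun i x => ?_) ENNReal.ofReal
    simp only [q, ← norm_gradient]
    rw [hu.periodic i, isPeriodic_gradient hu.periodic i]
  have h2 : ∫⁻ x in Metric.closedBall 0 (R' + 1 + 1), ‖fderiv ℝ v x‖ₑ ^ 2 ≤
      n * ∫⁻ x in cube d ℓ, ENNReal.ofReal (q x) := by
    refine le_trans (lintegral_mono_ae (ae_restrict_of_ae ?_)) (hn _ hqp)
    filter_upwards [hu.ae_differentiableAt] with x hx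
    have hχ : DifferentiableAt ℝ χ x := (χ.contDiff (n := 1)).differentiable (by simp) x
    rw [show fderiv ℝ v x = χ x • fderiv ℝ u x + u x • fderiv ℝ χ x from fderiv_mul hχ hx]
    rw [← ofReal_norm, ← ENNReal.ofReal_pow (norm_nonneg _)]
    refine ENNReal.ofReal_le_ofReal ?_
    have h3 : ‖fderiv ℝ χ x‖ ≤ Kχ := norm_fderiv_le_of_lipschitz ℝ hKχ
    have h4 : ‖χ x‖ ≤ 1 := by
      rw [Real.norm_eq_abs, abs_of_nonneg χ.nonneg]; exact χ.le_one
    have h5 : ‖χ x • fderiv ℝ u x + u x • fderiv ℝ χ x‖ ≤ ‖fderiv ℝ u x‖ + |u x| * Kχ := by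
      refine (norm_add_le _ _).trans ?_
      rw [norm_smul, norm_smul, Real.norm_eq_abs (u x)]
      calc _ ≤ 1 * ‖fderiv ℝ u x‖ + |u x| * Kχ := by gcongr
        _ = _ := by ring
    refine (pow_le_pow_left₀ (norm_nonneg _) h5 2).trans ?_
    simp only [q]
    rw [← sq_abs (u x)]
    nlinarith [sq_nonneg (‖fderiv ℝ u x‖ - |u x| * Kχ), sq_nonneg (Kχ * ‖fderiv ℝ u x‖),
      sq_nonneg (|u x|)]
  have hqi : IntegrableOn q (cube d ℓ) :=
    ((integrableOn_cube_of_continuous (by fun_prop)).add hu.integrableOn_norm_fderiv_sq).const_mul _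
  have h3 : ∫⁻ x in cube d ℓ, ENNReal.ofReal (q x) = ENNReal.ofReal (2 * (1 + (Kχ : ℝ) ^ 2) *
      (ip ℓ u u + ipv ℓ (wgrad ℓ u) (wgrad ℓ u))) := by
    rw [← ofReal_integral_eq_lintegral_ofReal hqi (Eventually.of_forall hq0)]
    congr 1
    rw [integral_const_mul, integral_add (integrableOn_cube_of_continuous (by fun_prop))
      hu.integrableOn_norm_fderiv_sq, hu.ipv_wgrad hℓ]
    simp only [ip, sq]
  set H := ip ℓ u u + ipv ℓ (wgrad ℓ u) (wgrad ℓ u) with hH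
  have hH0 : 0 ≤ H := by
    rw [hH, hu.ipv_wgrad hℓ]
    exact add_nonneg (integral_nonneg fun x => mul_self_nonneg _)
      (integral_nonneg fun x => by positivity)
  have h4 : ∫⁻ x in cube d ℓ, ENNReal.ofReal (u x ^ 6) ≤ ENNReal.ofReal (C * (A * H) ^ 3) := by
    calc ∫⁻ x in cube d ℓ, ENNReal.ofReal (u x ^ 6) = ∫⁻ x in cube d ℓ, ‖v x‖ₑ ^ 6 := by
          refine setLIntegral_congr_fun (measurableSet_cube d ℓ) fun x hx => ?_
          have : χ x = 1 := χ.one_of_mem_closedBall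
            (Metric.closedBall_subset_closedBall (le_max_left R 1) (hR (cube_subset_closedCube d ℓ hx)))
          simp only [v, this, one_mul]
          rw [← ofReal_norm, ← ENNReal.ofReal_pow (norm_nonneg _), Real.norm_eq_abs]
          congr 1
          exact (Even.pow_abs (by decide) _).symm
      _ ≤ ∫⁻ x, ‖v x‖ₑ ^ 6 := setLIntegral_le_lintegral _ _
      _ ≤ _ := h1
      _ ≤ C * (n * ENNReal.ofReal (2 * (1 + (Kχ : ℝ) ^ 2) * H)) ^ 3 := by
          rw [← h3]; gcongr
      _ = _ := by
          have hA' : A * H = n * (2 * (1 + (Kχ : ℝ) ^ 2) * H) := by rw [hA]; ring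
          rw [ENNReal.ofReal_mul (by positivity : (0 : ℝ) ≤ C), ENNReal.ofReal_coe_nnreal,
            ENNReal.ofReal_pow (by positivity), hA', ENNReal.ofReal_mul (Nat.cast_nonneg n),
            ENNReal.ofReal_natCast]
  rw [integral_eq_lintegral_of_nonneg_ae (Eventually.of_forall fun x => by positivity)
    (integrableOn_cube_of_continuous (by fun_prop)).aestronglyMeasurable]
  refine (ENNReal.toReal_mono ENNReal.ofReal_ne_top h4).trans ?_
  rw [ENNReal.toReal_ofReal (by positivity)]
  have : 0 ≤ H ^ 3 := by positivity
  nlinarith [this]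

end Sobolev

end CHAC
end

noncomputable section

namespace CHAC

/-! ### Estimates for the potential -/

section Potential

/-- Partial derivative in the first variable. -/
def pa (G : ℝ × ℝ → ℝ) : ℝ × ℝ → ℝ := fun p => fderiv ℝ G p (1, 0)

/-- Partial derivative in the second variable. -/
def pb (G : ℝ × ℝ → ℝ) : ℝ × ℝ → ℝ := fun p => fderiv ℝ G p (0, 1)

variable {G : ℝ × ℝ → ℝ}

lemma contDiff_pa (hG : ContDiff ℝ ∞ G) : ContDiff ℝ ∞ (pa G) :=
  (hG.fderiv_right (m := ∞) (by simp)).clm_apply contDiff_const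

lemma contDiff_pb (hG : ContDiff ℝ ∞ G) : ContDiff ℝ ∞ (pb G) :=
  (hG.fderiv_right (m := ∞) (by simp)).clm_apply contDiff_const

lemma fderiv_eq_pa_pb (G : ℝ × ℝ → ℝ) (p h : ℝ × ℝ) :
    fderiv ℝ G p h = pa G p * h.1 + pb G p * h.2 := by
  have : h = h.1 • ((1 : ℝ), (0 : ℝ)) + h.2 • ((0 : ℝ), (1 : ℝ)) := by ext <;> simp
  conv_lhs => rw [this]
  rw [map_add, map_smul, map_smul, smul_eq_mul, smul_eq_mul, pa, pb]; ring

/-- Symmetry of the second derivative. The growth hypothesis bounds mixed derivatives in one order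
only (second variable first), so every other order is brought to that form. -/
lemma pa_pb_comm (hG : ContDiff ℝ ∞ G) : pa (pb G) = pb (pa G) := by
  funext p
  have hd : DifferentiableAt ℝ (fderiv ℝ G) p :=
    (hG.fderiv_right (m := ∞) (by simp)).differentiable (by simp) p
  have hs : IsSymmSndFDerivAt ℝ G p := (contDiff_infty.mp hG 2).contDiffAt.isSymmSndFDerivAt (by simp)
  have h1 : pa (pb G) p = fderiv ℝ (fderiv ℝ G) p (1, 0) (0, 1) := by
    change fderiv ℝ (fun q => fderiv ℝ G q (0, 1)) p (1, 0) = _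
    rw [fderiv_clm_apply hd (differentiableAt_const _)]
    simp
  have h2 : pb (pa G) p = fderiv ℝ (fderiv ℝ G) p (0, 1) (1, 0) := by
    change fderiv ℝ (fun q => fderiv ℝ G q (1, 0)) p (0, 1) = _
    rw [fderiv_clm_apply hd (differentiableAt_const _)]
    simp
  rw [h1, h2]
  exact hs.eq _ _

lemma hasDerivAt_comp_curve (hG : ContDiff ℝ ∞ G) {φ ψ : ℝ → ℝ} {φ' ψ' t : ℝ}
    (hφ : HasDerivAt φ φ' t) (hψ : HasDerivAt ψ ψ' t) :
    HasDerivAt (fun s => G (φ s, ψ s)) (pa G (φ t, ψ t) * φ' + pb G (φ t, ψ t) * ψ') t := by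
  have h := (hG.differentiable (by simp) (φ t, ψ t)).hasFDerivAt.comp_hasDerivAt t
    (hφ.prodMk hψ)
  rwa [fderiv_eq_pa_pb] at h

lemma deriv_left (hG : ContDiff ℝ ∞ G) (a b : ℝ) : deriv (fun r => G (r, b)) a = pa G (a, b) := by
  simpa using (hasDerivAt_comp_curve hG (hasDerivAt_id a) (hasDerivAt_const a b)).deriv

lemma deriv_right (hG : ContDiff ℝ ∞ G) (a b : ℝ) : deriv (fun s => G (a, s)) b = pb G (a, b) := by
  simpa using (hasDerivAt_comp_curve hG (hasDerivAt_const b a) (hasDerivAt_id b)).deriv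

lemma iteratedDeriv_left (k : ℕ) (hG : ContDiff ℝ ∞ G) (b : ℝ) :
    iteratedDeriv k (fun r => G (r, b)) = fun a => (pa^[k] G) (a, b) := by
  induction k generalizing G with
  | zero => simp
  | succ k ih =>
    rw [iteratedDeriv_succ']
    have : deriv (fun r => G (r, b)) = fun r => pa G (r, b) := funext fun a => deriv_left hG a b
    rw [this, ih (contDiff_pa hG)]
    rfl

lemma iteratedDeriv_right (k : ℕ) (hG : ContDiff ℝ ∞ G) (a : ℝ) :
    iteratedDeriv k (fun s => G (a, s)) = fun b => (pb^[k] G) (a, b) := by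
  induction k generalizing G with
  | zero => simp
  | succ k ih =>
    rw [iteratedDeriv_succ']
    have : deriv (fun r => G (a, r)) = fun r => pb G (a, r) := funext fun b => deriv_right hG a b
    rw [this, ih (contDiff_pb hG)]
    rfl

lemma contDiff_pb_iterate (k : ℕ) (hG : ContDiff ℝ ∞ G) : ContDiff ℝ ∞ (pb^[k] G) := by
  induction k generalizing G with
  | zero => simpa
  | succ k ih => exact ih (contDiff_pb hG)

lemma abs_sub_le_of_partial_le (hG : ContDiff ℝ ∞ G) {a b a' b' B : ℝ}
    (ha : ∀ s ∈ Set.Icc (0 : ℝ) 1, |pa G (a' + s * (a - a'), b' + s * (b - b'))| ≤ B)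
    (hb : ∀ s ∈ Set.Icc (0 : ℝ) 1, |pb G (a' + s * (a - a'), b' + s * (b - b'))| ≤ B) :
    |G (a, b) - G (a', b')| ≤ B * (|a - a'| + |b - b'|) := by
  have hl : ∀ (x y t : ℝ), HasDerivAt (fun s : ℝ => x + s * y) y t := fun x y t => by
    simpa using ((hasDerivAt_id t).mul_const y).const_add x
  have hd := fun t => hasDerivAt_comp_curve hG (hl a' (a - a') t) (hl b' (b - b') t)
  obtain ⟨c, hc, he⟩ := exists_hasDerivAt_eq_slope _ _ one_pos
    (fun t _ => (hd t).continuousAt.continuousWithinAt) (fun t _ => hd t)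
  have hc' := Set.Ioo_subset_Icc_self hc
  simp only [one_mul, zero_mul, add_zero, sub_zero, div_one, add_sub_cancel] at he
  rw [← he]
  refine (abs_add_le _ _).trans ?_
  rw [abs_mul, abs_mul, mul_add]
  exact add_le_add (mul_le_mul_of_nonneg_right (ha c hc') (abs_nonneg _))
    (mul_le_mul_of_nonneg_right (hb c hc') (abs_nonneg _))

/-- The mean value theorem twice: once along the segment, which produces first derivatives at an
intermediate point `c`, and once more for those derivatives between the base point and `c`. -/
lemma abs_taylor_le_of_partial_le (hG : ContDiff ℝ ∞ G) {a b a' b' B : ℝ}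
    (haa : ∀ s ∈ Set.Icc (0 : ℝ) 1, |pa (pa G) (a' + s * (a - a'), b' + s * (b - b'))| ≤ B)
    (hab : ∀ s ∈ Set.Icc (0 : ℝ) 1, |pa (pb G) (a' + s * (a - a'), b' + s * (b - b'))| ≤ B)
    (hbb : ∀ s ∈ Set.Icc (0 : ℝ) 1, |pb (pb G) (a' + s * (a - a'), b' + s * (b - b'))| ≤ B) :
    |G (a, b) - G (a', b') - (pa G (a', b') * (a - a') + pb G (a', b') * (b - b'))| ≤
      2 * B * ((a - a') ^ 2 + (b - b') ^ 2) := by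
  have hB : 0 ≤ B := (abs_nonneg _).trans (haa 0 (by simp))
  have hl : ∀ (x y t : ℝ), HasDerivAt (fun s : ℝ => x + s * y) y t := fun x y t => by
    simpa using ((hasDerivAt_id t).mul_const y).const_add x
  have hd := fun t => hasDerivAt_comp_curve hG (hl a' (a - a') t) (hl b' (b - b') t)
  obtain ⟨c, hc, he⟩ := exists_hasDerivAt_eq_slope _ _ one_pos
    (fun t _ => (hd t).continuousAt.continuousWithinAt) (fun t _ => hd t)
  have hc' := Set.Ioo_subset_Icc_self hc
  simp only [one_mul, zero_mul, add_zero, sub_zero, div_one, add_sub_cancel] at he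
  rw [← he]
  have hseg : ∀ s ∈ Set.Icc (0 : ℝ) 1, s * c ∈ Set.Icc (0 : ℝ) 1 := fun s hs =>
    ⟨mul_nonneg hs.1 hc'.1, mul_le_one₀ hs.2 hc'.1 hc'.2⟩
  have hre : ∀ x x' s : ℝ, x' + s * (x' + c * (x - x') - x') = x' + s * c * (x - x') :=
    fun x x' s => by ring
  have hc1 : ∀ x x' : ℝ, |x' + c * (x - x') - x'| ≤ |x - x'| := fun x x' => by
    rw [add_sub_cancel_left, abs_mul, abs_of_nonneg hc'.1]
    exact mul_le_of_le_one_left (abs_nonneg _) hc'.2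
  have h1 : |pa G (a' + c * (a - a'), b' + c * (b - b')) - pa G (a', b')| ≤
      B * (|a - a'| + |b - b'|) := by
    refine (abs_sub_le_of_partial_le (contDiff_pa hG) (B := B) (fun s hs => ?_)
      (fun s hs => ?_)).trans (mul_le_mul_of_nonneg_left (add_le_add (hc1 _ _) (hc1 _ _)) hB)
    · rw [hre, hre]; exact haa _ (hseg s hs)
    · rw [hre, hre, ← pa_pb_comm hG]; exact hab _ (hseg s hs)
  have h2 : |pb G (a' + c * (a - a'), b' + c * (b - b')) - pb G (a', b')| ≤
      B * (|a - a'| + |b - b'|) := by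
    refine (abs_sub_le_of_partial_le (contDiff_pb hG) (B := B) (fun s hs => ?_)
      (fun s hs => ?_)).trans (mul_le_mul_of_nonneg_left (add_le_add (hc1 _ _) (hc1 _ _)) hB)
    · rw [hre, hre]; exact hab _ (hseg s hs)
    · rw [hre, hre]; exact hbb _ (hseg s hs)
  set X := pa G (a' + c * (a - a'), b' + c * (b - b'))
  set Y := pb G (a' + c * (a - a'), b' + c * (b - b'))
  have h3 : X * (a - a') + Y * (b - b') - (pa G (a', b') * (a - a') + pb G (a', b') * (b - b')) =
      (X - pa G (a', b')) * (a - a') + (Y - pb G (a', b')) * (b - b') := by ring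
  rw [h3]
  refine (abs_add_le _ _).trans ?_
  rw [abs_mul, abs_mul]
  calc _ ≤ B * (|a - a'| + |b - b'|) * |a - a'| + B * (|a - a'| + |b - b'|) * |b - b'| := by gcongr
    _ = B * (|a - a'| + |b - b'|) ^ 2 := by ring
    _ ≤ B * (2 * ((a - a') ^ 2 + (b - b') ^ 2)) := by
        gcongr
        rw [← sq_abs (a - a'), ← sq_abs (b - b')]
        nlinarith [sq_nonneg (|a - a'| - |b - b'|)]
    _ = _ := by ring

lemma abs_segment_le {x x' s : ℝ} (hs : s ∈ Set.Icc (0 : ℝ) 1) :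
    |x' + s * (x - x')| ≤ |x| + |x'| := by
  have : x' + s * (x - x') = (1 - s) * x' + s * x := by ring
  rw [this]
  refine (abs_add_le _ _).trans ?_
  rw [abs_mul, abs_mul, abs_of_nonneg hs.1, abs_of_nonneg (sub_nonneg.mpr hs.2)]
  have h1 := mul_le_of_le_one_left (abs_nonneg x) hs.2
  have h2 : (1 - s) * |x'| ≤ |x'| := mul_le_of_le_one_left (abs_nonneg x') (by linarith [hs.1])
  linarith

namespace PotentialAssumption

variable {c₁ c₂ α κ : ℝ} {f : ℝ → ℝ → ℝ}

/-- The potential as a function on the plane. -/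
abbrev _root_.CHAC.unc (f : ℝ → ℝ → ℝ) : ℝ × ℝ → ℝ := fun p => f p.1 p.2

lemma fρ_eq (hf : PotentialAssumption c₁ c₂ α κ f) (a b : ℝ) : fρ f a b = pa (unc f) (a, b) :=
  deriv_left hf.smooth a b

lemma fη_eq (hf : PotentialAssumption c₁ c₂ α κ f) (a b : ℝ) : fη f a b = pb (unc f) (a, b) :=
  deriv_right hf.smooth a b

/-- The growth hypothesis with both constants merged into one nonnegative factor; no signs of `c₁`,
`c₂` are assumed. -/
lemma abs_partial_le (hf : PotentialAssumption c₁ c₂ α κ f) {k l : ℕ} (hkl : k + l ≤ 4)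
    (a b : ℝ) : |(pa^[k] (pb^[l] (unc f))) (a, b)| ≤
      (|c₁| + |c₂|) * (1 + |a| ^ (4 - (k + l)) + |b| ^ (4 - (k + l))) := by
  have h := hf.growth k l hkl a b
  have h1 : (fun r => iteratedDeriv l (fun s => f r s) b) =
      fun r => (pb^[l] (unc f)) (r, b) := by
    funext r
    exact congrFun (iteratedDeriv_right l hf.smooth r) b
  rw [h1, iteratedDeriv_left k (contDiff_pb_iterate l hf.smooth)] at h
  refine h.trans ?_
  have h2 : 0 ≤ |a| ^ (4 - (k + l)) := by positivity
  have h3 : 0 ≤ |b| ^ (4 - (k + l)) := by positivity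
  nlinarith [le_abs_self c₁, le_abs_self c₂, mul_nonneg (abs_nonneg c₂) (add_nonneg h2 h3),
    abs_nonneg c₁, mul_le_mul_of_nonneg_right (le_abs_self c₁) (add_nonneg h2 h3)]

lemma le_growth (hf : PotentialAssumption c₁ c₂ α κ f) (a b : ℝ) :
    f a b ≤ (|c₁| + |c₂|) * (1 + a ^ 4 + b ^ 4) := by
  have := hf.abs_partial_le (k := 0) (l := 0) (by norm_num) a b
  simp only [Function.iterate_zero, id, Nat.add_zero, Nat.sub_zero] at this
  rw [Even.pow_abs (by decide), Even.pow_abs (by decide)] at this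
  exact (le_abs_self _).trans this

lemma abs_second_le (hf : PotentialAssumption c₁ c₂ α κ f) {k l : ℕ} (hkl : k + l = 2)
    {a b a' b' s : ℝ} (hs : s ∈ Set.Icc (0 : ℝ) 1) :
    |(pa^[k] (pb^[l] (unc f))) (a' + s * (a - a'), b' + s * (b - b'))| ≤
      2 * (|c₁| + |c₂|) * (1 + a ^ 2 + b ^ 2 + a' ^ 2 + b' ^ 2) := by
  have h := hf.abs_partial_le (k := k) (l := l) (by omega) (a' + s * (a - a')) (b' + s * (b - b'))
  rw [hkl] at h
  refine h.trans ?_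
  have h1 := pow_le_pow_left₀ (abs_nonneg _) (abs_segment_le (x := a) (x' := a') hs) 2
  have h2 := pow_le_pow_left₀ (abs_nonneg _) (abs_segment_le (x := b) (x' := b') hs) 2
  have h3 : ∀ x y : ℝ, (|x| + |y|) ^ 2 ≤ 2 * (x ^ 2 + y ^ 2) := fun x y => by
    rw [← sq_abs x, ← sq_abs y]; nlinarith [sq_nonneg (|x| - |y|)]
  have hC : 0 ≤ |c₁| + |c₂| := by positivity
  norm_num
  rw [mul_comm 2, mul_assoc]
  refine mul_le_mul_of_nonneg_left ?_ hC
  have := h1.trans (h3 a a')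
  have := h2.trans (h3 b b')
  simp only [sq_abs] at *
  linarith

lemma abs_third_le (hf : PotentialAssumption c₁ c₂ α κ f) {k l : ℕ} (hkl : k + l = 3)
    {a b a' b' s : ℝ} (hs : s ∈ Set.Icc (0 : ℝ) 1) :
    |(pa^[k] (pb^[l] (unc f))) (a' + s * (a - a'), b' + s * (b - b'))| ≤
      (|c₁| + |c₂|) * (1 + |a| + |b| + |a'| + |b'|) := by
  have h := hf.abs_partial_le (k := k) (l := l) (by omega) (a' + s * (a - a')) (b' + s * (b - b'))
  rw [hkl] at h
  refine h.trans ?_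
  have h1 := abs_segment_le (x := a) (x' := a') hs
  have h2 := abs_segment_le (x := b) (x' := b') hs
  have hC : 0 ≤ |c₁| + |c₂| := by positivity
  refine mul_le_mul_of_nonneg_left ?_ hC
  norm_num
  linarith

lemma abs_fρ_sub_le (hf : PotentialAssumption c₁ c₂ α κ f) (a b a' b' : ℝ) :
    |fρ f a b - fρ f a' b'| ≤
      2 * (|c₁| + |c₂|) * (1 + a ^ 2 + b ^ 2 + a' ^ 2 + b' ^ 2) * (|a - a'| + |b - b'|) := by
  rw [hf.fρ_eq, hf.fρ_eq]
  refine abs_sub_le_of_partial_le (contDiff_pa hf.smooth) (fun s hs => ?_) (fun s hs => ?_)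
  · exact hf.abs_second_le (k := 2) (l := 0) rfl hs
  · rw [← pa_pb_comm hf.smooth]
    exact hf.abs_second_le (k := 1) (l := 1) rfl hs

lemma abs_taylor_fρ_le (hf : PotentialAssumption c₁ c₂ α κ f) (a b a' b' : ℝ) :
    |fρ f a b - fρ f a' b' - (pa (pa (unc f)) (a', b') * (a - a') +
        pa (pb (unc f)) (a', b') * (b - b'))| ≤
      2 * ((|c₁| + |c₂|) * (1 + |a| + |b| + |a'| + |b'|)) * ((a - a') ^ 2 + (b - b') ^ 2) := by
  rw [hf.fρ_eq, hf.fρ_eq, pa_pb_comm hf.smooth]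
  refine abs_taylor_le_of_partial_le (contDiff_pa hf.smooth) (fun s hs => ?_) (fun s hs => ?_)
    (fun s hs => ?_)
  · exact hf.abs_third_le (k := 3) (l := 0) rfl hs
  · rw [← pa_pb_comm hf.smooth]
    exact hf.abs_third_le (k := 2) (l := 1) rfl hs
  · rw [← pa_pb_comm hf.smooth, ← pa_pb_comm (contDiff_pb hf.smooth)]
    exact hf.abs_third_le (k := 1) (l := 2) rfl hs

lemma abs_taylor_fη_le (hf : PotentialAssumption c₁ c₂ α κ f) (a b a' b' : ℝ) :
    |fη f a b - fη f a' b' - (pa (pb (unc f)) (a', b') * (a - a') +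
        pb (pb (unc f)) (a', b') * (b - b'))| ≤
      2 * ((|c₁| + |c₂|) * (1 + |a| + |b| + |a'| + |b'|)) * ((a - a') ^ 2 + (b - b') ^ 2) := by
  rw [hf.fη_eq, hf.fη_eq]
  refine abs_taylor_le_of_partial_le (contDiff_pb hf.smooth) (fun s hs => ?_) (fun s hs => ?_)
    (fun s hs => ?_)
  · exact hf.abs_third_le (k := 2) (l := 1) rfl hs
  · exact hf.abs_third_le (k := 1) (l := 2) rfl hs
  · exact hf.abs_third_le (k := 0) (l := 3) rfl hs

/-- The convex function `f + (α - κ)/2 |·|²`, restricted to the segment, lies above its tangent at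
the base point. The quadratic part contributes exactly `(α - κ)/2` times the squared distance. -/
lemma relPotential_ge (hf : PotentialAssumption c₁ c₂ α κ f) (a b a' b' : ℝ) :
    (κ - α) / 2 * ((a - a') ^ 2 + (b - b') ^ 2) ≤
      f a b - f a' b' - fρ f a' b' * (a - a') - fη f a' b' * (b - b') := by
  have hl : ∀ (x y t : ℝ), HasDerivAt (fun s : ℝ => x + s * y) y t := fun x y t => by
    simpa using ((hasDerivAt_id t).mul_const y).const_add x
  set ψ : ℝ → ℝ := fun s => f (a' + s * (a - a')) (b' + s * (b - b'))
    + α / 2 * ((a' + s * (a - a')) ^ 2 + (b' + s * (b - b')) ^ 2)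
    - κ / 2 * ((a' + s * (a - a')) ^ 2 + (b' + s * (b - b')) ^ 2) with hψ
  have hconv : ConvexOn ℝ Set.univ ψ := by
    have h := hf.convex.comp_affineMap (AffineMap.lineMap (k := ℝ) (a', b') (a, b))
    simp only [Set.preimage_univ] at h
    convert! h using 1
    funext s
    simp [hψ, AffineMap.lineMap_apply, add_comm]
  have hsq : HasDerivAt (fun s : ℝ => (a' + s * (a - a')) ^ 2 + (b' + s * (b - b')) ^ 2)
      (2 * a' * (a - a') + 2 * b' * (b - b')) 0 := by
    exact (((hl a' (a - a') 0).pow 2).add ((hl b' (b - b') 0).pow 2)).congr_deriv (by simp)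
  have hF := hasDerivAt_comp_curve hf.smooth (hl a' (a - a') 0) (hl b' (b - b') 0)
  have hd := (hF.add (hsq.const_mul (α / 2))).sub (hsq.const_mul (κ / 2))
  have h1 := hconv.le_slope_of_hasDerivAt (Set.mem_univ 0) (Set.mem_univ 1) one_pos hd
  rw [slope_def_field] at h1
  simp only [hψ, zero_mul, add_zero, one_mul, sub_zero, div_one, add_sub_cancel] at h1
  rw [hf.fρ_eq, hf.fη_eq]
  change pa (unc f) _ * _ + pb (unc f) _ * _ + _ - _ ≤ _ at h1
  nlinarith [h1]

end PotentialAssumption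

end Potential

end CHAC
end

noncomputable section

namespace CHAC

open MeasureTheory Filter Topology

/-! ### Bilinear forms on periodic Lipschitz functions -/

section Bilinear

variable {d : ℕ} {ℓ : ℝ} {u v w : E d → ℝ}

/-- The Dirichlet form. -/
def gg {d : ℕ} (ℓ : ℝ) (u v : E d → ℝ) : ℝ := ipv ℓ (wgrad ℓ u) (wgrad ℓ v)

/-- The square of the norm of `H¹(Ω)`. -/
def H1sq {d : ℕ} (ℓ : ℝ) (u : E d → ℝ) : ℝ := ip ℓ u u + gg ℓ u u

lemma ip_comm (u v : E d → ℝ) : ip ℓ u v = ip ℓ v u := by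
  simp only [ip, mul_comm]

lemma ip_add_left (hu : Continuous u) (hv : Continuous v) (hw : Continuous w) :
    ip ℓ (u + v) w = ip ℓ u w + ip ℓ v w := by
  simp only [ip, Pi.add_apply, add_mul]
  exact integral_add (integrableOn_cube_of_continuous (by fun_prop))
    (integrableOn_cube_of_continuous (by fun_prop))

lemma ip_sub_left (hu : Continuous u) (hv : Continuous v) (hw : Continuous w) :
    ip ℓ (u - v) w = ip ℓ u w - ip ℓ v w := by
  simp only [ip, Pi.sub_apply, sub_mul]
  exact integral_sub (integrableOn_cube_of_continuous (by fun_prop))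
    (integrableOn_cube_of_continuous (by fun_prop))

lemma ip_smul_left (c : ℝ) (u w : E d → ℝ) : ip ℓ (c • u) w = c * ip ℓ u w := by
  simp only [ip, Pi.smul_apply, smul_eq_mul, mul_assoc]
  exact integral_const_mul _ _

lemma ip_add_right (hu : Continuous u) (hv : Continuous v) (hw : Continuous w) :
    ip ℓ w (u + v) = ip ℓ w u + ip ℓ w v := by
  rw [ip_comm, ip_add_left hu hv hw, ip_comm u, ip_comm v]

lemma ip_smul_right (c : ℝ) (u w : E d → ℝ) : ip ℓ w (c • u) = c * ip ℓ w u := by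
  rw [ip_comm, ip_smul_left, ip_comm]

lemma ip_self_nonneg (u : E d → ℝ) : 0 ≤ ip ℓ u u := integral_nonneg fun _ => mul_self_nonneg _

lemma integrable_inner_wgrad (u v : E d → ℝ) :
    IntegrableOn (fun x => inner ℝ (wgrad ℓ u x) (wgrad ℓ v x)) (cube d ℓ) :=
  ((memLp_wgrad ℓ u).norm.integrable_mul (memLp_wgrad ℓ v).norm).mono'
    ((memLp_wgrad ℓ u).1.inner (memLp_wgrad ℓ v).1)
    (Eventually.of_forall fun _ => norm_inner_le_norm _ _)

lemma gg_comm (u v : E d → ℝ) : gg ℓ u v = gg ℓ v u := by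
  simp only [gg, ipv, real_inner_comm]

lemma gg_add_left (hℓ : 0 < ℓ) (hu : LipPer ℓ u) (hv : LipPer ℓ v) (w : E d → ℝ) :
    gg ℓ (u + v) w = gg ℓ u w + gg ℓ v w := by
  unfold gg ipv
  rw [← integral_add (integrable_inner_wgrad u w) (integrable_inner_wgrad v w)]
  refine integral_congr_ae (ae_restrict_of_ae ?_)
  filter_upwards [wgrad_add hℓ hu hv] with x hx
  rw [hx, inner_add_left]

lemma gg_sub_left (hℓ : 0 < ℓ) (hu : LipPer ℓ u) (hv : LipPer ℓ v) (w : E d → ℝ) :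
    gg ℓ (u - v) w = gg ℓ u w - gg ℓ v w := by
  unfold gg ipv
  rw [← integral_sub (integrable_inner_wgrad u w) (integrable_inner_wgrad v w)]
  refine integral_congr_ae (ae_restrict_of_ae ?_)
  filter_upwards [wgrad_sub hℓ hu hv] with x hx
  rw [hx, inner_sub_left]

lemma gg_smul_left (hℓ : 0 < ℓ) (hu : LipPer ℓ u) (c : ℝ) (w : E d → ℝ) :
    gg ℓ (c • u) w = c * gg ℓ u w := by
  unfold gg ipv
  rw [← integral_const_mul]
  refine integral_congr_ae (ae_restrict_of_ae ?_)
  filter_upwards [wgrad_smul hℓ hu c] with x hx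
  rw [hx, real_inner_smul_left]

lemma gg_add_right (hℓ : 0 < ℓ) (hu : LipPer ℓ u) (hv : LipPer ℓ v) (w : E d → ℝ) :
    gg ℓ w (u + v) = gg ℓ w u + gg ℓ w v := by
  rw [gg_comm, gg_add_left hℓ hu hv, gg_comm u, gg_comm v]

lemma gg_smul_right (hℓ : 0 < ℓ) (hu : LipPer ℓ u) (c : ℝ) (w : E d → ℝ) :
    gg ℓ w (c • u) = c * gg ℓ w u := by
  rw [gg_comm, gg_smul_left hℓ hu, gg_comm]

lemma gg_const (hℓ : 0 < ℓ) (c : ℝ) (w : E d → ℝ) : gg ℓ w (fun _ => c) = 0 := by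
  unfold gg ipv
  rw [← integral_zero (E d) ℝ (μ := volume.restrict (cube d ℓ))]
  refine integral_congr_ae (ae_restrict_of_ae ?_)
  filter_upwards [wgrad_const hℓ c] with x hx
  rw [hx, inner_zero_right]

lemma gg_self_nonneg (u : E d → ℝ) : 0 ≤ gg ℓ u u :=
  integral_nonneg fun _ => real_inner_self_nonneg

lemma H1sq_nonneg (u : E d → ℝ) : 0 ≤ H1sq ℓ u := add_nonneg (ip_self_nonneg u) (gg_self_nonneg u)

lemma ip_add_smul_self (hu : Continuous u) (hv : Continuous v) (s : ℝ) :
    ip ℓ (u + s • v) (u + s • v) = ip ℓ u u + 2 * s * ip ℓ u v + s ^ 2 * ip ℓ v v := by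
  have hsv : Continuous (s • v) := hv.const_smul s
  rw [ip_add_left hu hsv (hu.add hsv), ip_add_right hu hsv hu, ip_add_right hu hsv hsv,
    ip_smul_right, ip_smul_left, ip_smul_left, ip_smul_right, ip_comm v u]
  ring

lemma gg_add_smul_self (hℓ : 0 < ℓ) (hu : LipPer ℓ u) (hv : LipPer ℓ v) (s : ℝ) :
    gg ℓ (u + s • v) (u + s • v) = gg ℓ u u + 2 * s * gg ℓ u v + s ^ 2 * gg ℓ v v := by
  have hsv := hv.const_smul s
  rw [gg_add_left hℓ hu hsv, gg_add_right hℓ hu hsv, gg_add_right hℓ hu hsv,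
    gg_smul_right hℓ hv, gg_smul_left hℓ hv, gg_smul_left hℓ hv, gg_smul_right hℓ hv, gg_comm v u]
  ring

lemma ip_sq_le (hu : Continuous u) (hv : Continuous v) :
    ip ℓ u v ^ 2 ≤ ip ℓ u u * ip ℓ v v := by
  have h := discrim_le_zero (a := ip ℓ v v) (b := 2 * ip ℓ u v) (c := ip ℓ u u) fun t => by
    have := ip_self_nonneg (ℓ := ℓ) (u + t • v)
    rw [ip_add_smul_self hu hv] at this
    linarith
  rw [discrim] at h
  linarith

lemma gg_add_self_le (hℓ : 0 < ℓ) (hu : LipPer ℓ u) (hv : LipPer ℓ v) :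
    gg ℓ (u + v) (u + v) ≤ 2 * gg ℓ u u + 2 * gg ℓ v v := by
  have h1 := gg_add_smul_self hℓ hu hv 1
  have h2 := gg_add_smul_self hℓ hu hv (-1)
  have h3 := gg_self_nonneg (ℓ := ℓ) (u + (-1 : ℝ) • v)
  rw [one_smul] at h1
  linarith

lemma ip_add_self_le (hu : Continuous u) (hv : Continuous v) :
    ip ℓ (u + v) (u + v) ≤ 2 * ip ℓ u u + 2 * ip ℓ v v := by
  have h1 := ip_add_smul_self (ℓ := ℓ) hu hv 1
  have h2 := ip_add_smul_self (ℓ := ℓ) hu hv (-1)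
  have h3 := ip_self_nonneg (ℓ := ℓ) (u + (-1 : ℝ) • v)
  rw [one_smul] at h1
  linarith

lemma H1sq_smul (hℓ : 0 < ℓ) (hu : LipPer ℓ u) (c : ℝ) :
    H1sq ℓ (c • u) = c ^ 2 * H1sq ℓ u := by
  rw [H1sq, H1sq, ip_smul_left, ip_smul_right, gg_smul_left hℓ hu, gg_smul_right hℓ hu]
  ring

lemma H1sq_add_le (hℓ : 0 < ℓ) (hu : LipPer ℓ u) (hv : LipPer ℓ v) :
    H1sq ℓ (u + v) ≤ 2 * H1sq ℓ u + 2 * H1sq ℓ v := by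
  have h1 := gg_add_self_le hℓ hu hv
  have h2 := ip_add_self_le (ℓ := ℓ) hu.continuous hv.continuous
  simp only [H1sq]; linarith

lemma H1sq_add_smul (hℓ : 0 < ℓ) (hu : LipPer ℓ u) (hv : LipPer ℓ v) (s : ℝ) :
    H1sq ℓ (u + s • v) = H1sq ℓ u + 2 * s * (ip ℓ u v + gg ℓ u v) + s ^ 2 * H1sq ℓ v := by
  simp only [H1sq, ip_add_smul_self hu.continuous hv.continuous, gg_add_smul_self hℓ hu hv]
  ring

/-- Convexity of the squared norm: bounds at the time nodes hold throughout the step. -/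
lemma H1sq_segment_le (hℓ : 0 < ℓ) (hu : LipPer ℓ u) (hv : LipPer ℓ v) {τ s B : ℝ}
    (hτ : 0 < τ) (hs : s ∈ Set.Icc 0 τ) (h0 : H1sq ℓ u ≤ B) (h1 : H1sq ℓ (u + τ • v) ≤ B) :
    H1sq ℓ (u + s • v) ≤ B := by
  rw [H1sq_add_smul hℓ hu hv] at *
  set P := ip ℓ u v + gg ℓ u v
  set A := H1sq ℓ u
  set C := H1sq ℓ v with hC
  have hC0 : 0 ≤ C := H1sq_nonneg v
  have h2 : τ * (A + 2 * s * P + s ^ 2 * C) =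
      (τ - s) * A + s * (A + 2 * τ * P + τ ^ 2 * C) - s * (τ - s) * τ * C := by ring
  have h3 : (τ - s) * A ≤ (τ - s) * B := mul_le_mul_of_nonneg_left h0 (sub_nonneg.mpr hs.2)
  have h4 : s * (A + 2 * τ * P + τ ^ 2 * C) ≤ s * B := mul_le_mul_of_nonneg_left h1 hs.1
  have h5 : 0 ≤ s * (τ - s) * τ * C :=
    mul_nonneg (mul_nonneg (mul_nonneg hs.1 (sub_nonneg.mpr hs.2)) hτ.le) hC0
  refine le_of_mul_le_mul_left ?_ hτ
  rw [h2]; nlinarith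

/-- Jensen's inequality, here with the explicit defect `τ³/12` times `H1sq ℓ v`. It lets midpoint
errors be controlled by the time integral of the distance. -/
lemma H1sq_mid_le (hℓ : 0 < ℓ) (hu : LipPer ℓ u) (hv : LipPer ℓ v) {τ : ℝ} (hτ : 0 ≤ τ) :
    τ * H1sq ℓ (u + (τ / 2) • v) ≤ ∫ s in (0 : ℝ)..τ, H1sq ℓ (u + s • v) := by
  simp only [H1sq_add_smul hℓ hu hv]
  have h : ∫ s in (0 : ℝ)..τ, (H1sq ℓ u + 2 * s * (ip ℓ u v + gg ℓ u v) + s ^ 2 * H1sq ℓ v) =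
      τ * H1sq ℓ u + τ ^ 2 * (ip ℓ u v + gg ℓ u v) + τ ^ 3 / 3 * H1sq ℓ v := by
    have hd : ∀ s : ℝ, HasDerivAt (fun s => s * H1sq ℓ u + s ^ 2 * (ip ℓ u v + gg ℓ u v) +
        s ^ 3 / 3 * H1sq ℓ v)
        (H1sq ℓ u + 2 * s * (ip ℓ u v + gg ℓ u v) + s ^ 2 * H1sq ℓ v) s := by
      intro s
      have := ((((hasDerivAt_id s).mul_const (H1sq ℓ u))).add
        (((hasDerivAt_id s).pow 2).mul_const (ip ℓ u v + gg ℓ u v))).add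
        ((((hasDerivAt_id s).pow 3).div_const 3).mul_const (H1sq ℓ v))
      refine this.congr_deriv ?_
      simp only [id]
      push_cast
      ring
    rw [intervalIntegral.integral_eq_sub_of_hasDerivAt (fun s _ => hd s)
      (Continuous.intervalIntegrable (by fun_prop) _ _)]
    simp
  rw [h]
  have : 0 ≤ τ ^ 3 * H1sq ℓ v := mul_nonneg (by positivity) (H1sq_nonneg v)
  nlinarith

lemma normH1_sq (u : E d → ℝ) : normH1 ℓ u ^ 2 = H1sq ℓ u := Real.sq_sqrt (H1sq_nonneg u)

lemma normL2_sq (u : E d → ℝ) : normL2 ℓ u ^ 2 = ip ℓ u u := Real.sq_sqrt (ip_self_nonneg u)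

lemma H1sq_le_of_normH1_le {M : ℝ} (h : normH1 ℓ u ≤ M) : H1sq ℓ u ≤ M ^ 2 := by
  rw [← normH1_sq]
  exact pow_le_pow_left₀ (Real.sqrt_nonneg _) h 2

lemma ip_le_of_memLp (hu : MemLp u 2 (volume.restrict (cube d ℓ)))
    (hv : MemLp v 2 (volume.restrict (cube d ℓ))) :
    ip ℓ u v ≤ normL2 ℓ u * normL2 ℓ v := by
  have hi : Integrable (fun x => u x * v x) (volume.restrict (cube d ℓ)) := hu.integrable_mul hv
  have hu2 : Integrable (fun x => u x * u x) (volume.restrict (cube d ℓ)) := hu.integrable_mul hu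
  have hv2 : Integrable (fun x => v x * v x) (volume.restrict (cube d ℓ)) := hv.integrable_mul hv
  have h := discrim_le_zero (a := ip ℓ v v) (b := 2 * ip ℓ u v) (c := ip ℓ u u) fun t => by
    have h0 : 0 ≤ ∫ x in cube d ℓ, (u x + t * v x) ^ 2 := integral_nonneg fun x => sq_nonneg _
    have h1 : ∀ x, (u x + t * v x) ^ 2 = u x * u x + (2 * t) * (u x * v x) + t ^ 2 * (v x * v x) :=
      fun x => by ring
    simp only [h1] at h0
    have h2 : ∫ x in cube d ℓ, (u x * u x + (2 * t) * (u x * v x) + t ^ 2 * (v x * v x)) =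
        (∫ x in cube d ℓ, u x * u x) + 2 * t * (∫ x in cube d ℓ, u x * v x) +
          t ^ 2 * ∫ x in cube d ℓ, v x * v x := by
      have h3 : Integrable (fun x => u x * u x + 2 * t * (u x * v x))
        (volume.restrict (cube d ℓ)) := hu2.add (hi.const_mul _)
      rw [← integral_const_mul, ← integral_const_mul, ← integral_add hu2 (hi.const_mul _),
        ← integral_add h3 (hv2.const_mul _)]
    rw [h2] at h0
    simp only [ip]
    linarith
  rw [discrim] at h
  rw [normL2, normL2, ← Real.sqrt_mul (ip_self_nonneg u)]
  refine Real.le_sqrt_of_sq_le ?_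
  linarith

/-- The `sSup` defining the dual norm is meaningful because the quotients are bounded by the `L²`
norm of `r`. -/
lemma ip_le_normHneg1_mul {r : E d → ℝ} (hr : Continuous r) (hv : MemH1 ℓ v) :
    ip ℓ r v ≤ normHneg1 ℓ r * normH1 ℓ v := by
  have hle : ∀ v : E d → ℝ, normL2 ℓ v ≤ normH1 ℓ v := fun v =>
    Real.sqrt_le_sqrt (le_add_of_nonneg_right (gg_self_nonneg v))
  have hbd : BddAbove {q : ℝ | ∃ v : E d → ℝ, MemH1 ℓ v ∧ q = ip ℓ r v / normH1 ℓ v} := by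
    refine ⟨normL2 ℓ r, ?_⟩
    rintro _ ⟨v, hv, rfl⟩
    refine div_le_of_le_mul₀ (Real.sqrt_nonneg _) (Real.sqrt_nonneg _) ?_
    exact (ip_le_of_memLp (memLp_cube_of_continuous hr 2) hv.memLp).trans
      (mul_le_mul_of_nonneg_left (hle v) (Real.sqrt_nonneg _))
  have hn : 0 ≤ normH1 ℓ v := Real.sqrt_nonneg _
  -- If `normH1 ℓ v = 0` the quotient has the default value `0` and says nothing; then `v` vanishes
  -- in `L²` and so does the pairing.
  rcases hn.eq_or_lt with h0 | hpos
  · have h1 := ip_le_of_memLp (memLp_cube_of_continuous (ℓ := ℓ) hr 2) hv.memLp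
    have h2 : normL2 ℓ v = 0 := le_antisymm ((hle v).trans h0.symm.le) (Real.sqrt_nonneg _)
    rw [h2, mul_zero] at h1
    rwa [← h0, mul_zero]
  · rw [← div_le_iff₀ hpos]
    exact le_csSup hbd ⟨v, hv, rfl⟩

lemma ip_le_young {r : E d → ℝ} (hr : Continuous r) (hv : MemH1 ℓ v) {δ : ℝ} (hδ : 0 < δ) :
    ip ℓ r v ≤ normHneg1 ℓ r ^ 2 / (2 * δ) + δ / 2 * H1sq ℓ v := by
  refine (ip_le_normHneg1_mul hr hv).trans ?_
  rw [← normH1_sq]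
  have h : normHneg1 ℓ r ^ 2 / (2 * δ) + δ / 2 * normH1 ℓ v ^ 2 - normHneg1 ℓ r * normH1 ℓ v =
      (normHneg1 ℓ r - δ * normH1 ℓ v) ^ 2 / (2 * δ) := by field_simp; ring
  have : 0 ≤ (normHneg1 ℓ r - δ * normH1 ℓ v) ^ 2 / (2 * δ) := by positivity
  linarith

end Bilinear

/-! ### The mobility form -/

section Mobility

open Matrix

variable {d : ℕ} {ℓ lam₁ lam₂ lam₃ : ℝ} {L : Mobility d}

/-- The vector with a block of size `d` and a block of size one. -/
def blk {d : ℕ} (p : E d) (q : ℝ) : Fin d ⊕ Unit → ℝ := Sum.elim (fun i => p i) (fun _ => q)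

lemma blk_dotProduct_self (p : E d) (q : ℝ) : blk p q ⬝ᵥ blk p q = ‖p‖ ^ 2 + q ^ 2 := by
  rw [EuclideanSpace.norm_sq_eq]
  simp [blk, dotProduct, sq]

lemma blk_add (p p' : E d) (q q' : ℝ) : blk (p + p') (q + q') = blk p q + blk p' q' := by
  funext i; rcases i with i | i <;> simp [blk]

lemma blk_sub (p p' : E d) (q q' : ℝ) : blk (p - p') (q - q') = blk p q - blk p' q' := by
  funext i; rcases i with i | i <;> simp [blk]

lemma inner_flux (A : Matrix (Fin d ⊕ Unit) (Fin d ⊕ Unit) ℝ) (p p' : E d) (q : ℝ) :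
    inner ℝ (flux A p q) p' = blk p' 0 ⬝ᵥ A *ᵥ blk p q := by
  simp only [flux, PiLp.inner_apply, RCLike.inner_apply, conj_trivial, dotProduct, mulVec, blk,
    Fintype.sum_sum_type, Sum.elim_inl, Sum.elim_inr, Finset.univ_unique, Finset.sum_singleton,
    zero_mul, add_zero]
  refine Finset.sum_congr rfl fun i _ => ?_
  rw [mul_comm q]

lemma source_mul {A : Matrix (Fin d ⊕ Unit) (Fin d ⊕ Unit) ℝ} (hA : A.IsSymm) (p : E d)
    (q q' : ℝ) : source A p q * q' = blk 0 q' ⬝ᵥ A *ᵥ blk p q := by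
  simp only [source, dotProduct, mulVec, blk,
    Fintype.sum_sum_type, Sum.elim_inl, Sum.elim_inr, Finset.univ_unique, Finset.sum_singleton,
    PiLp.zero_apply, zero_mul, Finset.sum_const_zero, zero_add]
  rw [mul_comm]
  congr 2
  refine Finset.sum_congr rfl fun i _ => ?_
  rw [← hA.apply]

namespace MobilityAssumption

lemma nonneg (hL : MobilityAssumption lam₁ lam₂ lam₃ L) (h1 : 0 < lam₁) (z : State d)
    (ξ : Fin d ⊕ Unit → ℝ) : 0 ≤ ξ ⬝ᵥ L z *ᵥ ξ :=
  (mul_nonneg h1.le (Finset.sum_nonneg fun _ _ => mul_self_nonneg _)).trans (hL.lower z ξ)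

lemma comm (hL : MobilityAssumption lam₁ lam₂ lam₃ L) (z : State d)
    (ξ ζ : Fin d ⊕ Unit → ℝ) : ξ ⬝ᵥ L z *ᵥ ζ = ζ ⬝ᵥ L z *ᵥ ξ := by
  rw [dotProduct_mulVec, ← mulVec_transpose, (hL.symm z).eq, dotProduct_comm]

/-- Expand the nonnegative form at `s • ξ + ζ` and divide by `2 s`. The free bound `lam ≥ lam₂` is
there to be `|lam₂|` or larger later, since the sign of `lam₂` is not prescribed. -/
lemma neg_form_le (hL : MobilityAssumption lam₁ lam₂ lam₃ L) (h1 : 0 < lam₁) {lam : ℝ}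
    (hlam : lam₂ ≤ lam) (z : State d)
    (ξ ζ : Fin d ⊕ Unit → ℝ) {s : ℝ} (hs : 0 < s) :
    -(ζ ⬝ᵥ L z *ᵥ ξ) ≤ s / 2 * (ξ ⬝ᵥ L z *ᵥ ξ) + lam / (2 * s) * (ζ ⬝ᵥ ζ) := by
  have h := hL.nonneg h1 z (s • ξ + ζ)
  have h2 := hL.upper z ζ
  have h4 : lam₂ * (ζ ⬝ᵥ ζ) ≤ lam * (ζ ⬝ᵥ ζ) :=
    mul_le_mul_of_nonneg_right hlam (Finset.sum_nonneg fun _ _ => mul_self_nonneg _)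
  rw [mulVec_add, mulVec_smul, dotProduct_add, add_dotProduct, add_dotProduct, dotProduct_smul,
    dotProduct_smul, smul_dotProduct, smul_dotProduct, hL.comm z ξ ζ] at h
  simp only [smul_eq_mul] at h
  have h3 : lam / (2 * s) * (ζ ⬝ᵥ ζ) = (lam * (ζ ⬝ᵥ ζ)) / (2 * s) := by ring
  rw [h3, ← sub_le_iff_le_add', le_div_iff₀ (by positivity)]
  nlinarith

lemma abs_form_le (hL : MobilityAssumption lam₁ lam₂ lam₃ L) (h1 : 0 < lam₁) (z : State d)
    (ξ ζ : Fin d ⊕ Unit → ℝ) :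
    |ζ ⬝ᵥ L z *ᵥ ξ| ≤ lam₂ / 2 * (ξ ⬝ᵥ ξ + ζ ⬝ᵥ ζ) := by
  have ha := hL.neg_form_le h1 le_rfl z ξ ζ one_pos
  have hb := hL.neg_form_le h1 le_rfl z (-ξ) ζ one_pos
  have h2 := hL.upper z ξ
  rw [mulVec_neg, dotProduct_neg, neg_dotProduct, dotProduct_neg, neg_neg, neg_neg] at hb
  rw [abs_le]
  constructor <;> linarith

end MobilityAssumption

/-- The integrated mobility form. -/
def mobForm {d : ℕ} (ℓ : ℝ) (L : Mobility d) (z : E d → State d) (P : E d → E d) (Q : E d → ℝ)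
    (P' : E d → E d) (Q' : E d → ℝ) : ℝ :=
  ∫ x in cube d ℓ, blk (P' x) (Q' x) ⬝ᵥ L (z x) *ᵥ blk (P x) (Q x)

variable {z : E d → State d} {P P' P₂ : E d → E d} {Q Q' Q₂ : E d → ℝ}

lemma aestronglyMeasurable_blk {μ : Measure (E d)} (hP : AEStronglyMeasurable P μ)
    (hQ : AEStronglyMeasurable Q μ) (i : Fin d ⊕ Unit) :
    AEStronglyMeasurable (fun x => blk (P x) (Q x) i) μ := by
  rcases i with i | i
  · exact (EuclideanSpace.proj i : E d →L[ℝ] ℝ).continuous.comp_aestronglyMeasurable hP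
  · exact hQ

/-- Ellipticity dominates the integrand by squares of `L²` fields; continuity of the entries of `L`
provides measurability along `z`. -/
lemma integrable_mobForm (hL : MobilityAssumption lam₁ lam₂ lam₃ L) (h1 : 0 < lam₁)
    (hz : AEStronglyMeasurable z (volume.restrict (cube d ℓ)))
    (hP : MemLp P 2 (volume.restrict (cube d ℓ))) (hQ : MemLp Q 2 (volume.restrict (cube d ℓ)))
    (hP' : MemLp P' 2 (volume.restrict (cube d ℓ)))
    (hQ' : MemLp Q' 2 (volume.restrict (cube d ℓ))) :
    IntegrableOn (fun x => blk (P' x) (Q' x) ⬝ᵥ L (z x) *ᵥ blk (P x) (Q x)) (cube d ℓ) := by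
  have hn : ∀ {P : E d → E d} {Q : E d → ℝ}, MemLp P 2 (volume.restrict (cube d ℓ)) →
      MemLp Q 2 (volume.restrict (cube d ℓ)) →
      Integrable (fun x => blk (P x) (Q x) ⬝ᵥ blk (P x) (Q x)) (volume.restrict (cube d ℓ)) := by
    intro P Q hP hQ
    simp only [blk_dotProduct_self]
    have h2 := hQ.integrable_norm_pow (by norm_num)
    simp only [Real.norm_eq_abs, sq_abs] at h2
    exact (hP.integrable_norm_pow (by norm_num)).add h2
  refine Integrable.mono' (((hn hP hQ).add (hn hP' hQ')).const_mul (lam₂ / 2)) ?_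
    (Eventually.of_forall fun x => hL.abs_form_le h1 _ _ _)
  simp only [dotProduct, mulVec]
  refine Finset.aestronglyMeasurable_fun_sum _ fun i _ => ?_
  refine (aestronglyMeasurable_blk hP'.1 hQ'.1 i).mul ?_
  refine Finset.aestronglyMeasurable_fun_sum _ fun j _ => ?_
  exact ((hL.contDiff i j).continuous.comp_aestronglyMeasurable hz).mul
    (aestronglyMeasurable_blk hP.1 hQ.1 j)

lemma ipv_flux (L : Mobility d) (z : E d → State d) (P P' : E d → E d) (Q : E d → ℝ) :
    ipv ℓ (fun x => flux (L (z x)) (P x) (Q x)) P' = mobForm ℓ L z P Q P' 0 := by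
  simp only [ipv, inner_flux, mobForm]; rfl

lemma ip_source (hL : MobilityAssumption lam₁ lam₂ lam₃ L) (z : E d → State d)
    (P : E d → E d) (Q Q' : E d → ℝ) :
    ip ℓ (fun x => source (L (z x)) (P x) (Q x)) Q' = mobForm ℓ L z P Q 0 Q' := by
  simp only [ip, source_mul (hL.symm _), mobForm]; rfl

lemma mobForm_add_right (hL : MobilityAssumption lam₁ lam₂ lam₃ L) (h1 : 0 < lam₁)
    (hz : AEStronglyMeasurable z (volume.restrict (cube d ℓ)))
    (hP : MemLp P 2 (volume.restrict (cube d ℓ))) (hQ : MemLp Q 2 (volume.restrict (cube d ℓ)))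
    (hP' : MemLp P' 2 (volume.restrict (cube d ℓ)))
    (hQ' : MemLp Q' 2 (volume.restrict (cube d ℓ))) :
    mobForm ℓ L z P Q P' 0 + mobForm ℓ L z P Q 0 Q' = mobForm ℓ L z P Q P' Q' := by
  unfold mobForm
  rw [← integral_add]
  · congr 1; funext x
    rw [← add_dotProduct, ← blk_add]
    simp
  · exact integrable_mobForm hL h1 hz hP hQ hP' MemLp.zero
  · exact integrable_mobForm hL h1 hz hP hQ MemLp.zero hQ'

lemma mobForm_sub_left (hL : MobilityAssumption lam₁ lam₂ lam₃ L) (h1 : 0 < lam₁)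
    (hz : AEStronglyMeasurable z (volume.restrict (cube d ℓ)))
    (hP : MemLp P 2 (volume.restrict (cube d ℓ))) (hQ : MemLp Q 2 (volume.restrict (cube d ℓ)))
    (hP₂ : MemLp P₂ 2 (volume.restrict (cube d ℓ))) (hQ₂ : MemLp Q₂ 2 (volume.restrict (cube d ℓ)))
    (hP' : MemLp P' 2 (volume.restrict (cube d ℓ)))
    (hQ' : MemLp Q' 2 (volume.restrict (cube d ℓ))) :
    mobForm ℓ L z P Q P' Q' - mobForm ℓ L z P₂ Q₂ P' Q' =
      mobForm ℓ L z (P - P₂) (Q - Q₂) P' Q' := by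
  unfold mobForm
  rw [← integral_sub (integrable_mobForm hL h1 hz hP hQ hP' hQ')
    (integrable_mobForm hL h1 hz hP₂ hQ₂ hP' hQ')]
  congr 1; funext x
  rw [← dotProduct_sub, ← mulVec_sub, ← blk_sub]
  simp

lemma mobForm_congr (hP : P =ᵐ[volume] P₂) (hP' : P' =ᵐ[volume] (P₂' : E d → E d)) :
    mobForm ℓ L z P Q P' Q' = mobForm ℓ L z P₂ Q P₂' Q' := by
  refine integral_congr_ae (ae_restrict_of_ae ?_)
  filter_upwards [hP, hP'] with x h1 h2
  rw [h1, h2]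

lemma dissipation_eq (L : Mobility d) (z : E d → State d) (m q : E d → ℝ) :
    dissipation ℓ L z m q = mobForm ℓ L z (wgrad ℓ m) q (wgrad ℓ m) q := rfl

lemma dissipation_nonneg (hL : MobilityAssumption lam₁ lam₂ lam₃ L) (h1 : 0 < lam₁)
    (m q : E d → ℝ) : 0 ≤ dissipation ℓ L z m q :=
  integral_nonneg fun _ => hL.nonneg h1 _ _

lemma integral_blk_sq {m q : E d → ℝ} (hq : Continuous q) :
    IntegrableOn (fun x => blk (wgrad ℓ m x) (q x) ⬝ᵥ blk (wgrad ℓ m x) (q x)) (cube d ℓ) ∧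
    ∫ x in cube d ℓ, blk (wgrad ℓ m x) (q x) ⬝ᵥ blk (wgrad ℓ m x) (q x) =
      gg ℓ m m + ip ℓ q q := by
  have h1 : IntegrableOn (fun x => q x * q x) (cube d ℓ) :=
    integrableOn_cube_of_continuous (by fun_prop)
  have h2 : ∀ x, blk (wgrad ℓ m x) (q x) ⬝ᵥ blk (wgrad ℓ m x) (q x) =
      inner ℝ (wgrad ℓ m x) (wgrad ℓ m x) + q x * q x := fun x => by
    rw [blk_dotProduct_self, real_inner_self_eq_norm_sq, sq (q x)]
  simp only [h2]
  exact ⟨(integrable_inner_wgrad m m).add h1, integral_add (integrable_inner_wgrad m m) h1⟩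

lemma le_dissipation (hL : MobilityAssumption lam₁ lam₂ lam₃ L) (h1 : 0 < lam₁)
    (hz : AEStronglyMeasurable z (volume.restrict (cube d ℓ))) {m q : E d → ℝ}
    (hq : Continuous q) :
    lam₁ * (gg ℓ m m + ip ℓ q q) ≤ dissipation ℓ L z m q := by
  have hq2 := memLp_cube_of_continuous (ℓ := ℓ) hq 2
  obtain ⟨hi, he⟩ := integral_blk_sq (ℓ := ℓ) (m := m) hq
  rw [← he, ← integral_const_mul]
  exact integral_mono (hi.const_mul _)
    (integrable_mobForm hL h1 hz (memLp_wgrad ℓ m) hq2 (memLp_wgrad ℓ m) hq2)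
    fun x => hL.lower _ _

lemma neg_mobForm_le (hL : MobilityAssumption lam₁ lam₂ lam₃ L) (h1 : 0 < lam₁) {lam : ℝ}
    (hlam : lam₂ ≤ lam)
    (hz : AEStronglyMeasurable z (volume.restrict (cube d ℓ))) {m q v w : E d → ℝ}
    (hq : Continuous q) (hw : Continuous w) {s : ℝ} (hs : 0 < s) :
    -mobForm ℓ L z (wgrad ℓ m) q (wgrad ℓ v) w ≤
      s / 2 * dissipation ℓ L z m q + lam / (2 * s) * (gg ℓ v v + ip ℓ w w) := by
  have hq2 := memLp_cube_of_continuous (ℓ := ℓ) hq 2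
  have hw2 := memLp_cube_of_continuous (ℓ := ℓ) hw 2
  obtain ⟨hi, he⟩ := integral_blk_sq (ℓ := ℓ) (m := v) hw
  have hD := integrable_mobForm hL h1 hz (memLp_wgrad ℓ m) hq2 (memLp_wgrad ℓ m) hq2
  rw [← he, dissipation_eq, mobForm, mobForm, ← integral_const_mul, ← integral_const_mul,
    ← integral_add (hD.const_mul _) (hi.const_mul _), ← integral_neg]
  exact integral_mono (integrable_mobForm hL h1 hz (memLp_wgrad ℓ m) hq2 (memLp_wgrad ℓ v) hw2).neg
    ((hD.const_mul _).add (hi.const_mul _)) fun x => hL.neg_form_le h1 hlam _ _ _ hs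

end Mobility

end CHAC
end

noncomputable section

namespace CHAC

open MeasureTheory Filter Topology

/-! ### Integration over a time step -/

section Time

variable {d : ℕ} {ℓ τ : ℝ}

lemma node_succ (τ : ℝ) (n : ℕ) : node τ (n + 1) = node τ n + τ := by
  simp only [node]; push_cast; ring

lemma integral_node (τ : ℝ) (n : ℕ) (g : ℝ → ℝ) :
    ∫ t in (node τ n)..(node τ (n + 1)), g t = ∫ s in (0 : ℝ)..τ, g (node τ n + s) := by
  rw [intervalIntegral.integral_comp_add_left, add_zero, node_succ]

/-- Piecewise constant functions of time are prescribed on open steps only; their values at the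
nodes must not matter. -/
lemma intervalIntegral_congr_Ioo {g g' : ℝ → ℝ} (hτ : 0 ≤ τ)
    (h : ∀ s ∈ Set.Ioo 0 τ, g s = g' s) : ∫ s in (0 : ℝ)..τ, g s = ∫ s in (0 : ℝ)..τ, g' s := by
  rw [intervalIntegral.integral_of_le hτ, intervalIntegral.integral_of_le hτ,
    integral_Ioc_eq_integral_Ioo, integral_Ioc_eq_integral_Ioo]
  exact setIntegral_congr_fun measurableSet_Ioo h

lemma intervalIntegral_eq_mul {g : ℝ → ℝ} {c : ℝ} (hτ : 0 ≤ τ)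
    (h : ∀ s ∈ Set.Ioo 0 τ, g s = c) : ∫ s in (0 : ℝ)..τ, g s = τ * c := by
  rw [intervalIntegral_congr_Ioo hτ h]
  simp

lemma integrable_time_cube {Ψ : ℝ → E d → ℝ} (hΨ : Continuous fun q : ℝ × E d => Ψ q.1 q.2) :
    Integrable (fun q : ℝ × E d => Ψ q.1 q.2)
      ((volume.restrict (Set.Ioc 0 τ)).prod (volume.restrict (cube d ℓ))) := by
  rw [Measure.prod_restrict]
  exact (hΨ.continuousOn.integrableOn_compact (isCompact_Icc.prod
    (isCompact_closedCube d ℓ))).mono_set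
    (Set.prod_mono Set.Ioc_subset_Icc_self (cube_subset_closedCube d ℓ))

lemma intervalIntegrable_integral_cube {Ψ : ℝ → E d → ℝ} (hτ : 0 ≤ τ)
    (hΨ : Continuous fun q : ℝ × E d => Ψ q.1 q.2) :
    IntervalIntegrable (fun s => ∫ x in cube d ℓ, Ψ s x) volume 0 τ := by
  rw [intervalIntegrable_iff_integrableOn_Ioc_of_le hτ]
  exact (integrable_time_cube hΨ).integral_prod_left

/-- The fundamental theorem of calculus at each point, then Fubini. -/
lemma integral_cube_sub_eq {Φ Φ' : ℝ → E d → ℝ} (hτ : 0 ≤ τ)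
    (hΦ : ∀ s, Continuous (Φ s)) (hΦ' : Continuous fun q : ℝ × E d => Φ' q.1 q.2)
    (hd : ∀ s x, HasDerivAt (fun t => Φ t x) (Φ' s x) s) :
    (∫ x in cube d ℓ, Φ τ x) - ∫ x in cube d ℓ, Φ 0 x =
      ∫ s in (0 : ℝ)..τ, ∫ x in cube d ℓ, Φ' s x := by
  rw [← integral_sub (integrableOn_cube_of_continuous (hΦ τ))
    (integrableOn_cube_of_continuous (hΦ 0)), intervalIntegral.integral_of_le hτ,
    integral_integral_swap (integrable_time_cube hΦ')]
  congr 1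
  funext x
  rw [← intervalIntegral.integral_of_le hτ]
  refine (intervalIntegral.integral_eq_sub_of_hasDerivAt (fun s _ => hd s x) ?_).symm
  exact Continuous.intervalIntegrable (hΦ'.comp (by fun_prop : Continuous fun s : ℝ => (s, x))) _ _

end Time

/-! ### A single step of the scheme -/

/-- One time step of the perturbed scheme, on the interval `(0, τ)`: the solution is
`a + s b`, `a₂ + s b₂` with potentials `m`, `q` and residuals `r₁, …, r₄`. -/
structure IsStep {d : ℕ} {ℓ : ℝ} (T : PeriodicMesh d ℓ) (τ γρ γη : ℝ) (L : Mobility d)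
    (f : ℝ → ℝ → ℝ) (z : E d → State d) (a b a₂ b₂ m q r₁ r₂ r₃ r₄ : E d → ℝ) : Prop where
  a_mem : a ∈ T.Vh
  b_mem : b ∈ T.Vh
  a₂_mem : a₂ ∈ T.Vh
  b₂_mem : b₂ ∈ T.Vh
  m_mem : m ∈ T.Vh
  q_mem : q ∈ T.Vh
  r₁_mem : r₁ ∈ T.Vh
  r₂_mem : r₂ ∈ T.Vh
  r₃_mem : r₃ ∈ T.Vh
  r₄_mem : r₄ ∈ T.Vh
  eq₁ : ∀ v ∈ T.Vh, ip ℓ b v + mobForm ℓ L z (wgrad ℓ m) q (wgrad ℓ v) 0 = ip ℓ r₁ v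
  eq₂ : ∀ v ∈ T.Vh, ip ℓ b₂ v + mobForm ℓ L z (wgrad ℓ m) q 0 v = ip ℓ r₂ v
  eq₃ : ∀ w ∈ T.Vh, τ * ip ℓ m w - γρ * (τ * gg ℓ (a + (τ / 2) • b) w) -
    ∫ s in (0 : ℝ)..τ, ip ℓ (fun x => fρ f ((a + s • b) x) ((a₂ + s • b₂) x)) w = τ * ip ℓ r₃ w
  eq₄ : ∀ w ∈ T.Vh, τ * ip ℓ q w - γη * (τ * gg ℓ (a₂ + (τ / 2) • b₂) w) -
    ∫ s in (0 : ℝ)..τ, ip ℓ (fun x => fη f ((a + s • b) x) ((a₂ + s • b₂) x)) w = τ * ip ℓ r₄ w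

/-! ### From the scheme to a single step -/

section Extract

variable {d : ℕ} {ℓ τ : ℝ} {N n : ℕ} {V : Set (E d → ℝ)} {u : ℝ → E d → ℝ}

/-- For an affine function the time average is the midpoint value; this is why the scheme satisfies
exact energy identities. -/
lemma IsP1c.exists_affine (hτ : 0 < τ) (hu : IsP1c τ N V u) (hn : n < N) :
    ∃ a ∈ V, ∃ b ∈ V, (∀ s ∈ Set.Icc 0 τ, u (node τ n + s) = a + s • b) ∧
      (∀ s ∈ Set.Ioo 0 τ, dt u (node τ n + s) = b) ∧ avg τ n u = a + (τ / 2) • b := by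
  obtain ⟨a, ha, b, hb, h⟩ := hu n hn
  have h1 : ∀ s ∈ Set.Icc 0 τ, u (node τ n + s) = a + s • b := by
    intro s hs
    funext x
    rw [h (node τ n + s) ⟨by linarith [hs.1], by rw [node_succ]; linarith [hs.2]⟩ x]
    simp
  refine ⟨a, ha, b, hb, h1, fun s hs => ?_, ?_⟩
  · funext x
    have hev : (fun t => u t x) =ᶠ[𝓝 (node τ n + s)] fun t => a x + (t - node τ n) * b x := by
      have : Set.Icc (node τ n) (node τ (n + 1)) ∈ 𝓝 (node τ n + s) :=
        Icc_mem_nhds (by linarith [hs.1]) (by rw [node_succ]; linarith [hs.2])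
      filter_upwards [this] with t ht using h t ht x
    have hd : HasDerivAt (fun t => a x + (t - node τ n) * b x) (b x) (node τ n + s) := by
      simpa using (((hasDerivAt_id (node τ n + s)).sub_const (node τ n)).mul_const (b x)).const_add
        (a x)
    rw [dt, hev.deriv_eq, hd.deriv]
  · funext x
    rw [avg, integral_node, intervalIntegral_congr_Ioo hτ.le
      (g' := fun s => a x + s * b x) fun s hs => by
        rw [h1 s (Set.Ioo_subset_Icc_self hs)]; simp]
    rw [intervalIntegral.integral_add (by simp) (Continuous.intervalIntegrable (by fun_prop) _ _)]
    simp only [intervalIntegral.integral_const, intervalIntegral.integral_mul_const, integral_id,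
      smul_eq_mul, Pi.add_apply, Pi.smul_apply]
    field_simp
    ring

lemma IsP0.exists_const (hu : IsP0 τ N V u) (hn : n < N) :
    ∃ a ∈ V, ∀ s ∈ Set.Ioo 0 τ, u (node τ n + s) = a := by
  obtain ⟨a, ha, h⟩ := hu n hn
  exact ⟨a, ha, fun s hs => h _ ⟨by linarith [hs.1], by rw [node_succ]; linarith [hs.2]⟩⟩

lemma aestronglyMeasurable_stateBar {T : PeriodicMesh d ℓ} (hℓ : 0 < ℓ) (hτ : 0 < τ)
    {ρ η : ℝ → E d → ℝ} (hρ : IsP1c τ N T.Vh ρ) (hη : IsP1c τ N T.Vh η) (hn : n < N) :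
    AEStronglyMeasurable (stateBar ℓ τ n ρ η) (volume.restrict (cube d ℓ)) := by
  have hc : ∀ {u}, IsP1c τ N T.Vh u → Continuous (avg τ n u) := by
    intro u hu
    obtain ⟨a, ha, b, hb, _, _, h⟩ := hu.exists_affine hτ hn
    rw [h]
    exact (T.lipPer_of_mem_Vh hℓ ha).continuous.add
      ((T.lipPer_of_mem_Vh hℓ hb).continuous.const_smul _)
  exact (hc hρ).aestronglyMeasurable.prodMk ((hc hη).aestronglyMeasurable.prodMk
    ((memLp_wgrad ℓ _).1.prodMk (memLp_wgrad ℓ _).1))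

/-- Everything constant in time leaves the integral with a factor `τ`, which is cancelled in the
first two equations. In the last two the nonlinear force still depends on time, so the factor stays.
-/
lemma exists_isStep {T : PeriodicMesh d ℓ} (hτ : 0 < τ) (hn : n < N) {γρ γη lam₁ lam₂ lam₃ : ℝ}
    {L : Mobility d} (hL : MobilityAssumption lam₁ lam₂ lam₃ L) {f : ℝ → ℝ → ℝ}
    {z : E d → State d} {ρ η μρ μη r₁ r₂ r₃ r₄ : ℝ → E d → ℝ}
    (hρ : IsP1c τ N T.Vh ρ) (hη : IsP1c τ N T.Vh η)
    (hμρ : IsP0 τ N T.Vh μρ) (hμη : IsP0 τ N T.Vh μη)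
    (hr₁ : IsP0 τ N T.Vh r₁) (hr₂ : IsP0 τ N T.Vh r₂)
    (hr₃ : IsP0 τ N T.Vh r₃) (hr₄ : IsP0 τ N T.Vh r₄)
    (h₁ : ∀ v ∈ T.Vh, form₁ ℓ τ n L z ρ μρ μη v =
      ∫ t in (node τ n)..(node τ (n + 1)), ip ℓ (r₁ t) v)
    (h₂ : ∀ v ∈ T.Vh, form₂ ℓ τ n L z η μρ μη v =
      ∫ t in (node τ n)..(node τ (n + 1)), ip ℓ (r₂ t) v)
    (h₃ : ∀ v ∈ T.Vh, form₃ ℓ τ n γρ (fρ f) ρ ρ η μρ v =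
      ∫ t in (node τ n)..(node τ (n + 1)), ip ℓ (r₃ t) v)
    (h₄ : ∀ v ∈ T.Vh, form₃ ℓ τ n γη (fη f) η ρ η μη v =
      ∫ t in (node τ n)..(node τ (n + 1)), ip ℓ (r₄ t) v) :
    ∃ a b a₂ b₂ m q s₁ s₂ s₃ s₄ : E d → ℝ,
      IsStep T τ γρ γη L f z a b a₂ b₂ m q s₁ s₂ s₃ s₄ ∧
      (∀ s ∈ Set.Icc 0 τ, ρ (node τ n + s) = a + s • b ∧ η (node τ n + s) = a₂ + s • b₂) ∧
      (∀ s ∈ Set.Ioo 0 τ, dt ρ (node τ n + s) = b ∧ dt η (node τ n + s) = b₂ ∧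
        μρ (node τ n + s) = m ∧ μη (node τ n + s) = q ∧ r₁ (node τ n + s) = s₁ ∧
        r₂ (node τ n + s) = s₂ ∧ r₃ (node τ n + s) = s₃ ∧ r₄ (node τ n + s) = s₄) := by
  obtain ⟨a, ha, b, hb, hρe, hρd, hρa⟩ := hρ.exists_affine hτ hn
  obtain ⟨a₂, ha₂, b₂, hb₂, hηe, hηd, hηa⟩ := hη.exists_affine hτ hn
  obtain ⟨m, hm, hme⟩ := hμρ.exists_const hn
  obtain ⟨q, hq, hqe⟩ := hμη.exists_const hn
  obtain ⟨s₁, hs₁, hs₁e⟩ := hr₁.exists_const hn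
  obtain ⟨s₂, hs₂, hs₂e⟩ := hr₂.exists_const hn
  obtain ⟨s₃, hs₃, hs₃e⟩ := hr₃.exists_const hn
  obtain ⟨s₄, hs₄, hs₄e⟩ := hr₄.exists_const hn
  have hτ0 : τ ≠ 0 := hτ.ne'
  have hconst : ∀ {u : ℝ → E d → ℝ} {c : E d → ℝ} (F : (E d → ℝ) → ℝ),
      (∀ s ∈ Set.Ioo 0 τ, u (node τ n + s) = c) →
      ∫ t in (node τ n)..(node τ (n + 1)), F (u t) = τ * F c := by
    intro u c F hu
    rw [integral_node]
    exact intervalIntegral_eq_mul hτ.le fun s hs => by rw [hu s hs]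
  refine ⟨a, b, a₂, b₂, m, q, s₁, s₂, s₃, s₄, ⟨ha, hb, ha₂, hb₂, hm, hq, hs₁, hs₂, hs₃, hs₄,
    fun v hv => ?_, fun v hv => ?_, fun w hw => ?_, fun w hw => ?_⟩,
    fun s hs => ⟨hρe s hs, hηe s hs⟩, fun s hs => ⟨hρd s hs, hηd s hs, hme s hs, hqe s hs,
      hs₁e s hs, hs₂e s hs, hs₃e s hs, hs₄e s hs⟩⟩
  · have h := h₁ v hv
    rw [form₁, hconst (u := dt ρ) (fun u => ip ℓ u v) hρd, hconst (fun u => ip ℓ u v) hs₁e,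
      integral_node, intervalIntegral_eq_mul (c := mobForm ℓ L z (wgrad ℓ m) q (wgrad ℓ v) 0)
        hτ.le fun s hs => by rw [hme s hs, hqe s hs]; exact ipv_flux L z _ _ _] at h
    refine mul_left_cancel₀ hτ0 ?_
    linarith
  · have h := h₂ v hv
    rw [form₂, hconst (u := dt η) (fun u => ip ℓ u v) hηd, hconst (fun u => ip ℓ u v) hs₂e,
      integral_node, intervalIntegral_eq_mul (c := mobForm ℓ L z (wgrad ℓ m) q 0 v)
        hτ.le fun s hs => by rw [hme s hs, hqe s hs]; exact ip_source hL z _ _ _] at h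
    refine mul_left_cancel₀ hτ0 ?_
    linarith
  · have h := h₃ w hw
    rw [form₃, hconst (fun u => ip ℓ u w) hme, hconst (fun u => ip ℓ u w) hs₃e, hρa,
      integral_node τ n (fun _ => _), intervalIntegral_eq_mul
        (c := ipv ℓ (wgrad ℓ (a + (τ / 2) • b)) (wgrad ℓ w)) hτ.le
        fun s _ => rfl, integral_node] at h
    rw [← h]
    congr 1
    refine intervalIntegral_congr_Ioo hτ.le fun s hs => ?_
    rw [hρe s (Set.Ioo_subset_Icc_self hs), hηe s (Set.Ioo_subset_Icc_self hs)]
  · have h := h₄ w hw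
    rw [form₃, hconst (fun u => ip ℓ u w) hqe, hconst (fun u => ip ℓ u w) hs₄e, hηa,
      integral_node τ n (fun _ => _), intervalIntegral_eq_mul
        (c := ipv ℓ (wgrad ℓ (a₂ + (τ / 2) • b₂)) (wgrad ℓ w))
        hτ.le fun s _ => rfl, integral_node] at h
    rw [← h]
    congr 1
    refine intervalIntegral_congr_Ioo hτ.le fun s hs => ?_
    rw [hρe s (Set.Ioo_subset_Icc_self hs), hηe s (Set.Ioo_subset_Icc_self hs)]

end Extract

end CHAC
end

noncomputable section

namespace CHAC

open MeasureTheory Filter Topology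

/-! ### Nonlinear estimates -/

section Nonlinear

variable {d : ℕ} {ℓ c₁ c₂ α κ : ℝ} {f : ℝ → ℝ → ℝ}

/-- The second order Taylor remainder of the first partial derivative. -/
def taylorρ (f : ℝ → ℝ → ℝ) (a b a' b' : ℝ) : ℝ :=
  fρ f a b - fρ f a' b' - (pa (pa (unc f)) (a', b') * (a - a') + pa (pb (unc f)) (a', b') * (b - b'))

/-- The second order Taylor remainder of the second partial derivative. -/
def taylorη (f : ℝ → ℝ → ℝ) (a b a' b' : ℝ) : ℝ :=
  fη f a b - fη f a' b' - (pa (pb (unc f)) (a', b') * (a - a') + pb (pb (unc f)) (a', b') * (b - b'))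

namespace PotentialAssumption

lemma continuous_f (hf : PotentialAssumption c₁ c₂ α κ f) {X : Type*} [TopologicalSpace X]
    {u v : X → ℝ} (hu : Continuous u) (hv : Continuous v) :
    Continuous fun x => f (u x) (v x) :=
  hf.smooth.continuous.comp (hu.prodMk hv)

lemma continuous_fρ (hf : PotentialAssumption c₁ c₂ α κ f) {X : Type*} [TopologicalSpace X]
    {u v : X → ℝ} (hu : Continuous u) (hv : Continuous v) :
    Continuous fun x => fρ f (u x) (v x) := by
  simp only [hf.fρ_eq]
  exact (contDiff_pa hf.smooth).continuous.comp (hu.prodMk hv)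

lemma continuous_fη (hf : PotentialAssumption c₁ c₂ α κ f) {X : Type*} [TopologicalSpace X]
    {u v : X → ℝ} (hu : Continuous u) (hv : Continuous v) :
    Continuous fun x => fη f (u x) (v x) := by
  simp only [hf.fη_eq]
  exact (contDiff_pb hf.smooth).continuous.comp (hu.prodMk hv)

lemma continuous_taylorρ (hf : PotentialAssumption c₁ c₂ α κ f) {X : Type*} [TopologicalSpace X]
    {u v u' v' : X → ℝ} (hu : Continuous u) (hv : Continuous v) (hu' : Continuous u')
    (hv' : Continuous v') : Continuous fun x => taylorρ f (u x) (v x) (u' x) (v' x) :=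
  ((hf.continuous_fρ hu hv).sub (hf.continuous_fρ hu' hv')).sub
    ((((contDiff_pa (contDiff_pa hf.smooth)).continuous.comp (hu'.prodMk hv')).mul
      (hu.sub hu')).add (((contDiff_pa (contDiff_pb hf.smooth)).continuous.comp
      (hu'.prodMk hv')).mul (hv.sub hv')))

lemma continuous_taylorη (hf : PotentialAssumption c₁ c₂ α κ f) {X : Type*} [TopologicalSpace X]
    {u v u' v' : X → ℝ} (hu : Continuous u) (hv : Continuous v) (hu' : Continuous u')
    (hv' : Continuous v') : Continuous fun x => taylorη f (u x) (v x) (u' x) (v' x) :=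
  ((hf.continuous_fη hu hv).sub (hf.continuous_fη hu' hv')).sub
    ((((contDiff_pa (contDiff_pb hf.smooth)).continuous.comp (hu'.prodMk hv')).mul
      (hu.sub hu')).add (((contDiff_pb (contDiff_pb hf.smooth)).continuous.comp
      (hu'.prodMk hv')).mul (hv.sub hv')))

end PotentialAssumption

/-- Hölder's inequality with exponents `6`, `3`, `2`, obtained from the pointwise Young inequality
after scaling `y` by `K`. The scaling makes the bound linear in `K`, the size of `y` in `L³`. -/
lemma trilinear_le {b w y : E d → ℝ} (hb : Continuous b) (hw : Continuous w) (hy : Continuous y)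
    {K W B Y : ℝ} (hK : 0 < K) (hy0 : ∀ x, 0 ≤ y x) (hW : ∫ x in cube d ℓ, w x ^ 6 ≤ W)
    (hB : ip ℓ b b ≤ B) (hY : ∫ x in cube d ℓ, y x ^ 3 ≤ Y * K ^ 3) :
    ∫ x in cube d ℓ, w x * y x * |b x| ≤ K * (B / 2 + W / 6 + Y / 3) := by
  have hpt : ∀ x, w x * y x * |b x| ≤
      K * (b x * b x / 2 + w x ^ 6 / 6 + (y x ^ 3) / (3 * K ^ 3)) := by
    intro x
    obtain ⟨t, ht⟩ : ∃ t, t = y x / K := ⟨_, rfl⟩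
    have hyt : y x = K * t := by rw [ht]; field_simp
    have ht0 : 0 ≤ t := by rw [ht]; exact div_nonneg (hy0 x) hK.le
    have h1 : (y x ^ 3) / (3 * K ^ 3) = t ^ 3 / 3 := by rw [hyt]; field_simp
    rw [h1, hyt, ← abs_mul_abs_self (b x)]
    have h2 : w x * t * |b x| ≤ |b x| * |b x| / 2 + (w x * t) ^ 2 / 2 := by
      nlinarith [sq_nonneg (w x * t - |b x|)]
    have h3 : (w x * t) ^ 2 ≤ w x ^ 6 / 3 + 2 * t ^ 3 / 3 := by
      obtain ⟨p, hp⟩ : ∃ p, p = w x ^ 2 := ⟨_, rfl⟩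
      have hp0 : 0 ≤ p := by rw [hp]; positivity
      have h4 : w x ^ 6 = p ^ 3 := by rw [hp]; ring
      rw [mul_pow, h4, ← hp]
      -- The identity `(p + 2t)(p - t)² = p³ - 3 p t² + 2 t³` is Young's inequality for `p t²`.
      nlinarith [mul_nonneg (add_nonneg hp0 (mul_nonneg two_pos.le ht0)) (sq_nonneg (p - t))]
    have h5 : w x * t * |b x| ≤ |b x| * |b x| / 2 + w x ^ 6 / 6 + t ^ 3 / 3 := by linarith
    calc w x * (K * t) * |b x| = K * (w x * t * |b x|) := by ring
      _ ≤ _ := mul_le_mul_of_nonneg_left h5 hK.le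
  have hbb : IntegrableOn (fun x => b x * b x / 2) (cube d ℓ) :=
    integrableOn_cube_of_continuous (by fun_prop)
  have hww : IntegrableOn (fun x => w x ^ 6 / 6) (cube d ℓ) :=
    integrableOn_cube_of_continuous (by fun_prop)
  have hyy : IntegrableOn (fun x => (y x ^ 3) / (3 * K ^ 3)) (cube d ℓ) :=
    integrableOn_cube_of_continuous (by fun_prop)
  have hbw : IntegrableOn (fun x => b x * b x / 2 + w x ^ 6 / 6) (cube d ℓ) := hbb.add hww
  refine (integral_mono (integrableOn_cube_of_continuous (by fun_prop))
    ((hbw.add hyy).const_mul K) hpt).trans ?_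
  rw [integral_const_mul]
  refine mul_le_mul_of_nonneg_left ?_ hK.le
  have := integral_add hbw hyy
  refine this.le.trans ?_
  rw [integral_add hbb hww, integral_div, integral_div, integral_div]
  refine add_le_add (add_le_add ?_ ?_) ?_
  · exact div_le_div_of_nonneg_right hB two_pos.le
  · exact div_le_div_of_nonneg_right hW (by norm_num)
  · rw [div_le_iff₀ (by positivity)]
    calc _ ≤ Y * K ^ 3 := hY
      _ = _ := by ring

lemma sum_pow_six_le {a b c e : ℝ} (ha : 0 ≤ a) (hb : 0 ≤ b) (hc : 0 ≤ c) (he : 0 ≤ e) :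
    (1 + a + b + c + e) ^ 6 ≤ 32 ^ 4 * (1 + a ^ 6 + b ^ 6 + c ^ 6 + e ^ 6) := by
  have h : ∀ x y : ℝ, 0 ≤ x → 0 ≤ y → (x + y) ^ 6 ≤ 32 * (x ^ 6 + y ^ 6) := fun x y hx hy => by
    have := add_pow_le hx hy 6
    norm_num at this
    exact this
  have h1 := h (1 + a + b + c) e (by positivity) he
  have h2 := h (1 + a + b) c (by positivity) hc
  have h3 := h (1 + a) b (by positivity) hb
  have h4 := h 1 a (by positivity) ha
  have := pow_nonneg ha 6
  have := pow_nonneg hb 6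
  have := pow_nonneg hc 6
  have := pow_nonneg he 6
  linarith

lemma add_sq_pow_three_le (x y : ℝ) : (x ^ 2 + y ^ 2) ^ 3 ≤ 4 * (x ^ 6 + y ^ 6) := by
  have h := add_pow_le (sq_nonneg x) (sq_nonneg y) 3
  norm_num [← pow_mul] at h
  exact h

variable {u v u' v' b b₂ : E d → ℝ}

lemma integral_weight_le (hu : Continuous u) (hv : Continuous v) (hu' : Continuous u')
    (hv' : Continuous v') {W : ℝ} (h1 : ∫ x in cube d ℓ, u x ^ 6 ≤ W)
    (h2 : ∫ x in cube d ℓ, v x ^ 6 ≤ W) (h3 : ∫ x in cube d ℓ, u' x ^ 6 ≤ W)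
    (h4 : ∫ x in cube d ℓ, v' x ^ 6 ≤ W) :
    ∫ x in cube d ℓ, (1 + |u x| + |v x| + |u' x| + |v' x|) ^ 6 ≤
      32 ^ 4 * (volume.real (cube d ℓ) + 4 * W) := by
  have hi : ∀ {u : E d → ℝ}, Continuous u → IntegrableOn (fun x => u x ^ 6) (cube d ℓ) :=
    fun hu => integrableOn_cube_of_continuous (by fun_prop)
  have i1 : IntegrableOn (fun x => 1 + u x ^ 6) (cube d ℓ) :=
    integrableOn_cube_of_continuous (by fun_prop)
  have i2 : IntegrableOn (fun x => 1 + u x ^ 6 + v x ^ 6) (cube d ℓ) :=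
    integrableOn_cube_of_continuous (by fun_prop)
  have i3 : IntegrableOn (fun x => 1 + u x ^ 6 + v x ^ 6 + u' x ^ 6) (cube d ℓ) :=
    integrableOn_cube_of_continuous (by fun_prop)
  calc ∫ x in cube d ℓ, (1 + |u x| + |v x| + |u' x| + |v' x|) ^ 6
      ≤ ∫ x in cube d ℓ, 32 ^ 4 * (1 + u x ^ 6 + v x ^ 6 + u' x ^ 6 + v' x ^ 6) := by
        refine integral_mono (integrableOn_cube_of_continuous (by fun_prop))
          (integrableOn_cube_of_continuous (by fun_prop)) fun x => ?_
        have := sum_pow_six_le (abs_nonneg (u x)) (abs_nonneg (v x)) (abs_nonneg (u' x))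
          (abs_nonneg (v' x))
        simpa only [Even.pow_abs (show Even 6 by decide)] using this
    _ = 32 ^ 4 * (volume.real (cube d ℓ) + (∫ x in cube d ℓ, u x ^ 6) +
          (∫ x in cube d ℓ, v x ^ 6) + (∫ x in cube d ℓ, u' x ^ 6) +
          ∫ x in cube d ℓ, v' x ^ 6) := by
        rw [integral_const_mul, integral_add i3 (hi hv'), integral_add i2 (hi hu'),
          integral_add i1 (hi hv), integral_add (integrable_const _) (hi hu), setIntegral_const,
          smul_eq_mul, mul_one]
    _ ≤ _ := by
        refine mul_le_mul_of_nonneg_left ?_ (by norm_num)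
        linarith

/-- Third derivatives of the quartic-growth potential grow linearly, so the remainder is at most a
weight in `L⁶` times the squared error, which lies in `L³` with norm bounded by the squared `H¹`
distance. The remaining factor `b` needs only an `L²` bound, as is available for the velocity. -/
lemma exists_taylor_integral_le (hd : d = 2 ∨ d = 3) (hℓ : 0 < ℓ) (c₁ c₂ M : ℝ) (hM : 0 ≤ M) :
    ∃ C : ℝ, 0 ≤ C ∧ ∀ (α κ : ℝ) (f : ℝ → ℝ → ℝ), PotentialAssumption c₁ c₂ α κ f →
      ∀ u v u' v' b b₂ : E d → ℝ, LipPer ℓ u → LipPer ℓ v → LipPer ℓ u' → LipPer ℓ v' →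
        Continuous b → Continuous b₂ →
        H1sq ℓ u ≤ M → H1sq ℓ v ≤ M → H1sq ℓ u' ≤ M → H1sq ℓ v' ≤ M →
        ip ℓ b b ≤ M → ip ℓ b₂ b₂ ≤ M →
        ∫ x in cube d ℓ, (taylorρ f (u x) (v x) (u' x) (v' x) * b x +
          taylorη f (u x) (v x) (u' x) (v' x) * b₂ x) ≤
          C * (H1sq ℓ (u - u') + H1sq ℓ (v - v')) := by
  obtain ⟨S, hS, hsob⟩ := exists_sobolev hd hℓ
  set W : ℝ := 32 ^ 4 * (volume.real (cube d ℓ) + 4 * (S * M ^ 3)) with hW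
  have hW0 : 0 ≤ W := by positivity
  set c : ℝ := |c₁| + |c₂| with hc
  set A : ℝ := 4 * c * (M / 2 + W / 6 + 8 / 3) with hA
  have hA0 : 0 ≤ A := by positivity
  refine ⟨A * (S + 1), by positivity, ?_⟩
  intro α κ f hf u v u' v' b b₂ hu hv hu' hv' hb hb₂ h1 h2 h3 h4 hb1 hb2
  have huc := hu.continuous
  have hvc := hv.continuous
  have huc' := hu'.continuous
  have hvc' := hv'.continuous
  have hsob' : ∀ w : E d → ℝ, LipPer ℓ w → H1sq ℓ w ≤ M → ∫ x in cube d ℓ, w x ^ 6 ≤ S * M ^ 3 :=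
    fun w hw hwM => (hsob w hw).trans
      (mul_le_mul_of_nonneg_left (pow_le_pow_left₀ (H1sq_nonneg w) hwM 3) hS.le)
  have hw := integral_weight_le huc hvc huc' hvc' (hsob' u hu h1) (hsob' v hv h2)
    (hsob' u' hu' h3) (hsob' v' hv' h4)
  set e := u - u' with he
  set g := v - v' with hg
  have hel : LipPer ℓ e := hu.sub hu'
  have hgl : LipPer ℓ g := hv.sub hv'
  set X := H1sq ℓ e + H1sq ℓ g with hX
  have hX0 : 0 ≤ X := add_nonneg (H1sq_nonneg _) (H1sq_nonneg _)
  -- The trilinear estimate divides by its scale `K`, while the distance `X` may vanish. Hence the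
  -- bound is shown for every larger `K`, and then `K` decreases to the limit.
  suffices hK : ∀ K > (S + 1) * X, ∫ x in cube d ℓ, (taylorρ f (u x) (v x) (u' x) (v' x) * b x +
      taylorη f (u x) (v x) (u' x) (v' x) * b₂ x) ≤ A * K by
    have : ∀ᶠ K in 𝓝[>] ((S + 1) * X), ∫ x in cube d ℓ,
        (taylorρ f (u x) (v x) (u' x) (v' x) * b x +
        taylorη f (u x) (v x) (u' x) (v' x) * b₂ x) ≤ A * K :=
      eventually_nhdsWithin_of_forall hK
    have hlim : Tendsto (fun K => A * K) (𝓝[>] ((S + 1) * X)) (𝓝 (A * ((S + 1) * X))) :=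
      ((continuous_const.mul continuous_id).tendsto _).mono_left nhdsWithin_le_nhds
    rw [mul_assoc]
    exact ge_of_tendsto hlim this
  intro K hKX
  have hK0 : 0 < K := lt_of_le_of_lt (by positivity) hKX
  set wt : E d → ℝ := fun x => 1 + |u x| + |v x| + |u' x| + |v' x| with hwt
  set y : E d → ℝ := fun x => (u x - u' x) ^ 2 + (v x - v' x) ^ 2 with hy
  have hwc : Continuous wt := by fun_prop
  have hyc : Continuous y := by fun_prop
  have h6 : ∀ w : E d → ℝ, LipPer ℓ w → H1sq ℓ w ≤ X → ∫ x in cube d ℓ, w x ^ 6 ≤ K ^ 3 := by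
    intro w hw hwX
    refine (hsob w hw).trans ?_
    calc S * H1sq ℓ w ^ 3 ≤ (S + 1) ^ 3 * X ^ 3 := by
          refine mul_le_mul ?_ (pow_le_pow_left₀ (H1sq_nonneg w) hwX 3)
            (pow_nonneg (H1sq_nonneg w) 3) (by positivity)
          nlinarith [pow_pos hS 2, pow_pos hS 3]
      _ = ((S + 1) * X) ^ 3 := by ring
      _ ≤ K ^ 3 := pow_le_pow_left₀ (by positivity) hKX.le 3
  have hY : ∫ x in cube d ℓ, y x ^ 3 ≤ 8 * K ^ 3 := by
    have he6 := h6 e hel (le_add_of_nonneg_right (H1sq_nonneg _))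
    have hg6 := h6 g hgl (le_add_of_nonneg_left (H1sq_nonneg _))
    calc ∫ x in cube d ℓ, y x ^ 3 ≤ ∫ x in cube d ℓ, 4 * (e x ^ 6 + g x ^ 6) := by
          have hec := hel.continuous
          have hgc := hgl.continuous
          exact integral_mono (integrableOn_cube_of_continuous (by fun_prop))
            (integrableOn_cube_of_continuous (by fun_prop))
            fun x => add_sq_pow_three_le (u x - u' x) (v x - v' x)
      _ = 4 * ((∫ x in cube d ℓ, e x ^ 6) + ∫ x in cube d ℓ, g x ^ 6) := by
          rw [integral_const_mul, integral_add]
          · exact integrableOn_cube_of_continuous (hel.continuous.pow 6)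
          · exact integrableOn_cube_of_continuous (hgl.continuous.pow 6)
      _ ≤ _ := by linarith
  have hy0 : ∀ x, 0 ≤ y x := fun x => by positivity
  have t1 := trilinear_le hb hwc hyc hK0 hy0 hw hb1 hY
  have t2 := trilinear_le hb₂ hwc hyc hK0 hy0 hw hb2 hY
  have hi : ∀ {b : E d → ℝ}, Continuous b → IntegrableOn (fun x => wt x * y x * |b x|) (cube d ℓ) :=
    fun hb => integrableOn_cube_of_continuous (by fun_prop)
  calc _ ≤ ∫ x in cube d ℓ, 2 * c * (wt x * y x * |b x| + wt x * y x * |b₂ x|) := by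
        refine integral_mono (integrableOn_cube_of_continuous ?_)
          (integrableOn_cube_of_continuous (by fun_prop)) fun x => ?_
        · exact ((hf.continuous_taylorρ huc hvc huc' hvc').mul hb).add
            ((hf.continuous_taylorη huc hvc huc' hvc').mul hb₂)
        · have r1 := hf.abs_taylor_fρ_le (u x) (v x) (u' x) (v' x)
          have r2 := hf.abs_taylor_fη_le (u x) (v x) (u' x) (v' x)
          have k1 : taylorρ f (u x) (v x) (u' x) (v' x) * b x ≤ 2 * (c * wt x) * y x * |b x| := by
            refine (le_abs_self _).trans ?_
            rw [abs_mul]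
            exact mul_le_mul_of_nonneg_right r1 (abs_nonneg _)
          have k2 : taylorη f (u x) (v x) (u' x) (v' x) * b₂ x ≤
              2 * (c * wt x) * y x * |b₂ x| := by
            refine (le_abs_self _).trans ?_
            rw [abs_mul]
            exact mul_le_mul_of_nonneg_right r2 (abs_nonneg _)
          simp only
          linarith
    _ = 2 * c * ((∫ x in cube d ℓ, wt x * y x * |b x|) + ∫ x in cube d ℓ, wt x * y x * |b₂ x|) := by
        rw [integral_const_mul, integral_add (hi hb) (hi hb₂)]
    _ ≤ 2 * c * (K * (M / 2 + W / 6 + 8 / 3) + K * (M / 2 + W / 6 + 8 / 3)) := by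
        refine mul_le_mul_of_nonneg_left (add_le_add t1 t2) (by positivity)
    _ = A * K := by rw [hA]; ring

/-- A crude cubic bound, chosen so that after squaring the weight is the sixth power already
controlled by the Sobolev inequality. -/
lemma sum_sq_le_pow_three {a b a' b' : ℝ} (ha : 0 ≤ a) (hb : 0 ≤ b) (ha' : 0 ≤ a')
    (hb' : 0 ≤ b') :
    1 + a ^ 2 + b ^ 2 + a' ^ 2 + b' ^ 2 ≤ (1 + a + b + a' + b') ^ 3 := by
  have h1 : 1 ≤ 1 + a + b + a' + b' := by linarith
  refine le_trans ?_ (pow_le_pow_right₀ h1 (by norm_num : 2 ≤ 3))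
  nlinarith [mul_nonneg ha hb, mul_nonneg ha ha', mul_nonneg ha hb', mul_nonneg hb ha',
    mul_nonneg hb hb', mul_nonneg ha' hb']

/-- A linearized Cauchy–Schwarz inequality: after integration, optimizing over the free number `r`
gives the bound on the square of the integral. -/
lemma PotentialAssumption.mul_fρ_sub_le (hf : PotentialAssumption c₁ c₂ α κ f)
    (a b a' b' r : ℝ) :
    r * (fρ f a b - fρ f a' b') ≤
      (|c₁| + |c₂| + 1) * r ^ 2 * (1 + |a| + |b| + |a'| + |b'|) ^ 6 +
        2 * (|c₁| + |c₂| + 1) * ((a - a') ^ 2 + (b - b') ^ 2) := by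
  have h := hf.abs_fρ_sub_le a b a' b'
  have h5 := sum_sq_le_pow_three (abs_nonneg a) (abs_nonneg b) (abs_nonneg a') (abs_nonneg b')
  simp only [sq_abs] at h5
  obtain ⟨y, hy⟩ : ∃ y, y = (1 + |a| + |b| + |a'| + |b'|) ^ 3 := ⟨_, rfl⟩
  obtain ⟨t, ht⟩ : ∃ t, t = |a - a'| + |b - b'| := ⟨_, rfl⟩
  obtain ⟨c, hc⟩ : ∃ c, c = |c₁| + |c₂| + 1 := ⟨_, rfl⟩
  obtain ⟨D, hD⟩ : ∃ D, D = fρ f a b - fρ f a' b' := ⟨_, rfl⟩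
  have hc0 : 0 ≤ c := by rw [hc]; positivity
  have ht0 : 0 ≤ t := by rw [ht]; positivity
  have hy6 : (1 + |a| + |b| + |a'| + |b'|) ^ 6 = y ^ 2 := by rw [hy]; ring
  have hy0 : 0 ≤ y := by rw [hy]; positivity
  have ht2 : t ^ 2 ≤ 2 * ((a - a') ^ 2 + (b - b') ^ 2) := by
    rw [ht, ← sq_abs (a - a'), ← sq_abs (b - b')]
    nlinarith [sq_nonneg (|a - a'| - |b - b'|)]
  rw [← ht, ← hD] at h
  rw [hy6, ← hc, ← hD]
  have h7 : |D| ≤ 2 * c * y * t := by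
    refine h.trans (mul_le_mul_of_nonneg_right ?_ ht0)
    rw [← hy] at h5
    exact mul_le_mul (by linarith) h5 (by positivity) (by linarith)
  have h8 : r * D ≤ |r| * (2 * c * y * t) := by
    refine (le_abs_self _).trans ?_
    rw [abs_mul]
    exact mul_le_mul_of_nonneg_left h7 (abs_nonneg _)
  have h9 : 2 * (|r| * y * t) ≤ r ^ 2 * y ^ 2 + t ^ 2 := by
    rw [← sq_abs r]
    linarith [sq_nonneg (|r| * y - t), sub_sq (|r| * y) t, mul_pow |r| y 2]
  have h11 := mul_le_mul_of_nonneg_left (h9.trans (add_le_add_right ht2 _)) hc0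
  calc r * D ≤ _ := h8
    _ = c * (2 * (|r| * y * t)) := by ring
    _ ≤ _ := h11
    _ = _ := by ring

lemma exists_sq_integral_fρ_sub_le (hd : d = 2 ∨ d = 3) (hℓ : 0 < ℓ) (c₁ c₂ M : ℝ) (hM : 0 ≤ M) :
    ∃ C : ℝ, 0 ≤ C ∧ ∀ (α κ : ℝ) (f : ℝ → ℝ → ℝ), PotentialAssumption c₁ c₂ α κ f →
      ∀ u v u' v' : E d → ℝ, LipPer ℓ u → LipPer ℓ v → LipPer ℓ u' → LipPer ℓ v' →
        H1sq ℓ u ≤ M → H1sq ℓ v ≤ M → H1sq ℓ u' ≤ M → H1sq ℓ v' ≤ M →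
        (∫ x in cube d ℓ, (fρ f (u x) (v x) - fρ f (u' x) (v' x))) ^ 2 ≤
          C * (H1sq ℓ (u - u') + H1sq ℓ (v - v')) := by
  obtain ⟨S, hS, hsob⟩ := exists_sobolev hd hℓ
  set W : ℝ := 32 ^ 4 * (volume.real (cube d ℓ) + 4 * (S * M ^ 3)) with hW
  have hW0 : 0 < W := by
    have := volume_cube_pos (d := d) hℓ
    positivity
  set c : ℝ := |c₁| + |c₂| + 1 with hc
  have hc0 : 0 < c := by positivity
  refine ⟨8 * c ^ 2 * W, by positivity, ?_⟩
  intro α κ f hf u v u' v' hu hv hu' hv' h1 h2 h3 h4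
  have huc := hu.continuous
  have hvc := hv.continuous
  have huc' := hu'.continuous
  have hvc' := hv'.continuous
  have hsob' : ∀ w : E d → ℝ, LipPer ℓ w → H1sq ℓ w ≤ M → ∫ x in cube d ℓ, w x ^ 6 ≤ S * M ^ 3 :=
    fun w hw hwM => (hsob w hw).trans
      (mul_le_mul_of_nonneg_left (pow_le_pow_left₀ (H1sq_nonneg w) hwM 3) hS.le)
  have hw := integral_weight_le huc hvc huc' hvc' (hsob' u hu h1) (hsob' v hv h2)
    (hsob' u' hu' h3) (hsob' v' hv' h4)
  set wt : E d → ℝ := fun x => 1 + |u x| + |v x| + |u' x| + |v' x| with hwt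
  have hwc : Continuous wt := by fun_prop
  set I := ∫ x in cube d ℓ, (fρ f (u x) (v x) - fρ f (u' x) (v' x)) with hI
  set e := u - u' with he
  set g := v - v' with hg
  have hel : LipPer ℓ e := hu.sub hu'
  have hgl : LipPer ℓ g := hv.sub hv'
  have hec := hel.continuous
  have hgc := hgl.continuous
  have key : ∀ r : ℝ, r * I ≤ c * r ^ 2 * W + 2 * c * (ip ℓ e e + ip ℓ g g) := by
    intro r
    have i1 : IntegrableOn (fun x => c * r ^ 2 * wt x ^ 6) (cube d ℓ) :=
      integrableOn_cube_of_continuous (by fun_prop)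
    have i2 : IntegrableOn (fun x => 2 * c * (e x * e x + g x * g x)) (cube d ℓ) :=
      integrableOn_cube_of_continuous (by fun_prop)
    calc r * I = ∫ x in cube d ℓ, r * (fρ f (u x) (v x) - fρ f (u' x) (v' x)) :=
          (integral_const_mul _ _).symm
      _ ≤ ∫ x in cube d ℓ, (c * r ^ 2 * wt x ^ 6 + 2 * c * (e x * e x + g x * g x)) := by
          refine integral_mono (integrableOn_cube_of_continuous ?_) (i1.add i2) fun x => ?_
          · exact continuous_const.mul ((hf.continuous_fρ huc hvc).sub (hf.continuous_fρ huc' hvc'))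
          · have h := hf.mul_fρ_sub_le (u x) (v x) (u' x) (v' x) r
            have e1 : e x * e x = (u x - u' x) ^ 2 := by rw [sq]; rfl
            have e2 : g x * g x = (v x - v' x) ^ 2 := by rw [sq]; rfl
            simp only [e1, e2]
            exact h
      _ = c * r ^ 2 * (∫ x in cube d ℓ, wt x ^ 6) + 2 * c * (ip ℓ e e + ip ℓ g g) := by
          rw [integral_add i1 i2, integral_const_mul, integral_const_mul, integral_add]
          · rfl
          · exact integrableOn_cube_of_continuous (by fun_prop)
          · exact integrableOn_cube_of_continuous (by fun_prop)
      _ ≤ _ := by gcongr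
  -- The maximizer of `r I - c r² W`.
  have h5 := key (I / (2 * c * W))
  have h6 : ip ℓ e e + ip ℓ g g ≤ H1sq ℓ e + H1sq ℓ g :=
    add_le_add (le_add_of_nonneg_right (gg_self_nonneg _))
      (le_add_of_nonneg_right (gg_self_nonneg _))
  have h7 : I / (2 * c * W) * I - c * (I / (2 * c * W)) ^ 2 * W = I ^ 2 / (4 * c * W) := by
    field_simp; ring
  have h8 : I ^ 2 / (4 * c * W) ≤ 2 * c * (H1sq ℓ e + H1sq ℓ g) := by
    have := mul_le_mul_of_nonneg_left h6 (by positivity : 0 ≤ 2 * c)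
    linarith
  rw [div_le_iff₀ (by positivity)] at h8
  calc I ^ 2 ≤ _ := h8
    _ = _ := by ring

end Nonlinear

end CHAC
end

noncomputable section

namespace CHAC

open MeasureTheory Filter Topology

/-! ### Energy identities on one time step -/

section Energy

variable {d : ℕ} {ℓ τ γρ γη c₁ c₂ α κ : ℝ} {f : ℝ → ℝ → ℝ}

/-- The density of the potential part of the relative energy. -/
def relPot (f : ℝ → ℝ → ℝ) (a b a' b' : ℝ) : ℝ :=
  f a b - f a' b' - fρ f a' b' * (a - a') - fη f a' b' * (b - b')

lemma PotentialAssumption.continuous_relPot (hf : PotentialAssumption c₁ c₂ α κ f)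
    {X : Type*} [TopologicalSpace X]
    {u v u' v' : X → ℝ} (hu : Continuous u) (hv : Continuous v) (hu' : Continuous u')
    (hv' : Continuous v') : Continuous fun x => relPot f (u x) (v x) (u' x) (v' x) :=
  (((hf.continuous_f hu hv).sub (hf.continuous_f hu' hv')).sub
    ((hf.continuous_fρ hu' hv').mul (hu.sub hu'))).sub
    ((hf.continuous_fη hu' hv').mul (hv.sub hv'))

/-- The energy. -/
def energy (ℓ γρ γη : ℝ) (f : ℝ → ℝ → ℝ) (u v : E d → ℝ) : ℝ :=
  γρ / 2 * gg ℓ u u + γη / 2 * gg ℓ v v + ∫ x in cube d ℓ, f (u x) (v x)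

lemma relEnergy_eq (hf : PotentialAssumption c₁ c₂ α κ f) {u v u' v' : E d → ℝ}
    (hu : Continuous u) (hv : Continuous v) (hu' : Continuous u') (hv' : Continuous v') :
    relEnergy ℓ γρ γη α f u v u' v' =
      γρ / 2 * gg ℓ (u - u') (u - u') + γη / 2 * gg ℓ (v - v') (v - v') +
      α / 2 * ip ℓ (u - u') (u - u') + α / 2 * ip ℓ (v - v') (v - v') +
      ∫ x in cube d ℓ, relPot f (u x) (v x) (u' x) (v' x) := by
  have i1 : IntegrableOn (fun x => γρ / 2 * inner ℝ (wgrad ℓ (u - u') x) (wgrad ℓ (u - u') x))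
    (cube d ℓ) := (integrable_inner_wgrad _ _).const_mul _
  have i2 : IntegrableOn (fun x => γη / 2 * inner ℝ (wgrad ℓ (v - v') x) (wgrad ℓ (v - v') x))
    (cube d ℓ) := (integrable_inner_wgrad _ _).const_mul _
  have i3 : IntegrableOn (fun x => α / 2 * ((u - u') x * (u - u') x)) (cube d ℓ) :=
    integrableOn_cube_of_continuous (continuous_const.mul ((hu.sub hu').mul (hu.sub hu')))
  have i4 : IntegrableOn (fun x => α / 2 * ((v - v') x * (v - v') x)) (cube d ℓ) :=
    integrableOn_cube_of_continuous (continuous_const.mul ((hv.sub hv').mul (hv.sub hv')))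
  have i5 : IntegrableOn (fun x => relPot f (u x) (v x) (u' x) (v' x)) (cube d ℓ) :=
    integrableOn_cube_of_continuous (hf.continuous_relPot hu hv hu' hv')
  have e5 := integral_add (((i1.add i2).add i3).add i4) i5
  have e4 := integral_add ((i1.add i2).add i3) i4
  have e3 := integral_add (i1.add i2) i3
  have e2 := integral_add i1 i2
  rw [integral_const_mul, integral_const_mul] at e2
  rw [integral_const_mul] at e3 e4
  have e : relEnergy ℓ γρ γη α f u v u' v' = _ := Eq.trans
    (integral_congr_ae (Eventually.of_forall fun x => ?_)) e5
  · rw [e]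
    refine congrArg₂ _ (e4.trans (congrArg₂ _ (e3.trans (congrArg₂ _ e2 rfl)) rfl)) rfl
  · simp only [Pi.add_apply, real_inner_self_eq_norm_sq, relPot, sq_abs, Pi.sub_apply]
    ring

/-- The potential contributes at least `(κ - α)/2` times the squared `L²` distance and the
regularization adds `α/2`, leaving `κ/2`; the gradients are controlled by the capillary terms. -/
lemma le_relEnergy (hf : PotentialAssumption c₁ c₂ α κ f) {u v u' v' : E d → ℝ}
    (hu : Continuous u) (hv : Continuous v) (hu' : Continuous u') (hv' : Continuous v') {c : ℝ}
    (h1 : c ≤ γρ / 2) (h2 : c ≤ γη / 2) (h3 : c ≤ κ / 2) :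
    c * (H1sq ℓ (u - u') + H1sq ℓ (v - v')) ≤ relEnergy ℓ γρ γη α f u v u' v' := by
  rw [relEnergy_eq hf hu hv hu' hv']
  have h : (κ - α) / 2 * (ip ℓ (u - u') (u - u') + ip ℓ (v - v') (v - v')) ≤
      ∫ x in cube d ℓ, relPot f (u x) (v x) (u' x) (v' x) := by
    simp only [ip]
    rw [← integral_add, ← integral_const_mul]
    · refine integral_mono (integrableOn_cube_of_continuous ?_)
        (integrableOn_cube_of_continuous (hf.continuous_relPot hu hv hu' hv')) fun x => ?_
      · exact continuous_const.mul (((hu.sub hu').mul (hu.sub hu')).add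
          ((hv.sub hv').mul (hv.sub hv')))
      · have := hf.relPotential_ge (u x) (v x) (u' x) (v' x)
        simp only [sq] at this
        exact this
    · exact integrableOn_cube_of_continuous ((hu.sub hu').mul (hu.sub hu'))
    · exact integrableOn_cube_of_continuous ((hv.sub hv').mul (hv.sub hv'))
  have g1 := mul_le_mul_of_nonneg_right h1 (gg_self_nonneg (ℓ := ℓ) (u - u'))
  have g2 := mul_le_mul_of_nonneg_right h2 (gg_self_nonneg (ℓ := ℓ) (v - v'))
  have g3 := mul_le_mul_of_nonneg_right h3 (ip_self_nonneg (ℓ := ℓ) (u - u'))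
  have g4 := mul_le_mul_of_nonneg_right h3 (ip_self_nonneg (ℓ := ℓ) (v - v'))
  simp only [H1sq]
  linarith

variable {a b a₂ b₂ a' b' a₂' b₂' : E d → ℝ}

lemma hasDerivAt_line (x y s : ℝ) : HasDerivAt (fun t : ℝ => x + t * y) y s := by
  simpa using ((hasDerivAt_id s).mul_const y).const_add x

/-- A chain rule without remainder: a quadratic form changes along a line by its midpoint value
paired with the velocity, and the potential by the exact time integral of its derivative. These are
the terms occurring in the scheme. -/
lemma energy_sub (hℓ : 0 < ℓ) (hf : PotentialAssumption c₁ c₂ α κ f) (hτ : 0 ≤ τ)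
    (ha : LipPer ℓ a) (hb : LipPer ℓ b) (ha₂ : LipPer ℓ a₂) (hb₂ : LipPer ℓ b₂) :
    energy ℓ γρ γη f (a + τ • b) (a₂ + τ • b₂) - energy ℓ γρ γη f a a₂ =
      γρ * (τ * gg ℓ (a + (τ / 2) • b) b) + γη * (τ * gg ℓ (a₂ + (τ / 2) • b₂) b₂) +
      (∫ s in (0 : ℝ)..τ, ip ℓ (fun x => fρ f ((a + s • b) x) ((a₂ + s • b₂) x)) b) +
      ∫ s in (0 : ℝ)..τ, ip ℓ (fun x => fη f ((a + s • b) x) ((a₂ + s • b₂) x)) b₂ := by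
  have hac := ha.continuous
  have hbc := hb.continuous
  have hac₂ := ha₂.continuous
  have hbc₂ := hb₂.continuous
  have hR : Continuous fun q : ℝ × E d => a q.2 + q.1 * b q.2 := by fun_prop
  have hH : Continuous fun q : ℝ × E d => a₂ q.2 + q.1 * b₂ q.2 := by fun_prop
  have c1 : Continuous fun q : ℝ × E d =>
      fρ f (a q.2 + q.1 * b q.2) (a₂ q.2 + q.1 * b₂ q.2) * b q.2 :=
    (hf.continuous_fρ hR hH).mul (hbc.comp continuous_snd)
  have c2 : Continuous fun q : ℝ × E d =>
      fη f (a q.2 + q.1 * b q.2) (a₂ q.2 + q.1 * b₂ q.2) * b₂ q.2 :=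
    (hf.continuous_fη hR hH).mul (hbc₂.comp continuous_snd)
  have h := integral_cube_sub_eq (ℓ := ℓ) (d := d)
    (Φ := fun s x => f (a x + s * b x) (a₂ x + s * b₂ x))
    (Φ' := fun s x => fρ f (a x + s * b x) (a₂ x + s * b₂ x) * b x +
      fη f (a x + s * b x) (a₂ x + s * b₂ x) * b₂ x) hτ
    (fun s => hf.continuous_f (by fun_prop) (by fun_prop)) (c1.add c2) fun s x => by
      have := hasDerivAt_comp_curve hf.smooth (hasDerivAt_line (a x) (b x) s)
        (hasDerivAt_line (a₂ x) (b₂ x) s)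
      rw [hf.fρ_eq, hf.fη_eq]
      exact this
  have h2 : ∀ s : ℝ, ∫ x in cube d ℓ, (fρ f (a x + s * b x) (a₂ x + s * b₂ x) * b x +
      fη f (a x + s * b x) (a₂ x + s * b₂ x) * b₂ x) =
      ip ℓ (fun x => fρ f ((a + s • b) x) ((a₂ + s • b₂) x)) b +
      ip ℓ (fun x => fη f ((a + s • b) x) ((a₂ + s • b₂) x)) b₂ := by
    intro s
    exact integral_add
      (integrableOn_cube_of_continuous (c1.comp (by fun_prop : Continuous fun x : E d => (s, x))))
      (integrableOn_cube_of_continuous (c2.comp (by fun_prop : Continuous fun x : E d => (s, x))))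
  simp only [h2] at h
  replace h := h.trans (intervalIntegral.integral_add
    (intervalIntegrable_integral_cube (ℓ := ℓ) hτ c1)
    (intervalIntegrable_integral_cube (ℓ := ℓ) hτ c2))
  have h3 : ∫ x in cube d ℓ, f (a x + 0 * b x) (a₂ x + 0 * b₂ x) =
    ∫ x in cube d ℓ, f (a x) (a₂ x) := by simp only [zero_mul, add_zero]
  rw [h3] at h
  have h4 : ∫ x in cube d ℓ, f ((a + τ • b) x) ((a₂ + τ • b₂) x) =
    ∫ x in cube d ℓ, f (a x + τ * b x) (a₂ x + τ * b₂ x) := rfl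
  rw [energy, energy, h4, gg_add_smul_self hℓ ha hb, gg_add_smul_self hℓ ha₂ hb₂,
    gg_add_left hℓ ha (hb.const_smul _), gg_add_left hℓ ha₂ (hb₂.const_smul _),
    gg_smul_left hℓ hb, gg_smul_left hℓ hb₂]
  linarith

/-- The raw derivative contains `(∇f(u) - ∇f(u')) · y` and the Hessian at `u'` applied to `u - u'`
and `y'`. Writing `y = (y - y') + y'` in the first collects all `y'` terms into the Taylor
remainder, quadratic in the error. -/
lemma hasDerivAt_relPot (hf : PotentialAssumption c₁ c₂ α κ f) (x y x₂ y₂ x' y' x₂' y₂' s : ℝ) :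
    HasDerivAt (fun t => relPot f (x + t * y) (x₂ + t * y₂) (x' + t * y') (x₂' + t * y₂'))
      ((fρ f (x + s * y) (x₂ + s * y₂) - fρ f (x' + s * y') (x₂' + s * y₂')) * (y - y') +
       (fη f (x + s * y) (x₂ + s * y₂) - fη f (x' + s * y') (x₂' + s * y₂')) * (y₂ - y₂') +
       (taylorρ f (x + s * y) (x₂ + s * y₂) (x' + s * y') (x₂' + s * y₂') * y' +
        taylorη f (x + s * y) (x₂ + s * y₂) (x' + s * y') (x₂' + s * y₂') * y₂')) s := by
  have l1 := hasDerivAt_line x y s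
  have l2 := hasDerivAt_line x₂ y₂ s
  have l1' := hasDerivAt_line x' y' s
  have l2' := hasDerivAt_line x₂' y₂' s
  have h1 := hasDerivAt_comp_curve hf.smooth l1 l2
  have h2 := hasDerivAt_comp_curve hf.smooth l1' l2'
  have h3 := (hasDerivAt_comp_curve (contDiff_pa hf.smooth) l1' l2').mul (l1.sub l1')
  have h4 := (hasDerivAt_comp_curve (contDiff_pb hf.smooth) l1' l2').mul (l2.sub l2')
  have h := ((h1.sub h2).sub h3).sub h4
  unfold relPot taylorρ taylorη
  simp only [hf.fρ_eq, hf.fη_eq]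
  rw [← pa_pb_comm hf.smooth] at h
  refine h.congr_deriv ?_
  simp only [Pi.sub_apply]
  ring

lemma relEnergy_sub (hℓ : 0 < ℓ) (hf : PotentialAssumption c₁ c₂ α κ f) (hτ : 0 ≤ τ)
    (ha : LipPer ℓ a) (hb : LipPer ℓ b) (ha₂ : LipPer ℓ a₂) (hb₂ : LipPer ℓ b₂)
    (ha' : LipPer ℓ a') (hb' : LipPer ℓ b') (ha₂' : LipPer ℓ a₂') (hb₂' : LipPer ℓ b₂') :
    relEnergy ℓ γρ γη α f (a + τ • b) (a₂ + τ • b₂) (a' + τ • b') (a₂' + τ • b₂') -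
      relEnergy ℓ γρ γη α f a a₂ a' a₂' =
      γρ * (τ * gg ℓ ((a - a') + (τ / 2) • (b - b')) (b - b')) +
      γη * (τ * gg ℓ ((a₂ - a₂') + (τ / 2) • (b₂ - b₂')) (b₂ - b₂')) +
      α * (τ * ip ℓ ((a - a') + (τ / 2) • (b - b')) (b - b')) +
      α * (τ * ip ℓ ((a₂ - a₂') + (τ / 2) • (b₂ - b₂')) (b₂ - b₂')) +
      ((∫ s in (0 : ℝ)..τ, ip ℓ (fun x => fρ f ((a + s • b) x) ((a₂ + s • b₂) x)) (b - b')) -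
        ∫ s in (0 : ℝ)..τ, ip ℓ (fun x => fρ f ((a' + s • b') x) ((a₂' + s • b₂') x)) (b - b')) +
      ((∫ s in (0 : ℝ)..τ, ip ℓ (fun x => fη f ((a + s • b) x) ((a₂ + s • b₂) x)) (b₂ - b₂')) -
        ∫ s in (0 : ℝ)..τ,
          ip ℓ (fun x => fη f ((a' + s • b') x) ((a₂' + s • b₂') x)) (b₂ - b₂')) +
      ∫ s in (0 : ℝ)..τ, ∫ x in cube d ℓ,
        (taylorρ f ((a + s • b) x) ((a₂ + s • b₂) x) ((a' + s • b') x) ((a₂' + s • b₂') x) * b' x +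
         taylorη f ((a + s • b) x) ((a₂ + s • b₂) x) ((a' + s • b') x) ((a₂' + s • b₂') x)
          * b₂' x) := by
  have hac := ha.continuous
  have hbc := hb.continuous
  have hac₂ := ha₂.continuous
  have hbc₂ := hb₂.continuous
  have hac' := ha'.continuous
  have hbc' := hb'.continuous
  have hac₂' := ha₂'.continuous
  have hbc₂' := hb₂'.continuous
  have hR : Continuous fun q : ℝ × E d => (a + q.1 • b) q.2 :=
    (by fun_prop : Continuous fun q : ℝ × E d => a q.2 + q.1 * b q.2)
  have hH : Continuous fun q : ℝ × E d => (a₂ + q.1 • b₂) q.2 :=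
    (by fun_prop : Continuous fun q : ℝ × E d => a₂ q.2 + q.1 * b₂ q.2)
  have hR' : Continuous fun q : ℝ × E d => (a' + q.1 • b') q.2 :=
    (by fun_prop : Continuous fun q : ℝ × E d => a' q.2 + q.1 * b' q.2)
  have hH' : Continuous fun q : ℝ × E d => (a₂' + q.1 • b₂') q.2 :=
    (by fun_prop : Continuous fun q : ℝ × E d => a₂' q.2 + q.1 * b₂' q.2)
  have he : Continuous fun q : ℝ × E d => (b - b') q.2 := (hbc.sub hbc').comp continuous_snd
  have hg : Continuous fun q : ℝ × E d => (b₂ - b₂') q.2 := (hbc₂.sub hbc₂').comp continuous_snd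
  have c1 : Continuous fun q : ℝ × E d =>
      fρ f ((a + q.1 • b) q.2) ((a₂ + q.1 • b₂) q.2) * (b - b') q.2 :=
    (hf.continuous_fρ hR hH).mul he
  have c1' : Continuous fun q : ℝ × E d =>
      fρ f ((a' + q.1 • b') q.2) ((a₂' + q.1 • b₂') q.2) * (b - b') q.2 :=
    (hf.continuous_fρ hR' hH').mul he
  have c2 : Continuous fun q : ℝ × E d =>
      fη f ((a + q.1 • b) q.2) ((a₂ + q.1 • b₂) q.2) * (b₂ - b₂') q.2 :=
    (hf.continuous_fη hR hH).mul hg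
  have c2' : Continuous fun q : ℝ × E d =>
      fη f ((a' + q.1 • b') q.2) ((a₂' + q.1 • b₂') q.2) * (b₂ - b₂') q.2 :=
    (hf.continuous_fη hR' hH').mul hg
  have c3 : Continuous fun q : ℝ × E d =>
      taylorρ f ((a + q.1 • b) q.2) ((a₂ + q.1 • b₂) q.2)
        ((a' + q.1 • b') q.2) ((a₂' + q.1 • b₂') q.2) * b' q.2 +
      taylorη f ((a + q.1 • b) q.2) ((a₂ + q.1 • b₂) q.2)
        ((a' + q.1 • b') q.2) ((a₂' + q.1 • b₂') q.2) * b₂' q.2 :=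
    ((hf.continuous_taylorρ hR hH hR' hH').mul (hbc'.comp continuous_snd)).add
    ((hf.continuous_taylorη hR hH hR' hH').mul (hbc₂'.comp continuous_snd))
  have hsl : ∀ s : ℝ, Continuous fun x : E d => (s, x) := fun s => by fun_prop
  have h := integral_cube_sub_eq (ℓ := ℓ) (d := d)
    (Φ := fun (s : ℝ) (x : E d) => relPot f ((a + s • b) x) ((a₂ + s • b₂) x) ((a' + s • b') x)
      ((a₂' + s • b₂') x))
    (Φ' := fun (s : ℝ) (x : E d) =>
      (fρ f ((a + s • b) x) ((a₂ + s • b₂) x) * (b - b') x -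
        fρ f ((a' + s • b') x) ((a₂' + s • b₂') x) * (b - b') x) +
      (fη f ((a + s • b) x) ((a₂ + s • b₂) x) * (b₂ - b₂') x -
        fη f ((a' + s • b') x) ((a₂' + s • b₂') x) * (b₂ - b₂') x) +
      (taylorρ f ((a + s • b) x) ((a₂ + s • b₂) x) ((a' + s • b') x) ((a₂' + s • b₂') x) * b' x +
       taylorη f ((a + s • b) x) ((a₂ + s • b₂) x) ((a' + s • b') x) ((a₂' + s • b₂') x) * b₂' x))
    hτ (fun s => (hf.continuous_relPot hR hH hR' hH').comp (hsl s))
    (((c1.sub c1').add (c2.sub c2')).add c3) fun s x => by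
      refine (hasDerivAt_relPot hf (a x) (b x) (a₂ x) (b₂ x) (a' x) (b' x) (a₂' x) (b₂' x)
        s).congr_deriv ?_
      simp only [Pi.add_apply, Pi.smul_apply, Pi.sub_apply, smul_eq_mul]
      ring
  have i1 := fun s => integrableOn_cube_of_continuous (ℓ := ℓ) (c1.comp (hsl s))
  have i1' := fun s => integrableOn_cube_of_continuous (ℓ := ℓ) (c1'.comp (hsl s))
  have i2 := fun s => integrableOn_cube_of_continuous (ℓ := ℓ) (c2.comp (hsl s))
  have i2' := fun s => integrableOn_cube_of_continuous (ℓ := ℓ) (c2'.comp (hsl s))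
  have i3 := fun s => integrableOn_cube_of_continuous (ℓ := ℓ) (c3.comp (hsl s))
  have h2 : ∀ s : ℝ, ∫ x in cube d ℓ,
      ((fρ f ((a + s • b) x) ((a₂ + s • b₂) x) * (b - b') x -
        fρ f ((a' + s • b') x) ((a₂' + s • b₂') x) * (b - b') x) +
      (fη f ((a + s • b) x) ((a₂ + s • b₂) x) * (b₂ - b₂') x -
        fη f ((a' + s • b') x) ((a₂' + s • b₂') x) * (b₂ - b₂') x) +
      (taylorρ f ((a + s • b) x) ((a₂ + s • b₂) x) ((a' + s • b') x) ((a₂' + s • b₂') x) * b' x +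
       taylorη f ((a + s • b) x) ((a₂ + s • b₂) x) ((a' + s • b') x) ((a₂' + s • b₂') x)
        * b₂' x)) =
      (ip ℓ (fun x => fρ f ((a + s • b) x) ((a₂ + s • b₂) x)) (b - b') -
        ip ℓ (fun x => fρ f ((a' + s • b') x) ((a₂' + s • b₂') x)) (b - b')) +
      (ip ℓ (fun x => fη f ((a + s • b) x) ((a₂ + s • b₂) x)) (b₂ - b₂') -
        ip ℓ (fun x => fη f ((a' + s • b') x) ((a₂' + s • b₂') x)) (b₂ - b₂')) +
      ∫ x in cube d ℓ,
        (taylorρ f ((a + s • b) x) ((a₂ + s • b₂) x) ((a' + s • b') x) ((a₂' + s • b₂') x) * b' x +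
         taylorη f ((a + s • b) x) ((a₂ + s • b₂) x) ((a' + s • b') x) ((a₂' + s • b₂') x)
          * b₂' x) := by
    intro s
    refine (integral_add (((i1 s).sub (i1' s)).add ((i2 s).sub (i2' s))) (i3 s)).trans ?_
    refine congrArg₂ _ ?_ rfl
    refine (integral_add ((i1 s).sub (i1' s)) ((i2 s).sub (i2' s))).trans ?_
    exact congrArg₂ _ (integral_sub (i1 s) (i1' s)) (integral_sub (i2 s) (i2' s))
  simp only [h2] at h
  have t1 := intervalIntegrable_integral_cube (ℓ := ℓ)
    (Ψ := fun s x => fρ f ((a + s • b) x) ((a₂ + s • b₂) x) * (b - b') x) hτ c1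
  have t1' := intervalIntegrable_integral_cube (ℓ := ℓ)
    (Ψ := fun s x => fρ f ((a' + s • b') x) ((a₂' + s • b₂') x) * (b - b') x) hτ c1'
  have t2 := intervalIntegrable_integral_cube (ℓ := ℓ)
    (Ψ := fun s x => fη f ((a + s • b) x) ((a₂ + s • b₂) x) * (b₂ - b₂') x) hτ c2
  have t2' := intervalIntegrable_integral_cube (ℓ := ℓ)
    (Ψ := fun s x => fη f ((a' + s • b') x) ((a₂' + s • b₂') x) * (b₂ - b₂') x) hτ c2'
  have t3 := intervalIntegrable_integral_cube (ℓ := ℓ)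
    (Ψ := fun s x =>
      taylorρ f ((a + s • b) x) ((a₂ + s • b₂) x) ((a' + s • b') x) ((a₂' + s • b₂') x) * b' x +
      taylorη f ((a + s • b) x) ((a₂ + s • b₂) x) ((a' + s • b') x) ((a₂' + s • b₂') x) * b₂' x) hτ c3
  have h5 := intervalIntegral.integral_add ((t1.sub t1').add (t2.sub t2')) t3
  rw [intervalIntegral.integral_add (t1.sub t1') (t2.sub t2'), intervalIntegral.integral_sub t1 t1',
    intervalIntegral.integral_sub t2 t2'] at h5
  have h6 := h.trans h5
  have h3 : ∫ x in cube d ℓ, relPot f ((a + (0 : ℝ) • b) x) ((a₂ + (0 : ℝ) • b₂) x)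
      ((a' + (0 : ℝ) • b') x) ((a₂' + (0 : ℝ) • b₂') x) =
    ∫ x in cube d ℓ, relPot f (a x) (a₂ x) (a' x) (a₂' x) := by simp only [zero_smul, add_zero]
  rw [h3] at h6
  have hel := ha.sub ha'
  have hel₁ := hb.sub hb'
  have hgl := ha₂.sub ha₂'
  have hgl₁ := hb₂.sub hb₂'
  have hsm : ∀ {a b : E d → ℝ}, Continuous a → Continuous b → Continuous (a + τ • b) :=
    fun ha hb => ha.add (hb.const_smul τ)
  rw [relEnergy_eq hf (hsm hac hbc) (hsm hac₂ hbc₂) (hsm hac' hbc') (hsm hac₂' hbc₂'),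
    relEnergy_eq hf hac hac₂ hac' hac₂',
    show a + τ • b - (a' + τ • b') = (a - a') + τ • (b - b') by module,
    show a₂ + τ • b₂ - (a₂' + τ • b₂') = (a₂ - a₂') + τ • (b₂ - b₂') by module,
    gg_add_smul_self hℓ hel hel₁, gg_add_smul_self hℓ hgl hgl₁,
    ip_add_smul_self hel.continuous hel₁.continuous,
    ip_add_smul_self hgl.continuous hgl₁.continuous,
    gg_add_left hℓ hel (hel₁.const_smul _), gg_add_left hℓ hgl (hgl₁.const_smul _),
    gg_smul_left hℓ hel₁, gg_smul_left hℓ hgl₁,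
    ip_add_left hel.continuous (hel₁.const_smul _).continuous hel₁.continuous,
    ip_add_left hgl.continuous (hgl₁.const_smul _).continuous hgl₁.continuous,
    ip_smul_left, ip_smul_left]
  simp only [ip] at h6 ⊢
  linarith

end Energy

end CHAC
end

noncomputable section

namespace CHAC

open MeasureTheory Filter Topology

/-! ### A priori bounds for the discrete solution -/

section Bounds

variable {d : ℕ} {ℓ τ γρ γη lam₁ lam₂ lam₃ c₁ c₂ α κ : ℝ} {f : ℝ → ℝ → ℝ} {L : Mobility d}
  {Th : PeriodicMesh d ℓ} {z : E d → State d}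

lemma ip_zero_left (v : E d → ℝ) : ip ℓ 0 v = 0 := by simp [ip]

lemma ip_one_right (v : E d → ℝ) : ip ℓ v (fun _ => 1) = ∫ x in cube d ℓ, v x := by simp [ip]

lemma ip_one_one : ip ℓ (fun _ : E d => 1) (fun _ => 1) = volume.real (cube d ℓ) := by simp [ip]

lemma sq_integral_le {u : E d → ℝ} (hu : Continuous u) :
    (∫ x in cube d ℓ, u x) ^ 2 ≤ ip ℓ u u * volume.real (cube d ℓ) := by
  rw [← ip_one_right, ← ip_one_one]
  exact ip_sq_le hu continuous_const

lemma mobForm_const (hℓ : 0 < ℓ) (P : E d → E d) (Q : E d → ℝ) (c : ℝ) :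
    mobForm ℓ L z P Q (wgrad ℓ (fun _ => c)) 0 = 0 := by
  rw [mobForm_congr (P₂' := 0) (Filter.EventuallyEq.refl _ P) (wgrad_const hℓ c)]
  have : blk (0 : E d) 0 = 0 := by
    funext i; rcases i with i | i <;> simp [blk]
  simp [mobForm, this]

lemma normL2_add_smul_le {u v : E d → ℝ} (hu : Continuous u) (hv : Continuous v) {s : ℝ}
    (hs : 0 ≤ s) : normL2 ℓ (u + s • v) ≤ normL2 ℓ u + s * normL2 ℓ v := by
  have h0 : 0 ≤ normL2 ℓ u + s * normL2 ℓ v :=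
    add_nonneg (Real.sqrt_nonneg _) (mul_nonneg hs (Real.sqrt_nonneg _))
  refine Real.sqrt_le_iff.2 ⟨h0, ?_⟩
  rw [ip_add_smul_self hu hv]
  have h := mul_le_mul_of_nonneg_left (ip_le_of_memLp (ℓ := ℓ) (memLp_cube_of_continuous hu 2)
    (memLp_cube_of_continuous hv 2)) hs
  have h1 := normL2_sq (ℓ := ℓ) u
  have h2 := normL2_sq (ℓ := ℓ) v
  nlinarith

lemma normL2_le_normH1 (u : E d → ℝ) : normL2 ℓ u ≤ normH1 ℓ u :=
  Real.sqrt_le_sqrt (le_add_of_nonneg_right (gg_self_nonneg u))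

lemma integral_f_nonneg (hf : PotentialAssumption c₁ c₂ α κ f) (u v : E d → ℝ) :
    0 ≤ ∫ x in cube d ℓ, f (u x) (v x) := integral_nonneg fun _ => hf.nonneg _ _

/-- Quartic growth of the potential is dominated by `1 + y ^ 6`, hence by the Sobolev inequality. -/
lemma exists_energy_le (hd : d = 2 ∨ d = 3) (hℓ : 0 < ℓ) (hγρ : 0 < γρ) (hγη : 0 < γη)
    (c₁ c₂ M : ℝ) (hM : 0 ≤ M) :
    ∃ C : ℝ, 0 ≤ C ∧ ∀ (α κ : ℝ) (f : ℝ → ℝ → ℝ), PotentialAssumption c₁ c₂ α κ f →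
      ∀ u v : E d → ℝ, LipPer ℓ u → LipPer ℓ v → H1sq ℓ u ≤ M → H1sq ℓ v ≤ M →
        energy ℓ γρ γη f u v ≤ C := by
  obtain ⟨S, hS, hsob⟩ := exists_sobolev hd hℓ
  refine ⟨γρ / 2 * M + γη / 2 * M +
    (|c₁| + |c₂|) * (3 * volume.real (cube d ℓ) + 2 * (S * M ^ 3)), by positivity, ?_⟩
  intro α κ f hf u v hu hv hum hvm
  have hc := hu.continuous
  have hc' := hv.continuous
  have h6 : ∀ {w : E d → ℝ}, LipPer ℓ w → H1sq ℓ w ≤ M → ∫ x in cube d ℓ, w x ^ 6 ≤ S * M ^ 3 :=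
    fun hw hwm => (hsob _ hw).trans
      (mul_le_mul_of_nonneg_left (pow_le_pow_left₀ (H1sq_nonneg _) hwm 3) hS.le)
  have h4 : ∀ y : ℝ, y ^ 4 ≤ 1 + y ^ 6 := fun y => by
    nlinarith [sq_nonneg (y ^ 2 - 1), sq_nonneg y, mul_nonneg (sq_nonneg y)
      (sq_nonneg (y ^ 2 - 1))]
  have hpot : ∫ x in cube d ℓ, f (u x) (v x) ≤
      ∫ x in cube d ℓ, (|c₁| + |c₂|) * (3 + (u x ^ 6 + v x ^ 6)) := by
    refine integral_mono (integrableOn_cube_of_continuous (hf.continuous_f hc hc'))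
      (integrableOn_cube_of_continuous (by fun_prop)) fun x => ?_
    refine (hf.le_growth _ _).trans (mul_le_mul_of_nonneg_left ?_ (by positivity))
    linarith [h4 (u x), h4 (v x)]
  rw [integral_const_mul, integral_add (integrable_const _)
    (integrableOn_cube_of_continuous (by fun_prop)),
    integral_add (integrableOn_cube_of_continuous (by fun_prop))
    (integrableOn_cube_of_continuous (by fun_prop))] at hpot
  simp only [integral_const, smul_eq_mul, measureReal_restrict_apply_univ] at hpot
  have hb := mul_le_mul_of_nonneg_left (add_le_add (h6 hu hum) (h6 hv hvm))
    (by positivity : 0 ≤ |c₁| + |c₂|)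
  have hgu : gg ℓ u u ≤ M := (le_add_of_nonneg_left (ip_self_nonneg u)).trans hum
  have hgv : gg ℓ v v ≤ M := (le_add_of_nonneg_left (ip_self_nonneg v)).trans hvm
  have e1 := mul_le_mul_of_nonneg_left hgu (by positivity : 0 ≤ γρ / 2)
  have e2 := mul_le_mul_of_nonneg_left hgv (by positivity : 0 ≤ γη / 2)
  rw [energy]
  linarith

/-! ### Energy law, mass and velocity on one unperturbed step -/

namespace IsStep

variable {a b a₂ b₂ m q r₁ r₂ r₃ r₄ : E d → ℝ}

/-- Test the evolution equations with the potentials `m`, `q` and the potential equations with the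
velocities `b`, `b₂`; the pairings of both cancel. -/
lemma energy_add_dissipation (hs : IsStep Th τ γρ γη L f z a b a₂ b₂ m q 0 0 0 0) (hℓ : 0 < ℓ)
    (hτ : 0 ≤ τ) (hf : PotentialAssumption c₁ c₂ α κ f)
    (hL : MobilityAssumption lam₁ lam₂ lam₃ L) (h1 : 0 < lam₁)
    (hz : AEStronglyMeasurable z (volume.restrict (cube d ℓ))) :
    energy ℓ γρ γη f (a + τ • b) (a₂ + τ • b₂) + τ * dissipation ℓ L z m q =
      energy ℓ γρ γη f a a₂ := by
  have e := energy_sub (γρ := γρ) (γη := γη) hℓ hf hτ (Th.lipPer_of_mem_Vh hℓ hs.a_mem)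
    (Th.lipPer_of_mem_Vh hℓ hs.b_mem) (Th.lipPer_of_mem_Vh hℓ hs.a₂_mem)
    (Th.lipPer_of_mem_Vh hℓ hs.b₂_mem)
  have e1 := hs.eq₁ m hs.m_mem
  have e2 := hs.eq₂ q hs.q_mem
  have e3 := hs.eq₃ b hs.b_mem
  have e4 := hs.eq₄ b₂ hs.b₂_mem
  have hq2 := memLp_cube_of_continuous (ℓ := ℓ) (Th.lipPer_of_mem_Vh hℓ hs.q_mem).continuous 2
  have hD := mobForm_add_right hL h1 hz (memLp_wgrad ℓ m) hq2 (memLp_wgrad ℓ m) hq2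
  rw [ip_zero_left] at e1 e2 e3 e4
  rw [dissipation_eq, ← hD]
  rw [ip_comm m b] at e3
  rw [ip_comm q b₂] at e4
  linear_combination e - e3 - e4 + τ * e1 + τ * e2

lemma integral_eq_zero (hs : IsStep Th τ γρ γη L f z a b a₂ b₂ m q 0 r₂ r₃ r₄) (hℓ : 0 < ℓ) :
    ∫ x in cube d ℓ, b x = 0 := by
  have h := hs.eq₁ _ (Th.const_mem_Vh 1)
  rwa [mobForm_const hℓ, ip_zero_left, add_zero, ip_one_right] at h

/-- Test the second equation with `b₂` itself and apply Young's inequality with weight `|lam₂| + 1`,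
so that half of `‖b₂‖²` is absorbed on the left. -/
lemma ip_le_dissipation (hs : IsStep Th τ γρ γη L f z a b a₂ b₂ m q r₁ 0 r₃ r₄) (hℓ : 0 < ℓ)
    (hL : MobilityAssumption lam₁ lam₂ lam₃ L) (h1 : 0 < lam₁)
    (hz : AEStronglyMeasurable z (volume.restrict (cube d ℓ))) :
    ip ℓ b₂ b₂ ≤ (|lam₂| + 1) * dissipation ℓ L z m q := by
  have h := hs.eq₂ _ hs.b₂_mem
  have hΛ : (0 : ℝ) < |lam₂| + 1 := by positivity
  have h3 := neg_mobForm_le hL h1 (v := fun _ => 0)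
    ((le_abs_self lam₂).trans (le_add_of_nonneg_right zero_le_one)) hz (m := m)
    (Th.lipPer_of_mem_Vh hℓ hs.q_mem).continuous
    (Th.lipPer_of_mem_Vh hℓ hs.b₂_mem).continuous hΛ
  rw [mobForm_congr (P₂' := 0) (Filter.EventuallyEq.refl _ (wgrad ℓ m)) (wgrad_const hℓ 0),
    gg_const hℓ] at h3
  rw [ip_zero_left] at h
  have h4 : (|lam₂| + 1) / (2 * (|lam₂| + 1)) = 1 / 2 := by field_simp
  rw [h4] at h3
  linarith

end IsStep

/-! ### Induction over the time steps -/

namespace IsDiscreteSolution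

variable {N : ℕ} {ρ₀ η₀ : E d → ℝ} {ρ η μρ μη : ℝ → E d → ℝ}

lemma exists_isStep (hs : IsDiscreteSolution ℓ τ N Th.Vh γρ γη L f ρ₀ η₀ ρ η μρ μη) (hτ : 0 < τ)
    (hL : MobilityAssumption lam₁ lam₂ lam₃ L) {n : ℕ} (hn : n < N) :
    ∃ a b a₂ b₂ m q : E d → ℝ,
      IsStep Th τ γρ γη L f (stateBar ℓ τ n ρ η) a b a₂ b₂ m q 0 0 0 0 ∧
      (∀ s ∈ Set.Icc 0 τ, ρ (node τ n + s) = a + s • b ∧ η (node τ n + s) = a₂ + s • b₂) ∧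
      (∀ s ∈ Set.Ioo 0 τ, μρ (node τ n + s) = m ∧ μη (node τ n + s) = q) := by
  have h0 : IsP0 τ N Th.Vh (fun _ => 0) := fun n _ => ⟨0, Th.const_mem_Vh 0, fun _ _ => rfl⟩
  have hi : ∀ v : E d → ℝ,
      ∫ t in (node τ n)..(node τ (n + 1)), ip ℓ ((fun _ => 0 : ℝ → E d → ℝ) t) v = 0 :=
    fun v => by simp [ip_zero_left]
  obtain ⟨a, b, a₂, b₂, m, q, s₁, s₂, s₃, s₄, h1, h2, h3⟩ :=
    CHAC.exists_isStep hτ hn hL hs.ρ_mem hs.η_mem hs.μρ_mem hs.μη_mem h0 h0 h0 h0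
      (fun v hv => (hs.eq₁ n hn v hv).trans (hi v).symm)
      (fun v hv => (hs.eq₂ n hn v hv).trans (hi v).symm)
      (fun v hv => (hs.eq₃ n hn v hv).trans (hi v).symm)
      (fun v hv => (hs.eq₄ n hn v hv).trans (hi v).symm)
  obtain ⟨-, -, -, -, e₁, e₂, e₃, e₄⟩ := h3 (τ / 2) ⟨by linarith, by linarith⟩
  subst e₁ e₂ e₃ e₄
  exact ⟨a, b, a₂, b₂, m, q, h1, h2, fun s hs => ⟨(h3 s hs).2.2.1, (h3 s hs).2.2.2.1⟩⟩

/-- The mean of `η` is not conserved, so its `L²` norm has to be tracked. Adding a multiple of the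
energy makes the sum grow by at most `τ / 2` per step: the energy drop pays for the dissipation that
bounds the velocity. -/
lemma invariants (hs : IsDiscreteSolution ℓ τ N Th.Vh γρ γη L f ρ₀ η₀ ρ η μρ μη) (hℓ : 0 < ℓ)
    (hτ : 0 < τ) (hf : PotentialAssumption c₁ c₂ α κ f)
    (hL : MobilityAssumption lam₁ lam₂ lam₃ L) (h1 : 0 < lam₁)
    (hρ₀ : ρ₀ ∈ Th.Vh) (hη₀ : η₀ ∈ Th.Vh) (n : ℕ) (hn : n ≤ N) :
    ρ (node τ n) ∈ Th.Vh ∧ η (node τ n) ∈ Th.Vh ∧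
      (∫ x in cube d ℓ, ρ (node τ n) x) = ∫ x in cube d ℓ, ρ₀ x ∧
      energy ℓ γρ γη f (ρ (node τ n)) (η (node τ n)) ≤ energy ℓ γρ γη f ρ₀ η₀ ∧
      normL2 ℓ (η (node τ n)) + (|lam₂| + 1) / 2 * energy ℓ γρ γη f (ρ (node τ n)) (η (node τ n)) ≤
        normL2 ℓ η₀ + (|lam₂| + 1) / 2 * energy ℓ γρ γη f ρ₀ η₀ + node τ n / 2 := by
  induction n with
  | zero =>
    have h0 : node τ 0 = 0 := by simp [node]
    rw [h0, hs.ρ_init, hs.η_init]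
    exact ⟨hρ₀, hη₀, rfl, le_rfl, by simp⟩
  | succ n ih =>
    obtain ⟨-, -, ih3, ih4, ih5⟩ := ih (by omega)
    obtain ⟨a, b, a₂, b₂, m, q, hst, hae, -⟩ := hs.exists_isStep hτ hL (n := n) (by omega)
    have hz := aestronglyMeasurable_stateBar hℓ hτ hs.ρ_mem hs.η_mem (n := n) (by omega)
    obtain ⟨e1, e2⟩ := hae 0 ⟨le_rfl, hτ.le⟩
    obtain ⟨e3, e4⟩ := hae τ ⟨hτ.le, le_rfl⟩
    rw [add_zero, zero_smul, add_zero] at e1 e2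
    rw [← node_succ] at e3 e4
    rw [e3, e4]
    rw [e1] at ih3 ih4 ih5
    rw [e2] at ih4 ih5
    have hE := hst.energy_add_dissipation hℓ hτ.le hf hL h1 hz
    have hm := hst.integral_eq_zero hℓ
    have hd := hst.ip_le_dissipation hℓ hL h1 hz
    have hD := dissipation_nonneg (ℓ := ℓ) (z := stateBar ℓ τ n ρ η) hL h1 m q
    have hac := (Th.lipPer_of_mem_Vh hℓ hst.a_mem).continuous
    have hbc := (Th.lipPer_of_mem_Vh hℓ hst.b_mem).continuous
    have ha2c := (Th.lipPer_of_mem_Vh hℓ hst.a₂_mem).continuous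
    have hb2c := (Th.lipPer_of_mem_Vh hℓ hst.b₂_mem).continuous
    refine ⟨Th.add_mem_Vh hℓ hst.a_mem (Th.smul_mem_Vh hℓ _ hst.b_mem),
      Th.add_mem_Vh hℓ hst.a₂_mem (Th.smul_mem_Vh hℓ _ hst.b₂_mem), ?_, ?_, ?_⟩
    · rw [← ih3]
      simp only [Pi.add_apply, Pi.smul_apply, smul_eq_mul]
      rw [integral_add (integrableOn_cube_of_continuous hac)
        (integrableOn_cube_of_continuous (by fun_prop)), integral_const_mul, hm, mul_zero, add_zero]
    · have := mul_nonneg hτ.le hD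
      linarith
    · have ht := normL2_add_smul_le (ℓ := ℓ) ha2c hb2c hτ.le
      -- From `y ≤ 1/2 + y²/2` and the velocity bound.
      have hy : normL2 ℓ b₂ ≤ 1 / 2 +
          (|lam₂| + 1) / 2 * dissipation ℓ L (stateBar ℓ τ n ρ η) m q := by
        have h2 := normL2_sq (ℓ := ℓ) b₂
        nlinarith [sq_nonneg (normL2 ℓ b₂ - 1)]
      have hy' := mul_le_mul_of_nonneg_left hy hτ.le
      have hE' : energy ℓ γρ γη f (a + τ • b) (a₂ + τ • b₂) =
        energy ℓ γρ γη f a a₂ - τ * dissipation ℓ L (stateBar ℓ τ n ρ η) m q := by linarith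
      rw [hE', node_succ]
      linarith

end IsDiscreteSolution

/-- Since `f ≥ 0`, the energy bounds both gradients. The `L²` norms follow from conserved mass with
Poincaré for `ρ`, and from the tracked norm for `η`, which introduces the dependence on `T`. -/
lemma exists_H1sq_bound (hd : d = 2 ∨ d = 3) (hℓ : 0 < ℓ) (hγρ : 0 < γρ) (hγη : 0 < γη)
    (h1 : 0 < lam₁) (lam₂ lam₃ c₁ c₂ α κ T M : ℝ) :
    ∃ B : ℝ, 0 ≤ B ∧ ∀ (L : Mobility d), MobilityAssumption lam₁ lam₂ lam₃ L →
      ∀ (f : ℝ → ℝ → ℝ), PotentialAssumption c₁ c₂ α κ f →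
      ∀ (Th : PeriodicMesh d ℓ) (N : ℕ) (τ : ℝ), 0 < τ → node τ N ≤ T →
      ∀ (ρ₀ η₀ : E d → ℝ), ρ₀ ∈ Th.Vh → η₀ ∈ Th.Vh → normH1 ℓ ρ₀ ≤ M → normH1 ℓ η₀ ≤ M →
      ∀ (ρ η μρ μη : ℝ → E d → ℝ),
        IsDiscreteSolution ℓ τ N Th.Vh γρ γη L f ρ₀ η₀ ρ η μρ μη →
      ∀ n ≤ N, H1sq ℓ (ρ (node τ n)) ≤ B ∧ H1sq ℓ (η (node τ n)) ≤ B := by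
  obtain ⟨C, hC, hE⟩ := exists_energy_le hd hℓ hγρ hγη c₁ c₂ (M ^ 2) (sq_nonneg M)
  obtain ⟨P, hP, hpoin⟩ := exists_poincare d hℓ
  set V := volume.real (cube d ℓ)
  set B₁ := P * (2 * C / γρ + M ^ 2 * V) + 2 * C / γρ with hB₁
  set B₂ := (M + (|lam₂| + 1) / 2 * C + T / 2) ^ 2 + 2 * C / γη with hB₂
  have hV : 0 ≤ V := measureReal_nonneg
  have hB₁0 : 0 ≤ B₁ := by positivity
  have hB₂0 : 0 ≤ B₂ := by positivity
  refine ⟨B₁ + B₂, add_nonneg hB₁0 hB₂0, ?_⟩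
  intro L hL f hf Th N τ hτ hNT ρ₀ η₀ hρ₀ hη₀ hρM hηM ρ η μρ μη hs n hn
  obtain ⟨hρ, hη, hmean, hen, hnorm⟩ := hs.invariants hℓ hτ hf hL h1 hρ₀ hη₀ n hn
  have hE0 := hE α κ f hf ρ₀ η₀ (Th.lipPer_of_mem_Vh hℓ hρ₀) (Th.lipPer_of_mem_Vh hℓ hη₀)
    (H1sq_le_of_normH1_le hρM) (H1sq_le_of_normH1_le hηM)
  have hF := integral_f_nonneg (ℓ := ℓ) hf (ρ (node τ n)) (η (node τ n))
  have hgρ := mul_nonneg (by positivity : 0 ≤ γρ / 2) (gg_self_nonneg (ℓ := ℓ) (ρ (node τ n)))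
  have hgη := mul_nonneg (by positivity : 0 ≤ γη / 2) (gg_self_nonneg (ℓ := ℓ) (η (node τ n)))
  have hen' := hen
  rw [energy] at hen'
  have hen0 : 0 ≤ energy ℓ γρ γη f (ρ (node τ n)) (η (node τ n)) := by rw [energy]; positivity
  have g1 : gg ℓ (ρ (node τ n)) (ρ (node τ n)) ≤ 2 * C / γρ := by
    rw [le_div_iff₀ hγρ]; linarith
  have g2 : gg ℓ (η (node τ n)) (η (node τ n)) ≤ 2 * C / γη := by
    rw [le_div_iff₀ hγη]; linarith
  have hnode : node τ n ≤ T := by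
    refine le_trans ?_ hNT
    unfold node
    gcongr
  have hΛ : (0 : ℝ) ≤ (|lam₂| + 1) / 2 := by positivity
  constructor
  · have hp := hpoin _ (Th.lipPer_of_mem_Vh hℓ hρ)
    rw [hmean] at hp
    have hsq := sq_integral_le (ℓ := ℓ) (Th.lipPer_of_mem_Vh hℓ hρ₀).continuous
    have hip : ip ℓ ρ₀ ρ₀ ≤ M ^ 2 :=
      (le_add_of_nonneg_right (gg_self_nonneg ρ₀)).trans (H1sq_le_of_normH1_le hρM)
    have hsq' := hsq.trans (mul_le_mul_of_nonneg_right hip hV)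
    have hp' := hp.trans (mul_le_mul_of_nonneg_left (add_le_add g1 hsq') hP.le)
    rw [H1sq]
    linarith
  · have hη0 := (normL2_le_normH1 η₀).trans hηM
    have k1 := mul_nonneg hΛ hen0
    have k2 := mul_le_mul_of_nonneg_left hE0 hΛ
    have k3 : normL2 ℓ (η (node τ n)) ≤ M + (|lam₂| + 1) / 2 * C + T / 2 := by linarith
    have k4 := pow_le_pow_left₀ (show 0 ≤ normL2 ℓ (η (node τ n)) from Real.sqrt_nonneg _) k3 2
    rw [normL2_sq] at k4
    rw [H1sq]
    linarith

end Bounds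

end CHAC
end

noncomputable section

namespace CHAC

open MeasureTheory Filter Topology

/-! ### Stability estimate on one time step -/

section Stability

variable {d : ℕ} {ℓ τ γρ γη lam₁ lam₂ lam₃ c₁ c₂ α κ : ℝ} {f : ℝ → ℝ → ℝ} {L : Mobility d}
  {Th : PeriodicMesh d ℓ} {z : E d → State d}

lemma mobForm_add_add_right (hL : MobilityAssumption lam₁ lam₂ lam₃ L) (h1 : 0 < lam₁)
    (hz : AEStronglyMeasurable z (volume.restrict (cube d ℓ)))
    {P P₁ P₂ : E d → E d} {Q Q₁ Q₂ : E d → ℝ}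
    (hP : MemLp P 2 (volume.restrict (cube d ℓ))) (hQ : MemLp Q 2 (volume.restrict (cube d ℓ)))
    (hP₁ : MemLp P₁ 2 (volume.restrict (cube d ℓ))) (hQ₁ : MemLp Q₁ 2 (volume.restrict (cube d ℓ)))
    (hP₂ : MemLp P₂ 2 (volume.restrict (cube d ℓ)))
    (hQ₂ : MemLp Q₂ 2 (volume.restrict (cube d ℓ))) :
    mobForm ℓ L z P Q (P₁ + P₂) (Q₁ + Q₂) =
      mobForm ℓ L z P Q P₁ Q₁ + mobForm ℓ L z P Q P₂ Q₂ := by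
  unfold mobForm
  rw [← integral_add (integrable_mobForm hL h1 hz hP hQ hP₁ hQ₁)
    (integrable_mobForm hL h1 hz hP hQ hP₂ hQ₂)]
  congr 1; funext x
  rw [← add_dotProduct, ← blk_add]
  simp

/-- The potentials give the full dissipation with a minus sign; Young's inequality with `s = 1/2`
spends one quarter of it on the cross term. -/
lemma neg_mobForm_add_le (hℓ : 0 < ℓ) (hL : MobilityAssumption lam₁ lam₂ lam₃ L) (h1 : 0 < lam₁)
    {lam : ℝ} (hlam : lam₂ ≤ lam)
    (hz : AEStronglyMeasurable z (volume.restrict (cube d ℓ))) {m q v w : E d → ℝ}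
    (hm : LipPer ℓ m) (hq : LipPer ℓ q) (hv : LipPer ℓ v) (hw : LipPer ℓ w) :
    -mobForm ℓ L z (wgrad ℓ m) q (wgrad ℓ (m + v)) (q + w) ≤
      -(3 / 4) * dissipation ℓ L z m q + lam * (gg ℓ v v + ip ℓ w w) := by
  rw [mobForm_congr (P₂' := wgrad ℓ m + wgrad ℓ v) (Filter.EventuallyEq.refl _ (wgrad ℓ m))
    (wgrad_add hℓ hm hv), mobForm_add_add_right hL h1 hz (memLp_wgrad ℓ m)
    (memLp_cube_of_continuous hq.continuous 2) (memLp_wgrad ℓ m)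
    (memLp_cube_of_continuous hq.continuous 2) (memLp_wgrad ℓ v)
    (memLp_cube_of_continuous hw.continuous 2), ← dissipation_eq]
  have h := neg_mobForm_le hL h1 hlam hz (m := m) (v := v) hq.continuous hw.continuous
    (s := 1 / 2) (by norm_num)
  norm_num at h
  linarith

/-- Absorption of the terms that arise from testing with the perturbed potentials. -/
lemma test_terms_le (hℓ : 0 < ℓ) (hL : MobilityAssumption lam₁ lam₂ lam₃ L) (h1 : 0 < lam₁)
    {lam P : ℝ} (hlam : lam₂ ≤ lam) (hP : 0 < P)
    (hpoin : ∀ u : E d → ℝ, LipPer ℓ u → ip ℓ u u ≤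
      P * (ipv ℓ (wgrad ℓ u) (wgrad ℓ u) + (∫ x in cube d ℓ, u x) ^ 2))
    (hz : AEStronglyMeasurable z (volume.restrict (cube d ℓ))) {m q v w r₁ r₂ : E d → ℝ}
    (hm : LipPer ℓ m) (hq : LipPer ℓ q) (hv : LipPer ℓ v) (hw : LipPer ℓ w)
    (hr₁ : LipPer ℓ r₁) (hr₂ : LipPer ℓ r₂) :
    -mobForm ℓ L z (wgrad ℓ m) q (wgrad ℓ (m + v)) (q + w) - ip ℓ r₁ (m + v) - ip ℓ r₂ (q + w) ≤
      -(1 / 2) * dissipation ℓ L z m q + ((P + 1) / lam₁ + 1 / 2) * normHneg1 ℓ r₁ ^ 2 +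
      (1 / lam₁ + 1 / 2) * ip ℓ r₂ r₂ + (lam + 1 / 2) * (H1sq ℓ v + ip ℓ w w) -
      lam * ip ℓ v v + lam₁ / 4 * (∫ x in cube d ℓ, m x) ^ 2 := by
  have hA := neg_mobForm_add_le hℓ hL h1 hlam hz hm hq hv hw
  have hD := le_dissipation hL h1 hz (m := m) hq.continuous
  -- With this weight, Poincaré turns the `H¹` norm of `m` into `lam₁ / 4` times the squared
  -- gradient and mean. Together with `lam₁ / 4` times `‖q‖²` from the `r₂` term, this costs another
  -- quarter of the dissipation and leaves one half.
  have hδ : 0 < lam₁ / (2 * (P + 1)) := by positivity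
  have y1 := ip_le_young hr₁.continuous (hm.const_smul (-1)).memH1 hδ
  have y2 := ip_le_young hr₁.continuous (hv.const_smul (-1)).memH1 one_pos
  rw [ip_smul_right, H1sq_smul hℓ hm] at y1
  rw [ip_smul_right, H1sq_smul hℓ hv] at y2
  have hHm : lam₁ / (2 * (P + 1)) / 2 * ((-1) ^ 2 * H1sq ℓ m) ≤
      lam₁ / 4 * (gg ℓ m m + (∫ x in cube d ℓ, m x) ^ 2) := by
    have hp := hpoin m hm
    have hle : H1sq ℓ m ≤ (P + 1) * (gg ℓ m m + (∫ x in cube d ℓ, m x) ^ 2) := by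
      have := sq_nonneg (∫ x in cube d ℓ, m x)
      change ip ℓ m m ≤ P * (gg ℓ m m + _) at hp
      rw [H1sq]
      linarith
    have := mul_le_mul_of_nonneg_left hle (by positivity : 0 ≤ lam₁ / (4 * (P + 1)))
    have e1 : lam₁ / (2 * (P + 1)) / 2 * ((-1) ^ 2 * H1sq ℓ m) =
      lam₁ / (4 * (P + 1)) * H1sq ℓ m := by field_simp; ring
    have e2 : lam₁ / (4 * (P + 1)) * ((P + 1) * (gg ℓ m m + (∫ x in cube d ℓ, m x) ^ 2)) =
      lam₁ / 4 * (gg ℓ m m + (∫ x in cube d ℓ, m x) ^ 2) := by field_simp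
    rwa [e1, ← e2]
  have hn : normHneg1 ℓ r₁ ^ 2 / (2 * (lam₁ / (2 * (P + 1)))) =
    (P + 1) / lam₁ * normHneg1 ℓ r₁ ^ 2 := by field_simp
  rw [hn] at y1
  have y3 := ip_self_nonneg (ℓ := ℓ) (r₂ + (lam₁ / 2) • q)
  rw [ip_add_smul_self hr₂.continuous hq.continuous] at y3
  have y3' : -ip ℓ r₂ q ≤ 1 / lam₁ * ip ℓ r₂ r₂ + lam₁ / 4 * ip ℓ q q := by
    have e : 1 / lam₁ * ip ℓ r₂ r₂ + lam₁ / 4 * ip ℓ q q + ip ℓ r₂ q =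
      (ip ℓ r₂ r₂ + 2 * (lam₁ / 2) * ip ℓ r₂ q + (lam₁ / 2) ^ 2 * ip ℓ q q) / lam₁ := by
      field_simp; ring
    have := div_nonneg y3 h1.le
    linarith
  have y4 := ip_self_nonneg (ℓ := ℓ) (r₂ + (1 : ℝ) • w)
  rw [ip_add_smul_self hr₂.continuous hw.continuous] at y4
  rw [ip_add_right hm.continuous hv.continuous hr₁.continuous,
    ip_add_right hq.continuous hw.continuous hr₂.continuous]
  simp only [H1sq] at *
  linarith

namespace IsStep

variable {a b a₂ b₂ m q a' b' a₂' b₂' m' q' r₁ r₂ r₃ r₄ : E d → ℝ}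

/-- The evolution of the relative energy on one step, after testing the equations with the
differences of the potentials and with the linear part of the relative energy. -/
lemma relEnergy_sub_eq (hs : IsStep Th τ γρ γη L f z a b a₂ b₂ m q 0 0 0 0)
    (hs' : IsStep Th τ γρ γη L f z a' b' a₂' b₂' m' q' r₁ r₂ r₃ r₄) (hℓ : 0 < ℓ) (hτ : 0 ≤ τ)
    (hf : PotentialAssumption c₁ c₂ α κ f)
    (hL : MobilityAssumption lam₁ lam₂ lam₃ L) (h1 : 0 < lam₁)
    (hz : AEStronglyMeasurable z (volume.restrict (cube d ℓ))) {v w : E d → ℝ}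
    (hv : v = r₃ + α • ((a - a') + (τ / 2) • (b - b')))
    (hw : w = r₄ + α • ((a₂ - a₂') + (τ / 2) • (b₂ - b₂'))) :
    relEnergy ℓ γρ γη α f (a + τ • b) (a₂ + τ • b₂) (a' + τ • b') (a₂' + τ • b₂') -
      relEnergy ℓ γρ γη α f a a₂ a' a₂' =
      τ * (-mobForm ℓ L z (wgrad ℓ (m - m')) (q - q') (wgrad ℓ ((m - m') + v)) ((q - q') + w) -
        ip ℓ r₁ ((m - m') + v) - ip ℓ r₂ ((q - q') + w)) +
      ∫ s in (0 : ℝ)..τ, ∫ x in cube d ℓ,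
        (taylorρ f ((a + s • b) x) ((a₂ + s • b₂) x) ((a' + s • b') x) ((a₂' + s • b₂') x) * b' x +
         taylorη f ((a + s • b) x) ((a₂ + s • b₂) x) ((a' + s • b') x) ((a₂' + s • b₂') x)
          * b₂' x) := by
  have lip := fun {u : E d → ℝ} (hu : u ∈ Th.Vh) => Th.lipPer_of_mem_Vh hℓ hu
  have hbe := Th.sub_mem_Vh hℓ hs.b_mem hs'.b_mem
  have hbg := Th.sub_mem_Vh hℓ hs.b₂_mem hs'.b₂_mem
  have hem : (a - a') + (τ / 2) • (b - b') ∈ Th.Vh :=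
    Th.add_mem_Vh hℓ (Th.sub_mem_Vh hℓ hs.a_mem hs'.a_mem) (Th.smul_mem_Vh hℓ _ hbe)
  have hgm : (a₂ - a₂') + (τ / 2) • (b₂ - b₂') ∈ Th.Vh :=
    Th.add_mem_Vh hℓ (Th.sub_mem_Vh hℓ hs.a₂_mem hs'.a₂_mem) (Th.smul_mem_Vh hℓ _ hbg)
  have hvm : v ∈ Th.Vh := by
    rw [hv]; exact Th.add_mem_Vh hℓ hs'.r₃_mem (Th.smul_mem_Vh hℓ _ hem)
  have hwm : w ∈ Th.Vh := by
    rw [hw]; exact Th.add_mem_Vh hℓ hs'.r₄_mem (Th.smul_mem_Vh hℓ _ hgm)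
  have hdm := Th.sub_mem_Vh hℓ hs.m_mem hs'.m_mem
  have hdq := Th.sub_mem_Vh hℓ hs.q_mem hs'.q_mem
  have hV := Th.add_mem_Vh hℓ hdm hvm
  have hW := Th.add_mem_Vh hℓ hdq hwm
  have e := relEnergy_sub (γρ := γρ) (γη := γη) hℓ hf hτ (lip hs.a_mem) (lip hs.b_mem)
    (lip hs.a₂_mem) (lip hs.b₂_mem) (lip hs'.a_mem) (lip hs'.b_mem) (lip hs'.a₂_mem)
    (lip hs'.b₂_mem)
  have e1 := hs.eq₁ _ hV
  have e1' := hs'.eq₁ _ hV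
  have e2 := hs.eq₂ _ hW
  have e2' := hs'.eq₂ _ hW
  have e3 := hs.eq₃ _ hbe
  have e3' := hs'.eq₃ _ hbe
  have e4 := hs.eq₄ _ hbg
  have e4' := hs'.eq₄ _ hbg
  rw [ip_zero_left] at e1 e2 e3 e4
  have lp := fun {u : E d → ℝ} (hu : u ∈ Th.Vh) =>
    memLp_cube_of_continuous (ℓ := ℓ) (lip hu).continuous 2
  have f1 := mobForm_add_right hL h1 hz (memLp_wgrad ℓ m) (lp hs.q_mem)
    (memLp_wgrad ℓ ((m - m') + v)) (lp hW)
  have f2 := mobForm_add_right hL h1 hz (memLp_wgrad ℓ m') (lp hs'.q_mem)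
    (memLp_wgrad ℓ ((m - m') + v)) (lp hW)
  have f3 := mobForm_sub_left hL h1 hz (memLp_wgrad ℓ m) (lp hs.q_mem) (memLp_wgrad ℓ m')
    (lp hs'.q_mem) (memLp_wgrad ℓ ((m - m') + v)) (lp hW)
  have f4 : mobForm ℓ L z (wgrad ℓ (m - m')) (q - q') (wgrad ℓ ((m - m') + v)) ((q - q') + w) =
      mobForm ℓ L z (wgrad ℓ m - wgrad ℓ m') (q - q') (wgrad ℓ ((m - m') + v)) ((q - q') + w) :=
    mobForm_congr (wgrad_sub hℓ (lip hs.m_mem) (lip hs'.m_mem)) (Filter.EventuallyEq.refl _ _)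
  have cV := (lip hV).continuous
  have cW := (lip hW).continuous
  -- The choice of `v` makes this pairing produce all forces at once: the potential difference, the
  -- residual `r₃`, and the derivative of the `α`-term.
  have g1 : ip ℓ b ((m - m') + v) - ip ℓ b' ((m - m') + v) =
      ip ℓ m (b - b') - ip ℓ m' (b - b') + (ip ℓ r₃ (b - b') +
        α * ip ℓ ((a - a') + (τ / 2) • (b - b')) (b - b')) := by
    rw [← ip_sub_left (lip hs.b_mem).continuous (lip hs'.b_mem).continuous cV, ip_comm,
      ip_add_left (lip hdm).continuous (lip hvm).continuous (lip hbe).continuous,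
      ip_sub_left (lip hs.m_mem).continuous (lip hs'.m_mem).continuous (lip hbe).continuous, hv,
      ip_add_left (lip hs'.r₃_mem).continuous ((lip hem).const_smul α).continuous
        (lip hbe).continuous, ip_smul_left]
  have g2 : ip ℓ b₂ ((q - q') + w) - ip ℓ b₂' ((q - q') + w) =
      ip ℓ q (b₂ - b₂') - ip ℓ q' (b₂ - b₂') + (ip ℓ r₄ (b₂ - b₂') +
        α * ip ℓ ((a₂ - a₂') + (τ / 2) • (b₂ - b₂')) (b₂ - b₂')) := by
    rw [← ip_sub_left (lip hs.b₂_mem).continuous (lip hs'.b₂_mem).continuous cW, ip_comm,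
      ip_add_left (lip hdq).continuous (lip hwm).continuous (lip hbg).continuous,
      ip_sub_left (lip hs.q_mem).continuous (lip hs'.q_mem).continuous (lip hbg).continuous, hw,
      ip_add_left (lip hs'.r₄_mem).continuous ((lip hgm).const_smul α).continuous
        (lip hbg).continuous, ip_smul_left]
  have k : ∀ {a b a' b' : E d → ℝ}, a ∈ Th.Vh → b ∈ Th.Vh → a' ∈ Th.Vh → b' ∈ Th.Vh →
      gg ℓ ((a - a') + (τ / 2) • (b - b')) (b - b') =
      gg ℓ (a + (τ / 2) • b) (b - b') - gg ℓ (a' + (τ / 2) • b') (b - b') := by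
    intro a b a' b' ha hb ha' hb'
    rw [← gg_sub_left hℓ ((lip ha).add ((lip hb).const_smul _))
      ((lip ha').add ((lip hb').const_smul _)),
      show (a - a') + (τ / 2) • (b - b') = a + (τ / 2) • b - (a' + (τ / 2) • b') by module]
  have k1 := k hs.a_mem hs.b_mem hs'.a_mem hs'.b_mem
  have k2 := k hs.a₂_mem hs.b₂_mem hs'.a₂_mem hs'.b₂_mem
  rw [e, k1, k2, f4]
  linear_combination (-1 : ℝ) * e3 + e3' - e4 + e4' + τ * e1 - τ * e1' + τ * e2 - τ * e2' -
    τ * g1 - τ * g2 - τ * f1 + τ * f2 - τ * f3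

end IsStep

end Stability

end CHAC
end

noncomputable section

namespace CHAC

open MeasureTheory Filter Topology

/-! ### Stability estimate on one time step: the constants -/

section Estimate

variable {d : ℕ} {ℓ τ γρ γη lam₁ lam₂ lam₃ c₁ c₂ α κ : ℝ} {f : ℝ → ℝ → ℝ} {L : Mobility d}
  {Th : PeriodicMesh d ℓ} {z : E d → State d}
  {a b a₂ b₂ m q a' b' a₂' b₂' m' q' r₁ r₂ r₃ r₄ : E d → ℝ}

/-- The squared `H¹` distance of two pairs of affine functions of time. -/
def distSq (ℓ : ℝ) (a b a₂ b₂ a' b' a₂' b₂' : E d → ℝ) (s : ℝ) : ℝ :=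
  H1sq ℓ (a + s • b - (a' + s • b')) + H1sq ℓ (a₂ + s • b₂ - (a₂' + s • b₂'))

lemma line_sub_line (a b a' b' : E d → ℝ) (s : ℝ) :
    a + s • b - (a' + s • b') = (a - a') + s • (b - b') := by module

lemma continuous_distSq (hℓ : 0 < ℓ) (ha : LipPer ℓ a) (hb : LipPer ℓ b) (ha₂ : LipPer ℓ a₂)
    (hb₂ : LipPer ℓ b₂) (ha' : LipPer ℓ a') (hb' : LipPer ℓ b') (ha₂' : LipPer ℓ a₂')
    (hb₂' : LipPer ℓ b₂') : Continuous (distSq ℓ a b a₂ b₂ a' b' a₂' b₂') := by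
  have : distSq ℓ a b a₂ b₂ a' b' a₂' b₂' = fun s =>
      (H1sq ℓ (a - a') + 2 * s * (ip ℓ (a - a') (b - b') + gg ℓ (a - a') (b - b')) +
        s ^ 2 * H1sq ℓ (b - b')) +
      (H1sq ℓ (a₂ - a₂') + 2 * s * (ip ℓ (a₂ - a₂') (b₂ - b₂') + gg ℓ (a₂ - a₂') (b₂ - b₂')) +
        s ^ 2 * H1sq ℓ (b₂ - b₂')) := by
    funext s
    rw [distSq, line_sub_line, line_sub_line, H1sq_add_smul hℓ (ha.sub ha') (hb.sub hb'),
      H1sq_add_smul hℓ (ha₂.sub ha₂') (hb₂.sub hb₂')]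
  rw [this]
  fun_prop

/-- The scheme sees only the midpoint error, whereas the final bound is in terms of the time
integral; convexity of the squared norm gives the inequality in the useful direction. -/
lemma mid_le_integral_distSq (hℓ : 0 < ℓ) (hτ : 0 ≤ τ) (ha : LipPer ℓ a) (hb : LipPer ℓ b)
    (ha₂ : LipPer ℓ a₂) (hb₂ : LipPer ℓ b₂) (ha' : LipPer ℓ a') (hb' : LipPer ℓ b')
    (ha₂' : LipPer ℓ a₂') (hb₂' : LipPer ℓ b₂') :
    τ * (H1sq ℓ ((a - a') + (τ / 2) • (b - b')) + H1sq ℓ ((a₂ - a₂') + (τ / 2) • (b₂ - b₂'))) ≤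
      ∫ s in (0 : ℝ)..τ, distSq ℓ a b a₂ b₂ a' b' a₂' b₂' s := by
  have hc : ∀ {u v : E d → ℝ}, LipPer ℓ u → LipPer ℓ v →
      Continuous fun s : ℝ => H1sq ℓ (u + s • v) := by
    intro u v hu hv
    simp only [H1sq_add_smul hℓ hu hv]
    fun_prop
  have hi := intervalIntegral.integral_add
    ((hc (ha.sub ha') (hb.sub hb')).intervalIntegrable 0 τ (μ := volume))
    ((hc (ha₂.sub ha₂') (hb₂.sub hb₂')).intervalIntegrable 0 τ (μ := volume))
  have h1 := H1sq_mid_le hℓ (ha.sub ha') (hb.sub hb') hτ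
  have h2 := H1sq_mid_le hℓ (ha₂.sub ha₂') (hb₂.sub hb₂') hτ
  simp only [distSq, line_sub_line]
  linarith

lemma intervalIntegrable_relEnergy (hℓ : 0 < ℓ) (hτ : 0 ≤ τ)
    (hf : PotentialAssumption c₁ c₂ α κ f) (ha : LipPer ℓ a) (hb : LipPer ℓ b)
    (ha₂ : LipPer ℓ a₂) (hb₂ : LipPer ℓ b₂) (ha' : LipPer ℓ a') (hb' : LipPer ℓ b')
    (ha₂' : LipPer ℓ a₂') (hb₂' : LipPer ℓ b₂') :
    IntervalIntegrable (fun s => relEnergy ℓ γρ γη α f (a + s • b) (a₂ + s • b₂) (a' + s • b')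
      (a₂' + s • b₂')) volume 0 τ := by
  have hac := ha.continuous
  have hbc := hb.continuous
  have hac₂ := ha₂.continuous
  have hbc₂ := hb₂.continuous
  have hac' := ha'.continuous
  have hbc' := hb'.continuous
  have hac₂' := ha₂'.continuous
  have hbc₂' := hb₂'.continuous
  have hl : ∀ {u v : E d → ℝ}, Continuous u → Continuous v →
      Continuous fun p : ℝ × E d => (u + p.1 • v) p.2 := fun {u v} hu hv =>
    (by fun_prop : Continuous fun p : ℝ × E d => u p.2 + p.1 * v p.2)
  have hsm : ∀ {u v : E d → ℝ} (s : ℝ), Continuous u → Continuous v → Continuous (u + s • v) :=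
    fun s hu hv => hu.add (hv.const_smul s)
  have hpot := intervalIntegrable_integral_cube (ℓ := ℓ)
    (Ψ := fun s x => relPot f ((a + s • b) x) ((a₂ + s • b₂) x) ((a' + s • b') x)
      ((a₂' + s • b₂') x)) hτ
    (hf.continuous_relPot (hl hac hbc) (hl hac₂ hbc₂) (hl hac' hbc') (hl hac₂' hbc₂'))
  have hq : Continuous fun s : ℝ =>
      γρ / 2 * gg ℓ ((a - a') + s • (b - b')) ((a - a') + s • (b - b')) +
      γη / 2 * gg ℓ ((a₂ - a₂') + s • (b₂ - b₂')) ((a₂ - a₂') + s • (b₂ - b₂')) +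
      α / 2 * ip ℓ ((a - a') + s • (b - b')) ((a - a') + s • (b - b')) +
      α / 2 * ip ℓ ((a₂ - a₂') + s • (b₂ - b₂')) ((a₂ - a₂') + s • (b₂ - b₂')) := by
    simp only [gg_add_smul_self hℓ (ha.sub ha') (hb.sub hb'),
      gg_add_smul_self hℓ (ha₂.sub ha₂') (hb₂.sub hb₂'),
      ip_add_smul_self (ha.sub ha').continuous (hb.sub hb').continuous,
      ip_add_smul_self (ha₂.sub ha₂').continuous (hb₂.sub hb₂').continuous]
    fun_prop
  refine ((hq.intervalIntegrable 0 τ).add hpot).congr fun s _ => ?_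
  rw [relEnergy_eq hf (hsm s hac hbc) (hsm s hac₂ hbc₂) (hsm s hac' hbc') (hsm s hac₂' hbc₂'),
    line_sub_line, line_sub_line]

/-- The mean of the difference of the potentials is controlled by the relative energy and the
residual. -/
lemma IsStep.sq_mean_sub_le (hs : IsStep Th τ γρ γη L f z a b a₂ b₂ m q 0 0 0 0)
    (hs' : IsStep Th τ γρ γη L f z a' b' a₂' b₂' m' q' r₁ r₂ r₃ r₄) (hℓ : 0 < ℓ) (hτ : 0 ≤ τ)
    (hf : PotentialAssumption c₁ c₂ α κ f) {C : ℝ}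
    (hC : ∀ s ∈ Set.Icc 0 τ,
      (∫ x in cube d ℓ, (fρ f ((a + s • b) x) ((a₂ + s • b₂) x) -
        fρ f ((a' + s • b') x) ((a₂' + s • b₂') x))) ^ 2 ≤
        C * distSq ℓ a b a₂ b₂ a' b' a₂' b₂' s) :
    τ * (∫ x in cube d ℓ, (m - m') x) ^ 2 ≤
      2 * C * (∫ s in (0 : ℝ)..τ, distSq ℓ a b a₂ b₂ a' b' a₂' b₂' s) +
      2 * volume.real (cube d ℓ) * (τ * ip ℓ r₃ r₃) := by
  have lip := fun {u : E d → ℝ} (hu : u ∈ Th.Vh) => Th.lipPer_of_mem_Vh hℓ hu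
  have hac := (lip hs.a_mem).continuous
  have hbc := (lip hs.b_mem).continuous
  have hac₂ := (lip hs.a₂_mem).continuous
  have hbc₂ := (lip hs.b₂_mem).continuous
  have hac' := (lip hs'.a_mem).continuous
  have hbc' := (lip hs'.b_mem).continuous
  have hac₂' := (lip hs'.a₂_mem).continuous
  have hbc₂' := (lip hs'.b₂_mem).continuous
  have hl : ∀ {u v : E d → ℝ}, Continuous u → Continuous v →
      Continuous fun p : ℝ × E d => (u + p.1 • v) p.2 := fun {u v} hu hv =>
    (by fun_prop : Continuous fun p : ℝ × E d => u p.2 + p.1 * v p.2)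
  have c1 : Continuous fun p : ℝ × E d => fρ f ((a + p.1 • b) p.2) ((a₂ + p.1 • b₂) p.2) :=
    hf.continuous_fρ (hl hac hbc) (hl hac₂ hbc₂)
  have c2 : Continuous fun p : ℝ × E d => fρ f ((a' + p.1 • b') p.2) ((a₂' + p.1 • b₂') p.2) :=
    hf.continuous_fρ (hl hac' hbc') (hl hac₂' hbc₂')
  have hsl : ∀ s : ℝ, Continuous fun x : E d => (s, x) := fun s => by fun_prop
  have t1 := intervalIntegrable_integral_cube (ℓ := ℓ)
    (Ψ := fun s x => fρ f ((a + s • b) x) ((a₂ + s • b₂) x)) hτ c1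
  have t2 := intervalIntegrable_integral_cube (ℓ := ℓ)
    (Ψ := fun s x => fρ f ((a' + s • b') x) ((a₂' + s • b₂') x)) hτ c2
  have tX := (continuous_distSq hℓ (lip hs.a_mem) (lip hs.b_mem) (lip hs.a₂_mem) (lip hs.b₂_mem)
    (lip hs'.a_mem) (lip hs'.b_mem) (lip hs'.a₂_mem) (lip hs'.b₂_mem)).intervalIntegrable 0 τ
    (μ := volume)
  have e3 := hs.eq₃ _ (Th.const_mem_Vh 1)
  have e3' := hs'.eq₃ _ (Th.const_mem_Vh 1)
  simp only [ip_one_right, gg_const hℓ, Pi.zero_apply, integral_zero] at e3 e3'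
  set μ := ∫ x in cube d ℓ, (m - m') x with hμ
  have hμe : μ = (∫ x in cube d ℓ, m x) - ∫ x in cube d ℓ, m' x :=
    integral_sub (integrableOn_cube_of_continuous (lip hs.m_mem).continuous)
      (integrableOn_cube_of_continuous (lip hs'.m_mem).continuous)
  have hA : ∀ s : ℝ, (∫ x in cube d ℓ, (fρ f ((a + s • b) x) ((a₂ + s • b₂) x) -
        fρ f ((a' + s • b') x) ((a₂' + s • b₂') x))) =
      (∫ x in cube d ℓ, fρ f ((a + s • b) x) ((a₂ + s • b₂) x)) -
        ∫ x in cube d ℓ, fρ f ((a' + s • b') x) ((a₂' + s • b₂') x) := fun s =>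
    integral_sub (integrableOn_cube_of_continuous (c1.comp (hsl s)))
      (integrableOn_cube_of_continuous (c2.comp (hsl s)))
  have hI := intervalIntegral.integral_sub t1 t2
  have tc : IntervalIntegrable (fun _ : ℝ => μ ^ 2 / 4) volume 0 τ := intervalIntegrable_const
  -- One quarter of `μ²` goes to the force and one quarter to `r₃`, so half of it survives; hence
  -- the factors `2` in the bound.
  have hyoung : ∀ F X : ℝ, F ^ 2 ≤ X → μ * F ≤ X + μ ^ 2 / 4 := fun F X h => by
    nlinarith [sq_nonneg (μ / 2 - F)]
  have hmono := intervalIntegral.integral_mono_on hτ ((t1.sub t2).const_mul μ)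
    ((tX.const_mul C).add tc) fun s hs => hyoung _ _ ((hA s) ▸ hC s hs)
  have hadd := intervalIntegral.integral_add (tX.const_mul C) tc
  rw [intervalIntegral.integral_const_mul, intervalIntegral.integral_const] at hadd
  have hmono' := hmono.trans_eq hadd
  rw [intervalIntegral.integral_const_mul] at hmono'
  have hmono'' := (congrArg (μ * ·) hI).symm.trans_le hmono'
  simp only [sub_zero, smul_eq_mul] at hmono''
  have hr := sq_integral_le (ℓ := ℓ) (lip hs'.r₃_mem).continuous
  have hr' := mul_le_mul_of_nonneg_left hr hτ
  -- The third equations tested with the constant `1`; the gradient terms drop out.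
  have hτμ : τ * μ = (∫ s in (0 : ℝ)..τ, ∫ x in cube d ℓ, fρ f ((a + s • b) x) ((a₂ + s • b₂) x)) -
      (∫ s in (0 : ℝ)..τ, ∫ x in cube d ℓ, fρ f ((a' + s • b') x) ((a₂' + s • b₂') x)) -
      τ * ∫ x in cube d ℓ, r₃ x := by
    rw [hμe]; linear_combination e3 - e3'
  have h5 : τ * μ ^ 2 = μ * ((∫ s in (0 : ℝ)..τ, ∫ x in cube d ℓ,
      fρ f ((a + s • b) x) ((a₂ + s • b₂) x)) -
      (∫ s in (0 : ℝ)..τ, ∫ x in cube d ℓ, fρ f ((a' + s • b') x) ((a₂' + s • b₂') x))) -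
      τ * (μ * ∫ x in cube d ℓ, r₃ x) := by linear_combination μ * hτμ
  have h6 := mul_nonneg hτ (sq_nonneg (μ / 2 + ∫ x in cube d ℓ, r₃ x))
  nlinarith

/-- All error terms are multiples of the time integral of the squared `H¹` distance or of the
residuals; coercivity replaces that distance by the relative energy. The constants are fixed before
mesh, step size and solutions. -/
lemma exists_step_constants (hd : d = 2 ∨ d = 3) (hℓ : 0 < ℓ) (hγρ : 0 < γρ) (hγη : 0 < γη)
    (h1 : 0 < lam₁) (hκ : 0 < κ) (lam₂ lam₃ c₁ c₂ α B : ℝ) (hB : 0 ≤ B) :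
    ∃ C₂ C₃ : ℝ, 0 < C₂ ∧ 0 < C₃ ∧
      ∀ (L : Mobility d), MobilityAssumption lam₁ lam₂ lam₃ L →
      ∀ (f : ℝ → ℝ → ℝ), PotentialAssumption c₁ c₂ α κ f →
      ∀ (Th : PeriodicMesh d ℓ) (τ : ℝ) (z : E d → State d), 0 ≤ τ →
        AEStronglyMeasurable z (volume.restrict (cube d ℓ)) →
      ∀ a b a₂ b₂ m q a' b' a₂' b₂' m' q' r₁ r₂ r₃ r₄ : E d → ℝ,
        IsStep Th τ γρ γη L f z a b a₂ b₂ m q 0 0 0 0 →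
        IsStep Th τ γρ γη L f z a' b' a₂' b₂' m' q' r₁ r₂ r₃ r₄ →
        (∀ s ∈ Set.Icc 0 τ, H1sq ℓ (a + s • b) ≤ B) →
        (∀ s ∈ Set.Icc 0 τ, H1sq ℓ (a₂ + s • b₂) ≤ B) →
        (∀ s ∈ Set.Icc 0 τ, H1sq ℓ (a' + s • b') ≤ B) →
        (∀ s ∈ Set.Icc 0 τ, H1sq ℓ (a₂' + s • b₂') ≤ B) →
        ip ℓ b' b' ≤ B → ip ℓ b₂' b₂' ≤ B →
        relEnergy ℓ γρ γη α f (a + τ • b) (a₂ + τ • b₂) (a' + τ • b') (a₂' + τ • b₂') -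
          relEnergy ℓ γρ γη α f a a₂ a' a₂' +
          1 / 2 * (τ * dissipation ℓ L z (m - m') (q - q')) ≤
        C₂ * (∫ s in (0 : ℝ)..τ, relEnergy ℓ γρ γη α f (a + s • b) (a₂ + s • b₂) (a' + s • b')
          (a₂' + s • b₂')) +
        C₃ * (τ * (normHneg1 ℓ r₁ ^ 2 + ip ℓ r₂ r₂ + H1sq ℓ r₃ + ip ℓ r₄ r₄)) := by
  obtain ⟨P, hP, hpoin⟩ := exists_poincare d hℓ
  obtain ⟨CT, hCT, htay⟩ := exists_taylor_integral_le hd hℓ c₁ c₂ B hB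
  obtain ⟨CF, hCF, hmean⟩ := exists_sq_integral_fρ_sub_le hd hℓ c₁ c₂ B hB
  set Λ := |lam₂| with hΛ
  have hΛ0 : 0 ≤ Λ := abs_nonneg _
  set V := volume.real (cube d ℓ) with hV
  have hV0 : 0 ≤ V := measureReal_nonneg
  obtain ⟨c, hc, hcρ, hcη, hcκ⟩ : ∃ c : ℝ, 0 < c ∧ c ≤ γρ / 2 ∧ c ≤ γη / 2 ∧ c ≤ κ / 2 :=
    ⟨min (γρ / 2) (min (γη / 2) (κ / 2)), by positivity, min_le_left _ _,
      (min_le_right _ _).trans (min_le_left _ _), (min_le_right _ _).trans (min_le_right _ _)⟩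
  -- Contributions of the Taylor remainder, of the midpoint errors in the test functions, and of the
  -- mean of the potential difference. The later `A + 1` ensures a positive constant.
  set A := CT + (2 * Λ + 1) * α ^ 2 + lam₁ / 2 * CF with hA
  have hA0 : 0 ≤ A := by positivity
  -- Large enough to exceed each of the four residual coefficients separately.
  set K := (P + 1) / lam₁ + 1 / lam₁ + 2 * Λ + 2 + lam₁ / 2 * V with hK
  have hK0 : 0 < K := by positivity
  refine ⟨(A + 1) / c, K, by positivity, hK0, ?_⟩
  intro L hL f hf Th τ z hτ hz a b a₂ b₂ m q a' b' a₂' b₂' m' q' r₁ r₂ r₃ r₄ hs hs' hBa hBa₂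
    hBa' hBa₂' hBb hBb₂
  have lip := fun {u : E d → ℝ} (hu : u ∈ Th.Vh) => Th.lipPer_of_mem_Vh hℓ hu
  have hac := lip hs.a_mem
  have hbc := lip hs.b_mem
  have hac₂ := lip hs.a₂_mem
  have hbc₂ := lip hs.b₂_mem
  have hac' := lip hs'.a_mem
  have hbc' := lip hs'.b_mem
  have hac₂' := lip hs'.a₂_mem
  have hbc₂' := lip hs'.b₂_mem
  have hline : ∀ {u v : E d → ℝ} (s : ℝ), LipPer ℓ u → LipPer ℓ v → LipPer ℓ (u + s • v) :=
    fun s hu hv => hu.add (hv.const_smul s)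
  have tX := (continuous_distSq hℓ hac hbc hac₂ hbc₂ hac' hbc' hac₂' hbc₂').intervalIntegrable
    0 τ (μ := volume)
  set I := ∫ s in (0 : ℝ)..τ, distSq ℓ a b a₂ b₂ a' b' a₂' b₂' s with hI
  have hI0 : 0 ≤ I := intervalIntegral.integral_nonneg hτ fun s _ =>
    add_nonneg (H1sq_nonneg _) (H1sq_nonneg _)
  have hIE : (A + 1) * I ≤ (A + 1) / c * (∫ s in (0 : ℝ)..τ,
      relEnergy ℓ γρ γη α f (a + s • b) (a₂ + s • b₂) (a' + s • b') (a₂' + s • b₂')) := by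
    have hcI : c * I ≤ ∫ s in (0 : ℝ)..τ,
        relEnergy ℓ γρ γη α f (a + s • b) (a₂ + s • b₂) (a' + s • b') (a₂' + s • b₂') := by
      rw [hI, ← intervalIntegral.integral_const_mul]
      exact intervalIntegral.integral_mono_on hτ (tX.const_mul c)
        (intervalIntegrable_relEnergy hℓ hτ hf hac hbc hac₂ hbc₂ hac' hbc' hac₂' hbc₂')
        fun s _ => le_relEnergy hf (hline s hac hbc).continuous (hline s hac₂ hbc₂).continuous
          (hline s hac' hbc').continuous (hline s hac₂' hbc₂').continuous hcρ hcη hcκ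
    rw [div_mul_eq_mul_div, le_div_iff₀ hc]
    nlinarith
  set e := (a - a') + (τ / 2) • (b - b') with he
  set g := (a₂ - a₂') + (τ / 2) • (b₂ - b₂') with hg
  have hel : LipPer ℓ e := hline _ (hac.sub hac') (hbc.sub hbc')
  have hgl : LipPer ℓ g := hline _ (hac₂.sub hac₂') (hbc₂.sub hbc₂')
  have hmid : τ * (H1sq ℓ e + H1sq ℓ g) ≤ I :=
    mid_le_integral_distSq hℓ hτ hac hbc hac₂ hbc₂ hac' hbc' hac₂' hbc₂'
  have hid := hs.relEnergy_sub_eq hs' hℓ hτ hf hL h1 hz rfl rfl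
  rw [← he, ← hg] at hid
  have hl3 := lip hs'.r₃_mem
  have hl4 := lip hs'.r₄_mem
  have htest := test_terms_le hℓ hL h1 (le_abs_self lam₂) hP hpoin hz
    ((lip hs.m_mem).sub (lip hs'.m_mem)) ((lip hs.q_mem).sub (lip hs'.q_mem))
    (hl3.add (hel.const_smul α)) (hl4.add (hgl.const_smul α)) (lip hs'.r₁_mem) (lip hs'.r₂_mem)
  have hv : H1sq ℓ (r₃ + α • e) ≤ 2 * H1sq ℓ r₃ + 2 * (α ^ 2 * H1sq ℓ e) := by
    rw [← H1sq_smul hℓ hel]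
    exact H1sq_add_le hℓ hl3 (hel.const_smul α)
  have hw : ip ℓ (r₄ + α • g) (r₄ + α • g) ≤ 2 * ip ℓ r₄ r₄ + 2 * (α ^ 2 * H1sq ℓ g) := by
    have h := ip_add_self_le (ℓ := ℓ) hl4.continuous (hgl.const_smul α).continuous
    rw [ip_smul_left, ip_smul_right] at h
    have h' := mul_nonneg (sq_nonneg α) (gg_self_nonneg (ℓ := ℓ) g)
    rw [H1sq]
    linarith
  have hT : (∫ s in (0 : ℝ)..τ, ∫ x in cube d ℓ,
      (taylorρ f ((a + s • b) x) ((a₂ + s • b₂) x) ((a' + s • b') x) ((a₂' + s • b₂') x) * b' x +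
       taylorη f ((a + s • b) x) ((a₂ + s • b₂) x) ((a' + s • b') x) ((a₂' + s • b₂') x)
        * b₂' x)) ≤ CT * I := by
    have hl : ∀ {u v : E d → ℝ}, LipPer ℓ u → LipPer ℓ v →
        Continuous fun p : ℝ × E d => (u + p.1 • v) p.2 := fun {u v} hu hv => by
      have := hu.continuous
      have := hv.continuous
      exact (by fun_prop : Continuous fun p : ℝ × E d => u p.2 + p.1 * v p.2)
    rw [hI, ← intervalIntegral.integral_const_mul]
    refine intervalIntegral.integral_mono_on hτ ?_ (tX.const_mul CT) fun s hs => ?_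
    · refine intervalIntegrable_integral_cube (Ψ := fun s x =>
        taylorρ f ((a + s • b) x) ((a₂ + s • b₂) x) ((a' + s • b') x) ((a₂' + s • b₂') x) * b' x +
        taylorη f ((a + s • b) x) ((a₂ + s • b₂) x) ((a' + s • b') x) ((a₂' + s • b₂') x)
          * b₂' x) hτ ?_
      exact ((hf.continuous_taylorρ (hl hac hbc) (hl hac₂ hbc₂) (hl hac' hbc')
        (hl hac₂' hbc₂')).mul (hbc'.continuous.comp continuous_snd)).add
        ((hf.continuous_taylorη (hl hac hbc) (hl hac₂ hbc₂) (hl hac' hbc')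
        (hl hac₂' hbc₂')).mul (hbc₂'.continuous.comp continuous_snd))
    · exact htay α κ f hf _ _ _ _ _ _ (hline s hac hbc) (hline s hac₂ hbc₂) (hline s hac' hbc')
        (hline s hac₂' hbc₂') hbc'.continuous hbc₂'.continuous (hBa s hs) (hBa₂ s hs) (hBa' s hs)
        (hBa₂' s hs) hBb hBb₂
  have hM := hs.sq_mean_sub_le hs' hℓ hτ hf fun s hs =>
    hmean α κ f hf _ _ _ _ (hline s hac hbc) (hline s hac₂ hbc₂) (hline s hac' hbc')
      (hline s hac₂' hbc₂') (hBa s hs) (hBa₂ s hs) (hBa' s hs) (hBa₂' s hs)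
  rw [← hI, ← hV] at hM
  rw [hid]
  set D := dissipation ℓ L z (m - m') (q - q')
  set μ := ∫ x in cube d ℓ, (m - m') x
  set n₁ := normHneg1 ℓ r₁ ^ 2
  have hn₁ : 0 ≤ τ * n₁ := mul_nonneg hτ (sq_nonneg _)
  have hn₂ := mul_nonneg hτ (ip_self_nonneg (ℓ := ℓ) r₂)
  have hn₃ := mul_nonneg hτ (H1sq_nonneg (ℓ := ℓ) r₃)
  have hn₄ := mul_nonneg hτ (ip_self_nonneg (ℓ := ℓ) r₄)
  have hr₃ : ip ℓ r₃ r₃ ≤ H1sq ℓ r₃ := le_add_of_nonneg_right (gg_self_nonneg r₃)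
  have hvv := mul_nonneg hΛ0 (ip_self_nonneg (ℓ := ℓ) (r₃ + α • e))
  have s1 := mul_le_mul_of_nonneg_left htest hτ
  have s2 : (Λ + 1 / 2) * (H1sq ℓ (r₃ + α • e) + ip ℓ (r₄ + α • g) (r₄ + α • g)) ≤
      (2 * Λ + 1) * (H1sq ℓ r₃ + ip ℓ r₄ r₄) + (2 * Λ + 1) * α ^ 2 * (H1sq ℓ e + H1sq ℓ g) := by
    have := mul_le_mul_of_nonneg_left (add_le_add hv hw) (by positivity : 0 ≤ Λ + 1 / 2)
    linarith
  have s3 := mul_le_mul_of_nonneg_left s2 hτ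
  have s4 := mul_le_mul_of_nonneg_left hmid (by positivity : 0 ≤ (2 * Λ + 1) * α ^ 2)
  have s5 := mul_le_mul_of_nonneg_left hM (by positivity : 0 ≤ lam₁ / 4)
  have s6 := mul_le_mul_of_nonneg_left (mul_le_mul_of_nonneg_left hr₃ hτ)
    (by positivity : 0 ≤ lam₁ / 2 * V)
  have s7 := mul_nonneg hτ hvv
  have hp1 : 0 ≤ (P + 1) / lam₁ := by positivity
  have hp2 : 0 ≤ 1 / lam₁ := by positivity
  have hp3 : 0 ≤ lam₁ / 2 * V := by positivity
  have k1 : ((P + 1) / lam₁ + 1 / 2) * (τ * n₁) ≤ K * (τ * n₁) :=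
    mul_le_mul_of_nonneg_right (by linarith) hn₁
  have k2 : (1 / lam₁ + 1 / 2) * (τ * ip ℓ r₂ r₂) ≤ K * (τ * ip ℓ r₂ r₂) :=
    mul_le_mul_of_nonneg_right (by linarith) hn₂
  have k3 : (2 * Λ + 1 + lam₁ / 2 * V) * (τ * H1sq ℓ r₃) ≤ K * (τ * H1sq ℓ r₃) :=
    mul_le_mul_of_nonneg_right (by linarith) hn₃
  have k4 : (2 * Λ + 1) * (τ * ip ℓ r₄ r₄) ≤ K * (τ * ip ℓ r₄ r₄) :=
    mul_le_mul_of_nonneg_right (by linarith) hn₄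
  have hIA : A * I = CT * I + (2 * Λ + 1) * α ^ 2 * I + lam₁ / 2 * CF * I := by rw [hA]; ring
  linarith

end Estimate

end CHAC
end

/-! ### Assembly of the estimate -/

namespace CHAC

lemma node_add_mem_Icc {τ : ℝ} {n N : ℕ} (hτ : 0 ≤ τ) (hn : n < N) {s : ℝ}
    (hs : s ∈ Set.Icc 0 τ) : node τ n + s ∈ Set.Icc 0 (node τ N) := by
  have h1 : node τ (n + 1) ≤ node τ N :=
    mul_le_mul_of_nonneg_right (Nat.cast_le.2 (by omega)) hτ
  have h2 : 0 ≤ node τ n := mul_nonneg n.cast_nonneg hτ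
  rw [node_succ] at h1
  exact ⟨by linarith [hs.1], by linarith [hs.2]⟩

end CHAC

theorem theorem3 (d : ℕ) (hd : d = 2 ∨ d = 3) (ℓ T γρ γη lam₁ lam₂ lam₃ c₁ c₂ α κ σ M : ℝ)
    (hℓ : 0 < ℓ) (hT : 0 < T) (hγρ : 0 < γρ) (hγη : 0 < γη) (hlam₁ : 0 < lam₁)
    (hα : 0 < α) (hκ : 0 < κ) (hσ : 0 < σ) :
    ∃ C₁ C₂ C₃ : ℝ, 0 < C₁ ∧ 0 < C₂ ∧ 0 < C₃ ∧
      ∀ (L : CHAC.Mobility d), CHAC.MobilityAssumption lam₁ lam₂ lam₃ L →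
      ∀ (f : ℝ → ℝ → ℝ), CHAC.PotentialAssumption c₁ c₂ α κ f →
      ∀ (Th : CHAC.PeriodicMesh d ℓ), Th.QuasiUniform σ →
      ∀ (N : ℕ) (τ : ℝ), 1 ≤ N → τ = T / N →
      ∀ (ρ₀ η₀ : CHAC.E d → ℝ), ρ₀ ∈ Th.Vh → η₀ ∈ Th.Vh →
        CHAC.normH1 ℓ ρ₀ ≤ M → CHAC.normH1 ℓ η₀ ≤ M →
      ∀ (ρ η μρ μη : ℝ → CHAC.E d → ℝ),
        CHAC.IsDiscreteSolution ℓ τ N Th.Vh γρ γη L f ρ₀ η₀ ρ η μρ μη →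
      ∀ (ρ' η' μρ' μη' r₁ r₂ r₃ r₄ : ℝ → CHAC.E d → ℝ),
        CHAC.IsPerturbedSolution ℓ τ N Th.Vh γρ γη L f ρ η ρ' η' μρ' μη' r₁ r₂ r₃ r₄ →
        CHAC.IsBoundedBy ℓ τ N M ρ' η' →
      ∀ n < N,
        (CHAC.relEnergy ℓ γρ γη α f
            (ρ (CHAC.node τ (n + 1))) (η (CHAC.node τ (n + 1)))
            (ρ' (CHAC.node τ (n + 1))) (η' (CHAC.node τ (n + 1)))
          - CHAC.relEnergy ℓ γρ γη α f
            (ρ (CHAC.node τ n)) (η (CHAC.node τ n)) (ρ' (CHAC.node τ n)) (η' (CHAC.node τ n)))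
        + C₁ * ∫ t in (CHAC.node τ n)..(CHAC.node τ (n + 1)),
            CHAC.dissipation ℓ L (CHAC.stateBar ℓ τ n ρ η) (μρ t - μρ' t) (μη t - μη' t)
        ≤ C₂ * (∫ t in (CHAC.node τ n)..(CHAC.node τ (n + 1)),
            CHAC.relEnergy ℓ γρ γη α f (ρ t) (η t) (ρ' t) (η' t))
        + C₃ * ∫ t in (CHAC.node τ n)..(CHAC.node τ (n + 1)),
            (CHAC.normHneg1 ℓ (r₁ t) ^ 2 + CHAC.normL2 ℓ (r₂ t) ^ 2
              + CHAC.normH1 ℓ (r₃ t) ^ 2 + CHAC.normL2 ℓ (r₄ t) ^ 2) := by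
  obtain ⟨B, hB, hbound⟩ := CHAC.exists_H1sq_bound hd hℓ hγρ hγη hlam₁ lam₂ lam₃ c₁ c₂ α κ T M
  -- One common bound: `B` for the unperturbed solution and `M ^ 2` for the perturbed one and its
  -- time derivative.
  obtain ⟨C₂, C₃, hC₂, hC₃, hstep⟩ := CHAC.exists_step_constants hd hℓ hγρ hγη hlam₁ hκ lam₂ lam₃
    c₁ c₂ α (B + M ^ 2) (by positivity)
  refine ⟨1 / 2, C₂, C₃, by norm_num, hC₂, hC₃, ?_⟩
  intro L hL f hf Th _ N τ hN hτN ρ₀ η₀ hρ₀ hη₀ hρM hηM ρ η μρ μη hs ρ' η' μρ' μη' r₁ r₂ r₃ r₄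
    hs' hb n hn
  have hN0 : (0 : ℝ) < N := Nat.cast_pos.2 (by omega)
  have hτ : 0 < τ := by rw [hτN]; positivity
  have hNT : CHAC.node τ N ≤ T := by
    rw [CHAC.node, hτN]; exact (mul_div_cancel₀ T hN0.ne').le
  have hbd := hbound L hL f hf Th N τ hτ hNT ρ₀ η₀ hρ₀ hη₀ hρM hηM ρ η μρ μη hs
  have hz := CHAC.aestronglyMeasurable_stateBar hℓ hτ hs.ρ_mem hs.η_mem hn
  obtain ⟨a, b, a₂, b₂, m, q, hst, hae, hme⟩ := hs.exists_isStep hτ hL hn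
  obtain ⟨a', b', a₂', b₂', m', q', s₁, s₂, s₃, s₄, hst', hae', hme'⟩ :=
    CHAC.exists_isStep hτ hn hL hs'.ρ_mem hs'.η_mem hs'.μρ_mem hs'.μη_mem hs'.r₁_mem hs'.r₂_mem
      hs'.r₃_mem hs'.r₄_mem (hs'.eq₁ n hn) (hs'.eq₂ n hn) (hs'.eq₃ n hn) (hs'.eq₄ n hn)
  have hz0 : (0 : ℝ) ∈ Set.Icc 0 τ := ⟨le_rfl, hτ.le⟩
  have hzτ : τ ∈ Set.Icc 0 τ := ⟨hτ.le, le_rfl⟩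
  have hBM : B ≤ B + M ^ 2 := le_add_of_nonneg_right (sq_nonneg M)
  have hMB : M ^ 2 ≤ B + M ^ 2 := le_add_of_nonneg_left hB
  have e0 := hae 0 hz0
  have e0' := hae' 0 hz0
  have eτ := hae τ hzτ
  have eτ' := hae' τ hzτ
  simp only [add_zero, zero_smul] at e0 e0'
  simp only [← CHAC.node_succ] at eτ eτ'
  have hseg : ∀ {u v : CHAC.E d → ℝ}, u ∈ Th.Vh → v ∈ Th.Vh → CHAC.H1sq ℓ u ≤ B →
      CHAC.H1sq ℓ (u + τ • v) ≤ B → ∀ s ∈ Set.Icc 0 τ, CHAC.H1sq ℓ (u + s • v) ≤ B + M ^ 2 :=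
    fun hu hv h0 h1 s hs => (CHAC.H1sq_segment_le hℓ (Th.lipPer_of_mem_Vh hℓ hu)
      (Th.lipPer_of_mem_Vh hℓ hv) hτ hs h0 h1).trans hBM
  obtain ⟨n1, n2⟩ := hbd n hn.le
  obtain ⟨n3, n4⟩ := hbd (n + 1) hn
  rw [e0.1] at n1
  rw [e0.2] at n2
  rw [eτ.1] at n3
  rw [eτ.2] at n4
  -- The time derivative is constant on the open step, so its bound is read off at one interior
  -- time.
  have hhalf : τ / 2 ∈ Set.Ioo 0 τ := ⟨by linarith, by linarith⟩
  have hmid : CHAC.node τ n + τ / 2 ∈ Set.Ioo (CHAC.node τ n) (CHAC.node τ (n + 1)) := by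
    rw [CHAC.node_succ]
    exact ⟨by linarith, by linarith⟩
  have hL2 : ∀ {u : CHAC.E d → ℝ}, CHAC.normL2 ℓ u ≤ M → CHAC.ip ℓ u u ≤ B + M ^ 2 := fun {u} h => by
    rw [← CHAC.normL2_sq]
    exact (pow_le_pow_left₀ (Real.sqrt_nonneg _) h 2).trans hMB
  have hdρ := hb.ρ_dt n hn _ hmid
  have hdη := hb.η_dt n hn _ hmid
  rw [(hme' _ hhalf).1] at hdρ
  rw [(hme' _ hhalf).2.1] at hdη
  have key := hstep L hL f hf Th τ _ hτ.le hz a b a₂ b₂ m q a' b' a₂' b₂' m' q' s₁ s₂ s₃ s₄ hst hst'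
    (hseg hst.a_mem hst.b_mem n1 n3) (hseg hst.a₂_mem hst.b₂_mem n2 n4)
    (fun s hs => by
      have := hb.ρ_H1 _ (CHAC.node_add_mem_Icc hτ.le hn hs)
      rw [(hae' s hs).1] at this
      exact (CHAC.H1sq_le_of_normH1_le this).trans hMB)
    (fun s hs => by
      have := hb.η_H1 _ (CHAC.node_add_mem_Icc hτ.le hn hs)
      rw [(hae' s hs).2] at this
      exact (CHAC.H1sq_le_of_normH1_le this).trans hMB)
    (hL2 hdρ) (hL2 hdη)
  rw [e0.1, e0.2, e0'.1, e0'.2, eτ.1, eτ.2, eτ'.1, eτ'.2, CHAC.integral_node, CHAC.integral_node,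
    CHAC.integral_node]
  have i1 := CHAC.intervalIntegral_eq_mul hτ.le (g := fun s => CHAC.dissipation ℓ L
    (CHAC.stateBar ℓ τ n ρ η) (μρ (CHAC.node τ n + s) - μρ' (CHAC.node τ n + s))
    (μη (CHAC.node τ n + s) - μη' (CHAC.node τ n + s))) fun s hs => by
      simp only [(hme s hs).1, (hme s hs).2, (hme' s hs).2.2.1, (hme' s hs).2.2.2.1]
      rfl
  have i2 := CHAC.intervalIntegral_congr_Ioo hτ.le (g := fun s => CHAC.relEnergy ℓ γρ γη α f
    (ρ (CHAC.node τ n + s)) (η (CHAC.node τ n + s)) (ρ' (CHAC.node τ n + s))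
    (η' (CHAC.node τ n + s))) fun s hs => by
      have hs := Set.Ioo_subset_Icc_self hs
      simp only [(hae s hs).1, (hae s hs).2, (hae' s hs).1, (hae' s hs).2]
      rfl
  have i3 := CHAC.intervalIntegral_eq_mul hτ.le (g := fun s =>
    CHAC.normHneg1 ℓ (r₁ (CHAC.node τ n + s)) ^ 2 + CHAC.normL2 ℓ (r₂ (CHAC.node τ n + s)) ^ 2 +
    CHAC.normH1 ℓ (r₃ (CHAC.node τ n + s)) ^ 2 + CHAC.normL2 ℓ (r₄ (CHAC.node τ n + s)) ^ 2)
    fun s hs => by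
      obtain ⟨-, -, -, -, h1, h2, h3, h4⟩ := hme' s hs
      simp only [h1, h2, h3, h4, CHAC.normH1_sq, CHAC.normL2_sq]
      rfl
  rw [i1, i2, i3]
  exact key
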